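/- Let $n\ge 1$ and let $J:\mathbb R^n\to\mathbb R\cup\{+\infty\}$ be proper, lower semicontinuous and convex, with $\operatorname{int}(\operatorname{dom}J)\neq\varnothing$ and $\inf J=0$, where $\operatorname{dom}J=\{J<+\infty\}$. Let $\operatorname{dom}\partial J$ be the set of $x\in\operatorname{dom}J$ at which $J$ has a subgradient, and let $|\cdot|$ be the Euclidean norm. For $x\in\mathbb R^n$, $t>0$, $\epsilon>0$ put $$Z_J(x,t,\epsilon)=\int_{\mathbb R^n}e^{-\left(\frac{1}{2t}|x-y|^2+J(y)\right)/\epsilon}\,dy,\qquad S_\epsilon(x,t)=-\epsilon\ln\Big(\frac{1}{(2\pi t\epsilon)^{n/2}}Z_J(x,t,\epsilon)\Big)$$ (with $e^{-\infty}=0$), let $\mathbb E_J[f(y)]=Z_J(x,t,\epsilon)^{-1}\int f(y)\,e^{-(\frac1{2t}|x-y|^2+J(y))/\epsilon}dy$ be the posterior expectation, $u_{PM}(x,t,\epsilon)=\mathbb E_J[y]$ the posterior mean and $\mathbb E_J[|y-u_{PM}(x,t,\epsilon)|^2]$ the MSE; these integrals converge and $Z_J>0$. Let $S_0(x,t)=\inf_y\{\frac1{2t}|x-y|^2+J(y)\}$.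 Then: **(i)** For every $\epsilon>0$, $S_\epsilon$ is the unique $C^\infty$ function $\mathbb R^n\times(0,\infty)\to[0,\infty)$ that solves $$\partial_tS+\tfrac12|\nabla_xS|^2=\tfrac{\epsilon}{2}\Delta_xS\quad\text{in }\mathbb R^n\times(0,\infty)$$ with initial data $J$, in the sense that $\lim_{t\to0^+}S(x,t)=J(x)$ in $\mathbb R\cup\{+\infty\}$ for every $x\in\operatorname{int}(\operatorname{dom}J)$ and every $x\notin\operatorname{dom}J$. The sets $\operatorname{dom}J$, $\operatorname{int}(\operatorname{dom}J)$ and $\operatorname{dom}\partial J$ coincide up to Lebesgue null sets, and the domain of integration in $Z_J$ can be taken to be any of them. If $x\in\operatorname{dom}J\setminus\operatorname{int}(\operatorname{dom}J)$, then $\liminf_{t\to0^+}S_\epsilon(x,t)\ge J(x)$ and $$\limsup_{t\to0^+}S_\epsilon(x,t)\le J(x)-\epsilon\ln\Big(\frac1{(2\pi\epsilon)^{n/2}}\int_{\operatorname{dom}J}e^{-\frac1{2\epsilon}|x-y|^2}dy\Big).$$ **(ii)** (a) For every $\epsilon>0$, $(x,t)\mapsto S_\epsilon(x,t)-\frac{n\epsilon}2\ln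 t$ is jointly convex on $\mathbb R^n\times(0,\infty)$. (b) For all $x$ and $\epsilon>0$, $t\mapsto S_\epsilon(x,t)-\frac{n\epsilon}2\ln t$ is strictly decreasing on $(0,\infty)$. (c) For all $x$ and $t>0$, $\epsilon\mapsto\frac1\epsilon S_\epsilon(x,t)-\frac n2\ln\epsilon$ is strictly decreasing on $(0,\infty)$. (d) For all $t,\epsilon>0$, $x\mapsto\frac12|x|^2-tS_\epsilon(x,t)$ is strictly convex on $\mathbb R^n$. **(iii)** For all $x$ and $t,\epsilon>0$, $u_{PM}(x,t,\epsilon)=x-t\nabla_xS_\epsilon(x,t)$, $u_{PM}$ is differentiable in $x$, and $$\mathbb E_J\big[|y-u_{PM}(x,t,\epsilon)|^2\big]=t\epsilon\,\nabla_x\cdot u_{PM}(x,t,\epsilon)=nt\epsilon-t^2\epsilon\,\Delta_xS_\epsilon(x,t).$$ Moreover, $x\mapsto u_{PM}(x,t,\epsilon)$ is a bijection of $\mathbb R^n$ onto $\operatorname{int}(\operatorname{dom}J)$. **(iv)** $S_0$ is finite, continuously differentiable and jointly convex on $\mathbb R^n\times(0,\infty)$, and satisfies $\partial_tS_0+\frac12|\nabla_xS_0|^2=0$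 there and $\lim_{t\to0^+}S_0(x,t)=J(x)$ for every $x\in\mathbb R^n$; the infimum defining $S_0(x,t)$ is attained at a unique point $u_{MAP}(x,t)$. As $\epsilon\to0^+$, $$S_\epsilon\to S_0,\quad\nabla_xS_\epsilon\to\nabla_xS_0,\quad\partial_tS_\epsilon\to\partial_tS_0,\quad\tfrac\epsilon2\Delta_xS_\epsilon\to0,\quad u_{PM}(\cdot,\cdot,\epsilon)\to u_{MAP},$$ pointwise on $\mathbb R^n\times(0,\infty)$ and uniformly on each of its compact subsets. -/

import Mathlib

open Set Filter Topology MeasureTheory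
open scoped ContDiff

noncomputable section

namespace ViscousHJ

/-- The Euclidean space `ℝⁿ`. -/
abbrev E (n : ℕ) := EuclideanSpace ℝ (Fin n)

variable {n : ℕ}

/-- The effective domain `dom J = {x | J x < +∞}`. -/
def effDom (J : E n → EReal) : Set (E n) := {x | J x < ⊤}

/-- Proper, convex, lower semicontinuous functions `ℝⁿ → ℝ ∪ {+∞}`. -/
structure IsGammaZero (J : E n → EReal) : Prop where
  ne_bot : ∀ x, J x ≠ ⊥
  dom_nonempty : (effDom J).Nonempty
  dom_convex : Convex ℝ (effDom J)
  convex : ∀ x ∈ effDom J, ∀ y ∈ effDom J, ∀ a : ℝ, 0 < a → a < 1 →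
    J (a • x + (1 - a) • y) ≤ (a : EReal) * J x + ((1 - a : ℝ) : EReal) * J y
  lsc : LowerSemicontinuous J

/-- The standing assumptions on the regularization term `J`. -/
structure IsRegularizer (J : E n → EReal) : Prop where
  gammaZero : IsGammaZero J
  interior_dom_nonempty : (interior (effDom J)).Nonempty
  iInf_eq_zero : ⨅ y, J y = 0

/-- `dom ∂J`: the points of `dom J` at which `J` has a subgradient. -/
def subdiffDom (J : E n → EReal) : Set (E n) :=
  {x | x ∈ effDom J ∧ ∃ p : E n, ∀ y, J x + ((inner ℝ p (y - x) : ℝ) : EReal) ≤ J y}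

open Classical in
/-- The unnormalized posterior density `y ↦ exp(-(‖x - y‖² / (2t) + J y) / ε)`,
with `exp(-∞) = 0`. -/
def weight (J : E n → EReal) (x : E n) (t ε : ℝ) (y : E n) : ℝ :=
  if J y = ⊤ then 0 else Real.exp (-(‖x - y‖ ^ 2 / (2 * t) + (J y).toReal) / ε)

/-- The partition function `Z_J(x,t,ε)`. -/
def partitionFn (J : E n → EReal) (x : E n) (t ε : ℝ) : ℝ := ∫ y, weight J x t ε y

/-- The expectation of `f` under the posterior distribution. -/
def expect {F : Type*} [NormedAddCommGroup F] [NormedSpace ℝ F]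
    (J : E n → EReal) (x : E n) (t ε : ℝ) (f : E n → F) : F :=
  (partitionFn J x t ε)⁻¹ • ∫ y, weight J x t ε y • f y

/-- The posterior mean estimate. -/
def uPM (J : E n → EReal) (x : E n) (t ε : ℝ) : E n := expect J x t ε (fun y => y)

/-- The mean squared error of the posterior mean estimate. -/
def mse (J : E n → EReal) (x : E n) (t ε : ℝ) : ℝ :=
  expect J x t ε (fun y => ‖y - uPM J x t ε‖ ^ 2)

/-- `S_ε(x,t) = -ε ln((2πtε)^{-n/2} Z_J(x,t,ε))`, for `t > 0`. -/
def Seps (J : E n → EReal) (ε : ℝ) (x : E n) (t : ℝ) : ℝ :=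
  -ε * Real.log (1 / (2 * Real.pi * t * ε) ^ ((n : ℝ) / 2) * partitionFn J x t ε)

/-- The cost `y ↦ ‖x - y‖² / (2t) + J y` of the convex minimization problem. -/
def mapCost (J : E n → EReal) (x : E n) (t : ℝ) (y : E n) : EReal :=
  ((‖x - y‖ ^ 2 / (2 * t) : ℝ) : EReal) + J y

/-- The Lax–Oleinik function `S_0(x,t) = inf_y {‖x - y‖² / (2t) + J y}`, for `t > 0`. -/
def S0 (J : E n → EReal) (x : E n) (t : ℝ) : ℝ := (⨅ y, mapCost J x t y).toReal

/-- The MAP estimate: a minimizer of `y ↦ ‖x - y‖² / (2t) + J y`. -/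
def uMAP (J : E n → EReal) (x : E n) (t : ℝ) : E n :=
  Classical.epsilon fun u => ∀ y, mapCost J x t u ≤ mapCost J x t y

/-- The spatial gradient `∇ₓ S(x,t)`. -/
def gradX (S : E n → ℝ → ℝ) (x : E n) (t : ℝ) : E n := gradient (fun z => S z t) x

/-- The time derivative `∂S/∂t (x,t)`. -/
def derivT (S : E n → ℝ → ℝ) (x : E n) (t : ℝ) : ℝ := deriv (fun s => S x s) t

/-- The spatial Laplacian `Δₓ S(x,t)`. -/
def lapX (S : E n → ℝ → ℝ) (x : E n) (t : ℝ) : ℝ := Laplacian.laplacian (fun z => S z t) x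

/-- The divergence `∑ᵢ ∂Fᵢ/∂xᵢ` of a vector field. -/
def divergence (F : E n → E n) (x : E n) : ℝ :=
  ∑ i, (fderiv ℝ F x (EuclideanSpace.single i 1)) i

/-- The open space-time domain `ℝⁿ × (0,+∞)`. -/
def spaceTime (n : ℕ) : Set (E n × ℝ) := univ ×ˢ Ioi 0

/-- Smooth solutions with values in `[0,+∞)` of the viscous Hamilton–Jacobi equation
`∂ₜS + ½‖∇S‖² = (ε/2) ΔS` on `ℝⁿ × (0,+∞)` with initial data `J`. The initial data are attained
as pointwise limits for `t → 0⁺` in `ℝ ∪ {+∞}`, at every point that is not a boundary point of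
`dom J` belonging to `dom J` (at such boundary points the limit may differ from `J`). -/
structure IsViscousSolution (J : E n → EReal) (ε : ℝ) (S : E n → ℝ → ℝ) : Prop where
  nonneg : ∀ x, ∀ t > 0, 0 ≤ S x t
  smooth : ContDiffOn ℝ ∞ (fun p : E n × ℝ => S p.1 p.2) (spaceTime n)
  pde : ∀ x, ∀ t > 0,
    derivT S x t + 1 / 2 * ‖gradX S x t‖ ^ 2 = ε / 2 * lapX S x t
  initial : ∀ x, x ∉ effDom J \ interior (effDom J) →
    Tendsto (fun t => (S x t : EReal)) (𝓝[>] 0) (𝓝 (J x))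

/-- Continuously differentiable, jointly convex solutions of the first-order Hamilton–Jacobi
equation `∂ₜS + ½‖∇S‖² = 0` on `ℝⁿ × (0,+∞)` with initial data `J`. -/
structure IsFirstOrderSolution (J : E n → EReal) (S : E n → ℝ → ℝ) : Prop where
  contDiff : ContDiffOn ℝ 1 (fun p : E n × ℝ => S p.1 p.2) (spaceTime n)
  convex : ConvexOn ℝ (spaceTime n) (fun p : E n × ℝ => S p.1 p.2)
  pde : ∀ x, ∀ t > 0, derivT S x t + 1 / 2 * ‖gradX S x t‖ ^ 2 = 0
  initial : ∀ x, Tendsto (fun t => (S x t : EReal)) (𝓝[>] 0) (𝓝 (J x))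

/-- `F ε x t → f x t` as `ε → 0⁺`, pointwise on `ℝⁿ × (0,+∞)` and uniformly on each of its compact
subsets. -/
def ConvergesLocUnif {β : Type*} [PseudoMetricSpace β]
    (F : ℝ → E n → ℝ → β) (f : E n → ℝ → β) : Prop :=
  (∀ x, ∀ t > 0, Tendsto (fun ε => F ε x t) (𝓝[>] 0) (𝓝 (f x t))) ∧
  ∀ K : Set (E n × ℝ), K ⊆ spaceTime n → IsCompact K →
    TendstoUniformlyOn (fun ε (p : E n × ℝ) => F ε p.1 p.2) (fun p => f p.1 p.2) (𝓝[>] 0) K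

end ViscousHJ

end

/-! The Hopf–Cole substitution carries the proof: `exp (-S_ε / ε)` is the heat semigroup at time `t
* ε` applied to the prior `exp (-J / ε)`, a measurable function with values in `[0, 1]`. Viscous
solutions thus become bounded solutions of the linear heat equation.

For (i), the Gaussian kernel is the exponential of a functional linear in its natural parameters, so
Gaussian integrals are smooth and can be differentiated under the integral sign
(`ExpIntegrableOn.contDiffOn`). A nonnegative solution `S` has `exp (-S / ε) ≤ 1`, so a maximum
principle on the whole space represents it by its values at a time `τ > 0`, and dominated
convergence lets `τ → 0`. Initial data almost everywhere suffice, because the frontier of the convex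
set `dom J` is null. Strong convexity of the cost gives `S_0 ≤ S_ε` (`S0_le_Seps`), hence
nonnegativity and the lower initial bound; convexity of `J` along segments from `x` gives the upper
bound on the limsup.

For (ii), the weight is jointly log-concave in `(x, t, y)`, so by Prékopa–Leindler its integral is
log-concave in `(x, t)`. Monotonicity in `t` and `ε` is pointwise monotonicity of the weight. Strict
convexity in `x` is the strict Hölder inequality, whose equality case is confined to a hyperplane.

For (iii), the posterior mean is the gradient of the strictly convex potential `‖x‖² / 2 - t S_ε`.
Strict convexity gives injectivity, separation places the barycentre in `int (dom J)`, and
minimizing the coercive function obtained by subtracting `⟪z, x⟫` gives surjectivity. Comparing two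
expressions for the Laplacian of `exp (-S_ε / ε)` gives the mean squared error.

For (iv), `S_0` lies between an affine minorant and a smooth majorant that touch at a given point
with the same differential, which yields differentiability, joint convexity and the equation
together. Integrating over a small ball contracted towards the minimizer gives `S_ε ≤ S_0 + O(ε) +
O(ε |log ε|)` locally uniformly. Convexity upgrades this to convergence of first derivatives, and
the equation itself then handles the Laplacian term. -/

noncomputable section

namespace ViscousHJ

/-! ### The Prékopa–Leindler inequality. -/

section PrekopaLeindler

open scoped ENNReal

/-- One-dimensional Brunn–Minkowski. For compact `K ⊆ A` and `L ⊆ B`, the translates `K + min L` and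
`max K + L` both lie in `C` and share at most the point `max K + min L`. Inner regularity passes
from compact to measurable sets. -/
theorem volume_add_volume_le_of_add_subset {A B C : Set ℝ} (hA : MeasurableSet A)
    (hB : MeasurableSet B) (hA0 : A.Nonempty) (hB0 : B.Nonempty)
    (h : ∀ x ∈ A, ∀ y ∈ B, x + y ∈ C) : volume A + volume B ≤ volume C := by
  obtain ⟨a0, ha0⟩ := hA0
  obtain ⟨b0, hb0⟩ := hB0
  have hAC : volume A ≤ volume C := by
    rw [← measure_preimage_add_right volume (-b0) A]
    refine measure_mono fun z hz => ?_
    simpa using h _ hz b0 hb0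
  have hBC : volume B ≤ volume C := by
    rw [← measure_preimage_add_right volume (-a0) B]
    refine measure_mono fun z hz => ?_
    simpa [add_comm] using h a0 ha0 _ hz
  by_cases hC : volume C = ⊤
  · simp [hC]
  have hAf : volume A ≠ ⊤ := ne_top_of_le_ne_top hC hAC
  have hBf : volume B ≠ ⊤ := ne_top_of_le_ne_top hC hBC
  refine ENNReal.le_of_forall_pos_le_add fun e he _ => ?_
  have he2 : (e / 2 : ℝ≥0∞) ≠ 0 := by simp [he.ne']
  obtain ⟨K, hKA, hK, hKv⟩ := hA.exists_isCompact_lt_add hAf he2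
  obtain ⟨L, hLB, hL, hLv⟩ := hB.exists_isCompact_lt_add hBf he2
  have key : ∀ K L : Set ℝ, K ⊆ A → L ⊆ B → IsCompact K → IsCompact L → K.Nonempty →
      L.Nonempty → volume K + volume L ≤ volume C := by
    intro K L hKA hLB hK hL hK0 hL0
    obtain ⟨k, hkK, hk⟩ := hK.exists_isGreatest hK0
    obtain ⟨l, hlL, hl⟩ := hL.exists_isLeast hL0
    have e1 : volume ((fun z => z + -l) ⁻¹' K) = volume K := measure_preimage_add_right _ _ _
    have e2 : volume ((fun z => z + -k) ⁻¹' L) = volume L := measure_preimage_add_right _ _ _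
    have hd : AEDisjoint volume ((fun z => z + -l) ⁻¹' K) ((fun z => z + -k) ⁻¹' L) := by
      refine measure_mono_null (t := {k + l}) ?_ (by simp)
      rintro z ⟨hz1, hz2⟩
      have := hk hz1
      have := hl hz2
      simp only [mem_singleton_iff]
      linarith
    rw [← e1, ← e2, ← measure_union₀ ((hL.measurableSet.preimage
      (measurable_add_const _)).nullMeasurableSet) hd]
    refine measure_mono ?_
    rintro z (hz | hz)
    · simpa using h _ (hKA hz) l (hLB hlL)
    · simpa [add_comm] using h k (hKA hkK) _ (hLB hz)
  -- The compact approximations may be empty, so a point of each set is adjoined.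
  have := key (K ∪ {a0}) (L ∪ {b0}) (union_subset hKA (by simpa)) (union_subset hLB (by simpa))
    (hK.union isCompact_singleton) (hL.union isCompact_singleton) (by simp) (by simp)
  calc volume A + volume B ≤ (volume K + e / 2) + (volume L + e / 2) := by gcongr
    _ = volume K + volume L + e := by
      rw [add_add_add_comm, ENNReal.add_halves]
    _ ≤ volume (K ∪ {a0}) + volume (L ∪ {b0}) + e := by
      gcongr <;> exact subset_union_left
    _ ≤ _ := by gcongr

theorem mul_volume_add_mul_volume_le {A B C : Set ℝ} (hA : MeasurableSet A)
    (hB : MeasurableSet B) (hA0 : A.Nonempty) (hB0 : B.Nonempty) {a b : ℝ} (ha : 0 < a)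
    (hb : 0 < b) (h : ∀ x ∈ A, ∀ y ∈ B, a * x + b * y ∈ C) :
    ENNReal.ofReal a * volume A + ENNReal.ofReal b * volume B ≤ volume C := by
  have e : ∀ {c : ℝ}, 0 < c → ∀ S : Set ℝ,
      ENNReal.ofReal c * volume S = volume ((fun z => c⁻¹ * z) ⁻¹' S) := by
    intro c hc S
    rw [Real.volume_preimage_mul_left (inv_ne_zero hc.ne'), inv_inv, abs_of_pos hc]
  rw [e ha, e hb]
  refine volume_add_volume_le_of_add_subset (hA.preimage (measurable_const_mul _))
    (hB.preimage (measurable_const_mul _)) ?_ ?_ ?_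
  · obtain ⟨x, hx⟩ := hA0
    exact ⟨a * x, by simpa [ha.ne'] using hx⟩
  · obtain ⟨x, hx⟩ := hB0
    exact ⟨b * x, by simpa [hb.ne'] using hx⟩
  · intro x hx y hy
    have := h _ hx _ hy
    rwa [← mul_assoc, ← mul_assoc, mul_inv_cancel₀ ha.ne', mul_inv_cancel₀ hb.ne', one_mul,
      one_mul] at this

/-- Layer-cake formula; superlevel sets at levels `s ≥ 1` are empty. -/
theorem lintegral_eq_lintegral_Ioo_meas_lt {f : ℝ → ℝ≥0∞} (hf : Measurable f)
    (h1 : ∀ x, f x ≤ 1) :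
    ∫⁻ x, f x = ∫⁻ s in Ioo (0 : ℝ) 1, volume {x | ENNReal.ofReal s < f x} := by
  have hlt : ∀ x, f x ≠ ⊤ := fun x => ne_top_of_le_ne_top ENNReal.one_ne_top (h1 x)
  have e1 : ∫⁻ x, f x = ∫⁻ x, ENNReal.ofReal (f x).toReal :=
    lintegral_congr fun x => (ENNReal.ofReal_toReal (hlt x)).symm
  rw [e1, lintegral_eq_lintegral_meas_lt volume (ae_of_all _ fun x => ENNReal.toReal_nonneg)
    hf.ennreal_toReal.aemeasurable]
  rw [← lintegral_indicator measurableSet_Ioi, ← lintegral_indicator measurableSet_Ioo]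
  refine lintegral_congr fun s => ?_
  by_cases hs : 0 < s
  · rw [indicator_of_mem (mem_Ioi.2 hs)]
    have e : {a | s < (f a).toReal} = {x | ENNReal.ofReal s < f x} := by
      ext x
      exact (ENNReal.ofReal_lt_iff_lt_toReal hs.le (hlt x)).symm
    by_cases hs1 : s < 1
    · rw [indicator_of_mem (mem_Ioo.2 ⟨hs, hs1⟩), e]
    · rw [indicator_of_notMem (fun h => hs1 h.2), e]
      have : {x | ENNReal.ofReal s < f x} = ∅ := by
        ext x
        simp only [mem_ofPred_eq, mem_empty_iff_false, iff_false, not_lt]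
        exact (h1 x).trans (by simpa using not_lt.1 hs1)
      simp [this]
  · rw [indicator_of_notMem (by simpa using hs), indicator_of_notMem (fun h => hs h.1)]

/-- Since both suprema are `1`, both superlevel sets are nonempty at every level `s < 1`.
Brunn–Minkowski therefore applies level by level, and layer cake integrates the result. -/
theorem add_le_lintegral_of_iSup_eq_one {f g h : ℝ → ℝ≥0∞} (hf : Measurable f)
    (hg : Measurable g) (hh : Measurable h) {a b : ℝ} (ha : 0 < a) (hb : 0 < b) (hab : a + b = 1)
    (hf1 : ⨆ x, f x = 1) (hg1 : ⨆ x, g x = 1)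
    (hfgh : ∀ x y, f x ^ a * g y ^ b ≤ h (a * x + b * y)) :
    ENNReal.ofReal a * (∫⁻ x, f x) + ENNReal.ofReal b * (∫⁻ x, g x) ≤ ∫⁻ x, h x := by
  -- Truncating `h` at `1` makes all three layer-cake integrals run over the same levels.
  calc _ ≤ ∫⁻ x, min (h x) 1 := ?_
    _ ≤ _ := lintegral_mono fun x => min_le_left _ _
  rw [lintegral_eq_lintegral_Ioo_meas_lt hf (fun x => hf1 ▸ le_iSup f x),
    lintegral_eq_lintegral_Ioo_meas_lt hg (fun x => hg1 ▸ le_iSup g x),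
    lintegral_eq_lintegral_Ioo_meas_lt (hh.min measurable_const) (fun x => min_le_right _ _),
    ← lintegral_const_mul' _ _ ENNReal.ofReal_ne_top,
    ← lintegral_const_mul' _ _ ENNReal.ofReal_ne_top, ← lintegral_add_left]
  · refine setLIntegral_mono' measurableSet_Ioo fun s hs => ?_
    have hs1 : ENNReal.ofReal s < 1 := by simpa using hs.2
    refine mul_volume_add_mul_volume_le (measurableSet_lt measurable_const hf)
      (measurableSet_lt measurable_const hg) ?_ ?_ ha hb ?_
    · rw [← hf1] at hs1
      exact lt_iSup_iff.1 hs1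
    · rw [← hg1] at hs1
      exact lt_iSup_iff.1 hs1
    · intro x hx y hy
      simp only [mem_ofPred_eq] at hx hy ⊢
      refine lt_min (lt_of_lt_of_le ?_ (hfgh x y)) hs1
      have hs0 : ENNReal.ofReal s ≠ 0 := by simpa using hs.1
      calc ENNReal.ofReal s = ENNReal.ofReal s ^ a * ENNReal.ofReal s ^ b := by
            rw [← ENNReal.rpow_add _ _ hs0 ENNReal.ofReal_ne_top, hab, ENNReal.rpow_one]
        _ < f x ^ a * g y ^ b :=
            ENNReal.mul_lt_mul (ENNReal.rpow_lt_rpow hx ha) (ENNReal.rpow_lt_rpow hy hb)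
  · refine Measurable.const_mul ?_ _
    refine Antitone.measurable fun s t hst => measure_mono fun x hx => ?_
    exact lt_of_le_of_lt (ENNReal.ofReal_le_ofReal hst) hx

/-- Dividing by the suprema reduces to the normalized additive inequality; the weighted
arithmetic–geometric mean inequality turns it into the multiplicative one. -/
theorem prekopaLeindler_real_of_bounded {f g h : ℝ → ℝ≥0∞} (hf : Measurable f)
    (hg : Measurable g) (hh : Measurable h) {a b : ℝ} (ha : 0 < a) (hb : 0 < b) (hab : a + b = 1)
    (hf0 : ⨆ x, f x ≠ 0) (hg0 : ⨆ x, g x ≠ 0) (hfb : ⨆ x, f x ≠ ⊤) (hgb : ⨆ x, g x ≠ ⊤)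
    (hfgh : ∀ x y, f x ^ a * g y ^ b ≤ h (a * x + b * y)) :
    (∫⁻ x, f x) ^ a * (∫⁻ x, g x) ^ b ≤ ∫⁻ x, h x := by
  set M := ⨆ x, f x with hM
  set N := ⨆ x, g x with hN
  set P := M ^ a * N ^ b with hP
  have hMa : M ^ a ≠ 0 := by simp [hf0, hfb]
  have hMa' : M ^ a ≠ ⊤ := by simp [hf0, hfb]
  have hNb : N ^ b ≠ 0 := by simp [hg0, hgb]
  have hNb' : N ^ b ≠ ⊤ := by simp [hg0, hgb]
  have hP0 : P ≠ 0 := mul_ne_zero hMa hNb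
  have hPt : P ≠ ⊤ := ENNReal.mul_ne_top hMa' hNb'
  have key := add_le_lintegral_of_iSup_eq_one (f := fun x => M⁻¹ * f x) (g := fun x => N⁻¹ * g x)
    (h := fun x => P⁻¹ * h x) (hf.const_mul _) (hg.const_mul _) (hh.const_mul _) ha hb hab
    (by rw [← ENNReal.mul_iSup, ENNReal.inv_mul_cancel hf0 hfb])
    (by rw [← ENNReal.mul_iSup, ENNReal.inv_mul_cancel hg0 hgb])
    (by
      intro x y
      rw [ENNReal.mul_rpow_of_nonneg _ _ ha.le, ENNReal.mul_rpow_of_nonneg _ _ hb.le,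
        mul_mul_mul_comm, ENNReal.inv_rpow, ENNReal.inv_rpow, hP,
        ENNReal.mul_inv (Or.inl hMa) (Or.inl hMa')]
      gcongr
      exact hfgh x y)
  rw [lintegral_const_mul _ hf, lintegral_const_mul _ hg, lintegral_const_mul _ hh] at key
  have amgm : ∀ u v : ℝ≥0∞, u ^ a * v ^ b ≤ ENNReal.ofReal a * u + ENNReal.ofReal b * v := by
    intro u v
    by_cases hu : u = ⊤
    · simp [hu, ha]
    by_cases hv : v = ⊤
    · simp [hv, hb]
    lift u to NNReal using hu
    lift v to NNReal using hv
    have := NNReal.geom_mean_le_arith_mean2_weighted a.toNNReal b.toNNReal u v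
      (by rw [← Real.toNNReal_add ha.le hb.le, hab, Real.toNNReal_one])
    rw [Real.coe_toNNReal _ ha.le, Real.coe_toNNReal _ hb.le] at this
    rw [← ENNReal.coe_rpow_of_nonneg _ ha.le, ← ENNReal.coe_rpow_of_nonneg _ hb.le]
    simp only [ENNReal.ofReal]
    exact_mod_cast this
  have h2 := (amgm _ _).trans key
  rw [ENNReal.mul_rpow_of_nonneg _ _ ha.le, ENNReal.mul_rpow_of_nonneg _ _ hb.le,
        mul_mul_mul_comm, ENNReal.inv_rpow, ENNReal.inv_rpow, 
        ← ENNReal.mul_inv (Or.inl hMa) (Or.inl hMa')] at h2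
  exact (ENNReal.mul_le_mul_iff_right (ENNReal.inv_ne_zero.2 hPt) (ENNReal.inv_ne_top.2 hP0)).1 h2

theorem tendsto_lintegral_min_natCast {f : ℝ → ℝ≥0∞} (hf : Measurable f) :
    Tendsto (fun k : ℕ => ∫⁻ x, min (f x) k) atTop (𝓝 (∫⁻ x, f x)) := by
  refine lintegral_tendsto_of_tendsto_of_monotone
    (fun k => (hf.min measurable_const).aemeasurable)
    (ae_of_all _ fun x i j hij => by
      refine min_le_min_left _ ?_
      exact_mod_cast hij) (ae_of_all _ fun x => ?_)
  have := (tendsto_const_nhds (x := f x)).min ENNReal.tendsto_nat_nhds_top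
  simpa using this

theorem prekopaLeindler_real {f g h : ℝ → ℝ≥0∞} (hf : Measurable f)
    (hg : Measurable g) (hh : Measurable h) {a b : ℝ} (ha : 0 < a) (hb : 0 < b) (hab : a + b = 1)
    (hfgh : ∀ x y, f x ^ a * g y ^ b ≤ h (a * x + b * y)) :
    (∫⁻ x, f x) ^ a * (∫⁻ x, g x) ^ b ≤ ∫⁻ x, h x := by
  by_cases hf0 : ∫⁻ x, f x = 0
  · simp [hf0, ha]
  by_cases hg0 : ∫⁻ x, g x = 0
  · simp [hg0, hb]
  have hlim : Tendsto (fun k : ℕ => (∫⁻ x, min (f x) k) ^ a * (∫⁻ x, min (g x) k) ^ b) atTop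
      (𝓝 ((∫⁻ x, f x) ^ a * (∫⁻ x, g x) ^ b)) := by
    refine ENNReal.Tendsto.mul ((ENNReal.continuous_rpow_const.tendsto _).comp
      (tendsto_lintegral_min_natCast hf)) (Or.inl ?_)
      ((ENNReal.continuous_rpow_const.tendsto _).comp
      (tendsto_lintegral_min_natCast hg)) (Or.inl ?_)
    · simp [hf0, ha.le]
    · simp [hg0, hb.le]
  -- Boundedness is removed by truncating `f` and `g` at height `k`; for `k ≥ 1` the truncations
  -- still have nonzero supremum.
  refine le_of_tendsto hlim (eventually_atTop.2 ⟨1, fun k hk => ?_⟩)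
  have hk0 : (k : ℝ≥0∞) ≠ 0 := by
    have : k ≠ 0 := by omega
    exact_mod_cast this
  have pos : ∀ f : ℝ → ℝ≥0∞, ∫⁻ x, f x ≠ 0 → ⨆ x, min (f x) (k : ℝ≥0∞) ≠ 0 := by
    intro f hf0 h
    apply hf0
    have : ∀ x, f x = 0 := by
      intro x
      have h1 : min (f x) (k : ℝ≥0∞) ≤ 0 := h ▸ le_iSup (fun x => min (f x) (k : ℝ≥0∞)) x
      rcases min_le_iff.1 h1 with h1 | h1
      · simpa using h1
      · exact absurd (le_antisymm h1 bot_le) hk0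
    simp [this]
  have fin : ∀ f : ℝ → ℝ≥0∞, ⨆ x, min (f x) (k : ℝ≥0∞) ≠ ⊤ := fun f =>
    ne_top_of_le_ne_top (ENNReal.natCast_ne_top k) (iSup_le fun x => min_le_right _ _)
  refine prekopaLeindler_real_of_bounded (hf.min measurable_const) (hg.min measurable_const) hh ha
    hb hab (pos f hf0) (pos g hg0) (fin f) (fin g) fun x y => le_trans ?_ (hfgh x y)
  gcongr <;> exact min_le_left _ _

theorem lintegral_pi_succ {n : ℕ} {f : (Fin (n + 1) → ℝ) → ℝ≥0∞} (hf : Measurable f) :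
    ∫⁻ x, f x = ∫⁻ s : ℝ, ∫⁻ v : Fin n → ℝ, f (Fin.insertNth 0 s v) := by
  rw [← ((volume_preserving_piFinSuccAbove (fun _ : Fin (n + 1) => ℝ) 0).symm _).lintegral_comp hf,
    Measure.volume_eq_prod, lintegral_prod]
  · rfl
  · exact (hf.comp (MeasurableEquiv.measurable _)).aemeasurable

/-- Induction on the dimension: slices over first coordinates `s`, `s'` satisfy the hypothesis in
dimension `n`, so their integrals, as functions of the first coordinate, satisfy the one-dimensional
hypothesis. -/
theorem prekopaLeindler_pi {n : ℕ} {f g h : (Fin n → ℝ) → ℝ≥0∞} (hf : Measurable f)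
    (hg : Measurable g) (hh : Measurable h) {a b : ℝ} (ha : 0 < a) (hb : 0 < b) (hab : a + b = 1)
    (hfgh : ∀ x y, f x ^ a * g y ^ b ≤ h (a • x + b • y)) :
    (∫⁻ x, f x) ^ a * (∫⁻ x, g x) ^ b ≤ ∫⁻ x, h x := by
  induction n with
  | zero =>
    have e : ∀ f : (Fin 0 → ℝ) → ℝ≥0∞, ∫⁻ x, f x = f default := by
      intro f
      rw [lintegral_unique, Measure.volume_pi_eq_dirac (default : Fin 0 → ℝ)]
      simp only [measure_univ, mul_one]
      exact congrArg f (Subsingleton.elim _ _)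
    rw [e, e, e]
    refine (hfgh _ _).trans (le_of_eq ?_)
    congr 1
    exact Subsingleton.elim _ _
  | succ n ih =>
    have meas : Measurable fun p : ℝ × (Fin n → ℝ) =>
        (Fin.insertNth 0 p.1 p.2 : Fin (n + 1) → ℝ) :=
      (MeasurableEquiv.piFinSuccAbove (fun _ : Fin (n + 1) => ℝ) 0).symm.measurable
    have meas' : ∀ s : ℝ, Measurable fun v : Fin n → ℝ =>
        (Fin.insertNth 0 s v : Fin (n + 1) → ℝ) := fun s => meas.comp measurable_prodMk_left
    have measI : ∀ {f : (Fin (n + 1) → ℝ) → ℝ≥0∞}, Measurable f →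
        Measurable fun s : ℝ => ∫⁻ v : Fin n → ℝ, f (Fin.insertNth 0 s v) := fun hf =>
      (hf.comp meas).lintegral_prod_right'
    rw [lintegral_pi_succ hf, lintegral_pi_succ hg, lintegral_pi_succ hh]
    refine prekopaLeindler_real (measI hf) (measI hg) (measI hh) ha hb hab fun s s' => ?_
    refine ih (f := fun v => f (Fin.insertNth 0 s v)) (g := fun v => g (Fin.insertNth 0 s' v))
      (h := fun v => h (Fin.insertNth 0 (a * s + b * s') v)) (hf.comp (meas' s))
      (hg.comp (meas' s')) (hh.comp (meas' _)) fun v w => ?_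
    refine (hfgh _ _).trans (le_of_eq ?_)
    congr 1
    ext i
    refine Fin.cases ?_ (fun i => ?_) i <;> simp [Fin.insertNth_zero']

/-- The **Prékopa–Leindler inequality** on the Euclidean space. -/
theorem prekopaLeindler {n : ℕ} {f g h : E n → ℝ≥0∞} (hf : Measurable f)
    (hg : Measurable g) (hh : Measurable h) {a b : ℝ} (ha : 0 < a) (hb : 0 < b) (hab : a + b = 1)
    (hfgh : ∀ x y, f x ^ a * g y ^ b ≤ h (a • x + b • y)) :
    (∫⁻ x, f x) ^ a * (∫⁻ x, g x) ^ b ≤ ∫⁻ x, h x := by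
  have mp := PiLp.volume_preserving_toLp (Fin n)
  rw [← mp.lintegral_comp hf, ← mp.lintegral_comp hg, ← mp.lintegral_comp hh]
  refine prekopaLeindler_pi (hf.comp mp.measurable) (hg.comp mp.measurable)
    (hh.comp mp.measurable) ha hb hab fun x y => ?_
  simpa using hfgh (WithLp.toLp 2 x) (WithLp.toLp 2 y)

end PrekopaLeindler

end ViscousHJ

namespace ViscousHJ

/-! ### Smoothness of integrals of exponentials of a linear parameter. -/

section Laplace

variable {α : Type} [MeasurableSpace α] {μ : Measure α}
  {V : Type} [NormedAddCommGroup V] [NormedSpace ℝ V]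
  {W : Type} [NormedAddCommGroup W] [NormedSpace ℝ W]

/-- `F` is integrable against the exponentials `exp (ℓ y θ)`, locally uniformly in `θ ∈ U`. -/
structure ExpIntegrableOn (ℓ : α → V →L[ℝ] ℝ) (F : α → W) (μ : Measure α) (U : Set V) : Prop where
  meas : AEStronglyMeasurable F μ
  integrable : ∀ θ ∈ U, ∃ r > 0, Integrable (fun y => Real.exp (ℓ y θ + r * ‖ℓ y‖) * ‖F y‖) μ

theorem ExpIntegrableOn.integrable_exp_smul {ℓ : α → V →L[ℝ] ℝ} {F : α → W} {U : Set V}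
    (hℓ : AEStronglyMeasurable ℓ μ) (h : ExpIntegrableOn ℓ F μ U) {θ : V} (hθ : θ ∈ U) :
    Integrable (fun y => Real.exp (ℓ y θ) • F y) μ := by
  obtain ⟨r, hr, hi⟩ := h.integrable θ hθ
  refine hi.mono' ?_ (ae_of_all _ fun y => ?_)
  · exact (Real.continuous_exp.comp_aestronglyMeasurable
      (hℓ.apply_continuousLinearMap θ)).smul h.meas
  · rw [norm_smul, Real.norm_eq_abs, Real.abs_exp]
    gcongr
    have : 0 ≤ r * ‖ℓ y‖ := by positivity
    linarith

/-- Differentiating in `θ` brings down a factor `ℓ y`. Half of the exponential margin `r` absorbs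
it, so the class is stable under differentiation. -/
theorem ExpIntegrableOn.smulRight {ℓ : α → V →L[ℝ] ℝ} {F : α → W} {U : Set V}
    (hℓ : AEStronglyMeasurable ℓ μ) (h : ExpIntegrableOn ℓ F μ U) :
    ExpIntegrableOn ℓ (fun y => (ℓ y).smulRight (F y)) μ U := by
  have hm : AEStronglyMeasurable (fun y => (ℓ y).smulRight (F y)) μ :=
    (ContinuousLinearMap.smulRightL ℝ V W).aestronglyMeasurable_comp₂ hℓ h.meas
  refine ⟨hm, fun θ hθ => ?_⟩
  obtain ⟨r, hr, hi⟩ := h.integrable θ hθ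
  refine ⟨r / 2, by positivity, (hi.const_mul (2 / r)).mono' ?_ (ae_of_all _ fun y => ?_)⟩
  · exact (Real.continuous_exp.comp_aestronglyMeasurable
      ((hℓ.apply_continuousLinearMap θ).add (hℓ.norm.const_mul _))).mul hm.norm
  · rw [ContinuousLinearMap.norm_smulRight_apply, Real.norm_of_nonneg (by positivity)]
    have h1 : ‖ℓ y‖ ≤ 2 / r * Real.exp (r / 2 * ‖ℓ y‖) := by
      have := Real.add_one_le_exp (r / 2 * ‖ℓ y‖)
      calc ‖ℓ y‖ = 2 / r * (r / 2 * ‖ℓ y‖) := by field_simp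
        _ ≤ _ := by gcongr; linarith
    calc Real.exp (ℓ y θ + r / 2 * ‖ℓ y‖) * (‖ℓ y‖ * ‖F y‖)
        ≤ Real.exp (ℓ y θ + r / 2 * ‖ℓ y‖) * ((2 / r * Real.exp (r / 2 * ‖ℓ y‖)) * ‖F y‖) := by
          gcongr
      _ = 2 / r * ((Real.exp (ℓ y θ + r / 2 * ‖ℓ y‖) * Real.exp (r / 2 * ‖ℓ y‖)) * ‖F y‖) := by
          ring
      _ = _ := by
        rw [← Real.exp_add]
        congr 3
        ring

theorem ExpIntegrableOn.hasFDerivAt {ℓ : α → V →L[ℝ] ℝ} {F : α → W} {U : Set V}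
    (hℓ : AEStronglyMeasurable ℓ μ) (h : ExpIntegrableOn ℓ F μ U) {θ : V} (hθ : θ ∈ U) :
    HasFDerivAt (fun θ => ∫ y, Real.exp (ℓ y θ) • F y ∂μ)
      (∫ y, Real.exp (ℓ y θ) • (ℓ y).smulRight (F y) ∂μ) θ := by
  obtain ⟨r, hr, hi⟩ := (h.smulRight hℓ).integrable θ hθ
  have hexp : ∀ θ, AEStronglyMeasurable (fun y => Real.exp (ℓ y θ)) μ := fun θ =>
    Real.continuous_exp.comp_aestronglyMeasurable (hℓ.apply_continuousLinearMap θ)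
  refine hasFDerivAt_integral_of_dominated_of_fderiv_le (𝕜 := ℝ)
    (F' := fun θ y => Real.exp (ℓ y θ) • (ℓ y).smulRight (F y)) (Metric.ball_mem_nhds θ hr)
    (Eventually.of_forall fun θ => (hexp θ).smul h.meas) (h.integrable_exp_smul hℓ hθ)
    ((hexp θ).smul (h.smulRight hℓ).meas) (ae_of_all _ fun y θ' hθ' => ?_) hi
    (ae_of_all _ fun y θ' _ => ?_)
  · rw [norm_smul, Real.norm_eq_abs, Real.abs_exp]
    gcongr
    have e : ℓ y θ' = ℓ y θ + ℓ y (θ' - θ) := by rw [map_sub]; ring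
    rw [e]
    gcongr
    refine (le_abs_self _).trans (((ℓ y).le_opNorm _).trans ?_)
    rw [mul_comm]
    gcongr
    exact (mem_ball_iff_norm.1 hθ').le
  · have := ((ℓ y).hasFDerivAt (x := θ')).exp.smul_const (F y)
    convert this using 1
    ext v
    simp [smul_smul]

/-- The derivative is an integral of the same form with values in `V →L[ℝ] W`, so the induction must
quantify over the target space. -/
theorem ExpIntegrableOn.contDiffOn_nat {ℓ : α → V →L[ℝ] ℝ} {U : Set V}
    (hℓ : AEStronglyMeasurable ℓ μ) (hU : IsOpen U) (m : ℕ) :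
    ∀ {W : Type} [NormedAddCommGroup W] [NormedSpace ℝ W] {F : α → W},
    ExpIntegrableOn ℓ F μ U →
    ContDiffOn ℝ m (fun θ => ∫ y, Real.exp (ℓ y θ) • F y ∂μ) U := by
  induction m with
  | zero =>
    intro W _ _ F h
    exact contDiffOn_zero.2 fun θ hθ => (h.hasFDerivAt hℓ hθ).continuousAt.continuousWithinAt
  | succ m ih =>
    intro W _ _ F h
    push_cast
    rw [contDiffOn_succ_iff_fderiv_of_isOpen hU]
    refine ⟨fun θ hθ => (h.hasFDerivAt hℓ hθ).differentiableAt.differentiableWithinAt, by simp, ?_⟩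
    exact (ih (h.smulRight hℓ)).congr fun θ hθ => (h.hasFDerivAt hℓ hθ).fderiv

theorem ExpIntegrableOn.contDiffOn {ℓ : α → V →L[ℝ] ℝ} {F : α → W} {U : Set V}
    (hℓ : AEStronglyMeasurable ℓ μ) (hU : IsOpen U) (h : ExpIntegrableOn ℓ F μ U) :
    ContDiffOn ℝ ∞ (fun θ => ∫ y, Real.exp (ℓ y θ) • F y ∂μ) U :=
  contDiffOn_infty.2 fun m => h.contDiffOn_nat hℓ hU m

end Laplace

/-! ### Gaussian integrals in their natural parameters. -/

section Gauss

variable {n : ℕ}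

theorem integrable_exp_mul_norm_sub_sq (c : ℝ) {d : ℝ} (hd : 0 < d) :
    Integrable (fun y : E n => Real.exp (c * ‖y‖ - d * ‖y‖ ^ 2)) := by
  have h0 : Integrable (fun y : E n => Real.exp (-(d / 2) * ‖y‖ ^ 2)) := by
    have := (GaussianFourier.integrable_cexp_neg_mul_sq_norm_add (V := E n) (b := (d / 2 : ℝ))
      (by simpa using hd) 0 0).norm
    refine this.congr (ae_of_all _ fun y => ?_)
    simp only [Complex.norm_exp]
    congr 1
    simp [← Complex.ofReal_pow, -Complex.ofReal_mul,
      -Complex.ofReal_neg, -Complex.ofReal_div]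
  refine (h0.const_mul (Real.exp (c ^ 2 / (2 * d)))).mono' (by fun_prop) (ae_of_all _ fun y => ?_)
  rw [Real.norm_eq_abs, Real.abs_exp, ← Real.exp_add]
  gcongr
  -- Completing the square: half of the quadratic decay pays for the linear term.
  have : c ^ 2 / (2 * d) + -(d / 2) * ‖y‖ ^ 2 - (c * ‖y‖ - d * ‖y‖ ^ 2)
      = (c - d * ‖y‖) ^ 2 / (2 * d) := by
    field_simp
    ring
  have h2 : 0 ≤ (c - d * ‖y‖) ^ 2 / (2 * d) := by positivity
  linarith

/-- The linear functional `(a, b, c) ↦ ⟪a, y⟫ - b * ‖y‖ ^ 2 - c`. -/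
def gaussFun (y : E n) : (E n × ℝ × ℝ) →L[ℝ] ℝ :=
  (innerSL ℝ y).comp (ContinuousLinearMap.fst ℝ (E n) (ℝ × ℝ))
    - (‖y‖ ^ 2) • (ContinuousLinearMap.fst ℝ ℝ ℝ).comp (ContinuousLinearMap.snd ℝ (E n) (ℝ × ℝ))
    - (ContinuousLinearMap.snd ℝ ℝ ℝ).comp (ContinuousLinearMap.snd ℝ (E n) (ℝ × ℝ))

theorem gaussFun_apply (y a : E n) (b c : ℝ) :
    gaussFun y (a, b, c) = inner ℝ y a - ‖y‖ ^ 2 * b - c := by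
  simp [gaussFun]

theorem continuous_gaussFun : Continuous (gaussFun (n := n)) := by
  unfold gaussFun
  fun_prop

theorem norm_gaussFun_le (y : E n) : ‖gaussFun y‖ ≤ ‖y‖ + ‖y‖ ^ 2 + 1 := by
  refine ContinuousLinearMap.opNorm_le_bound _ (by positivity) fun ⟨a, b, c⟩ => ?_
  have ha : ‖a‖ ≤ ‖(a, b, c)‖ := norm_fst_le (a, b, c)
  have hb : |b| ≤ ‖(a, b, c)‖ := (norm_fst_le (b, c)).trans (norm_snd_le (a, b, c))
  have hc : |c| ≤ ‖(a, b, c)‖ := (norm_snd_le (b, c)).trans (norm_snd_le (a, b, c))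
  rw [gaussFun_apply]
  calc ‖inner ℝ y a - ‖y‖ ^ 2 * b - c‖ ≤ ‖inner ℝ y a‖ + ‖‖y‖ ^ 2 * b‖ + ‖c‖ :=
        (norm_sub_le _ _).trans (by gcongr; exact norm_sub_le _ _)
    _ ≤ ‖y‖ * ‖a‖ + ‖y‖ ^ 2 * |b| + |c| := by
        gcongr
        · exact norm_inner_le_norm y a
        · rw [norm_mul, Real.norm_of_nonneg (by positivity), Real.norm_eq_abs]
        · exact le_rfl
    _ ≤ ‖y‖ * ‖(a, b, c)‖ + ‖y‖ ^ 2 * ‖(a, b, c)‖ + ‖(a, b, c)‖ := by gcongr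
    _ = _ := by ring

theorem expIntegrableOn_gaussFun {W : Type} [NormedAddCommGroup W] [NormedSpace ℝ W]
    {F : E n → W} (hF : AEStronglyMeasurable F) {C : ℝ} (hC : ∀ y, ‖F y‖ ≤ C * (1 + ‖y‖ ^ 2)) :
    ExpIntegrableOn gaussFun F volume {θ : E n × ℝ × ℝ | 0 < θ.2.1} := by
  refine ⟨hF, fun ⟨a, b, c⟩ hb => ?_⟩
  replace hb : 0 < b := hb
  have hC0 : 0 ≤ C := by simpa using (norm_nonneg _).trans (hC 0)
  -- One `r` pays for the norm of `gaussFun y`, another for the quadratic growth of `F`; of the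
  -- decay rate `b` there remains `b - 2 * r = b / 2`.
  set r := b / 4 with hr
  have hr0 : 0 < r := by positivity
  refine ⟨r, hr0, ((integrable_exp_mul_norm_sub_sq (n := n) (‖a‖ + r) (d := b / 2)
    (by positivity)).const_mul (C / r * Real.exp (2 * r - c))).mono' ?_ (ae_of_all _ fun y => ?_)⟩
  · refine Continuous.aestronglyMeasurable ?_ |>.mul hF.norm
    have := continuous_gaussFun (n := n)
    fun_prop
  · rw [Real.norm_of_nonneg (by positivity), gaussFun_apply]
    have h1 : 1 + ‖y‖ ^ 2 ≤ 1 / r * Real.exp (r * (1 + ‖y‖ ^ 2)) := by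
      have := Real.add_one_le_exp (r * (1 + ‖y‖ ^ 2))
      calc 1 + ‖y‖ ^ 2 = 1 / r * (r * (1 + ‖y‖ ^ 2)) := by field_simp
        _ ≤ _ := by gcongr; linarith
    have h2 : inner ℝ y a ≤ ‖a‖ * ‖y‖ := by
      rw [mul_comm]
      exact real_inner_le_norm y a
    calc Real.exp (inner ℝ y a - ‖y‖ ^ 2 * b - c + r * ‖gaussFun y‖) * ‖F y‖
        ≤ Real.exp (‖a‖ * ‖y‖ - ‖y‖ ^ 2 * b - c + r * (‖y‖ + ‖y‖ ^ 2 + 1)) *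
          (C * (1 / r * Real.exp (r * (1 + ‖y‖ ^ 2)))) := by
          gcongr
          · exact norm_gaussFun_le y
          · exact (hC y).trans (by gcongr)
      _ = C / r * (Real.exp (‖a‖ * ‖y‖ - ‖y‖ ^ 2 * b - c + r * (‖y‖ + ‖y‖ ^ 2 + 1)) *
          Real.exp (r * (1 + ‖y‖ ^ 2))) := by ring
      _ = _ := by
        rw [← Real.exp_add, mul_assoc, ← Real.exp_add]
        congr 2
        rw [hr]
        ring

/-- The Gaussian weight `exp (-‖x - y‖ ^ 2 / (2 * s))`. -/
def gauss (x : E n) (s : ℝ) (y : E n) : ℝ := Real.exp (-(‖x - y‖ ^ 2 / (2 * s)))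

/-- The natural parameters of the Gaussian weight. -/
def gaussParam (x : E n) (s : ℝ) : E n × ℝ × ℝ := (s⁻¹ • x, (2 * s)⁻¹, ‖x‖ ^ 2 / (2 * s))

theorem gauss_pos (x : E n) (s : ℝ) (y : E n) : 0 < gauss x s y := Real.exp_pos _

/-- In the coordinates `gaussParam` the exponent is linear, which makes the preceding smoothness
results available; the dependence on `(x, s)` then follows by the chain rule. -/
theorem gauss_eq (x : E n) {s : ℝ} (hs : 0 < s) (y : E n) :
    gauss x s y = Real.exp (gaussFun y (gaussParam x s)) := by
  rw [gauss, gaussParam, gaussFun_apply]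
  congr 1
  rw [norm_sub_sq_real, inner_smul_right, real_inner_comm]
  field_simp
  ring

theorem continuous_gauss (x : E n) (s : ℝ) : Continuous (gauss x s) := by
  unfold gauss
  fun_prop

section Class

variable {W : Type} [NormedAddCommGroup W] [NormedSpace ℝ W]
  {F : E n → W}

theorem integrable_gauss_smul (hF : AEStronglyMeasurable F) {C : ℝ}
    (hC : ∀ y, ‖F y‖ ≤ C * (1 + ‖y‖ ^ 2)) (x : E n) {s : ℝ} (hs : 0 < s) :
    Integrable fun y => gauss x s y • F y := by
  simp_rw [gauss_eq x hs]
  exact (expIntegrableOn_gaussFun hF hC).integrable_exp_smul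
    continuous_gaussFun.aestronglyMeasurable
    (show 0 < (gaussParam x s).2.1 by simp only [gaussParam]; positivity)

theorem contDiffOn_gaussParam :
    ContDiffOn ℝ ∞ (fun p : E n × ℝ => gaussParam p.1 p.2) (spaceTime n) := by
  have h : ∀ p ∈ spaceTime n, p.2 ≠ 0 := fun p hp => (mem_Ioi.1 hp.2).ne'
  have h2 : ∀ p ∈ spaceTime n, 2 * p.2 ≠ 0 := fun p hp => mul_ne_zero two_ne_zero (h p hp)
  unfold gaussParam
  refine ContDiffOn.prodMk ?_ (ContDiffOn.prodMk ?_ ?_)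
  · exact (contDiffOn_snd.inv h).smul contDiffOn_fst
  · exact (contDiffOn_const.mul contDiffOn_snd).inv h2
  · exact (contDiffOn_fst.norm_sq ℝ).div (contDiffOn_const.mul contDiffOn_snd) h2

theorem contDiffOn_integral_gauss (hF : AEStronglyMeasurable F) {C : ℝ}
    (hC : ∀ y, ‖F y‖ ≤ C * (1 + ‖y‖ ^ 2)) :
    ContDiffOn ℝ ∞ (fun p : E n × ℝ => ∫ y, gauss p.1 p.2 y • F y) (spaceTime n) := by
  have hU : IsOpen {θ : E n × ℝ × ℝ | 0 < θ.2.1} :=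
    isOpen_lt continuous_const (by fun_prop)
  have h := ((expIntegrableOn_gaussFun hF hC).contDiffOn
    continuous_gaussFun.aestronglyMeasurable hU).comp contDiffOn_gaussParam (fun p hp => by
      have : 0 < p.2 := hp.2
      simp only [gaussParam, mem_ofPred_eq]
      positivity)
  refine h.congr fun p hp => ?_
  simp only [Function.comp]
  refine integral_congr_ae (ae_of_all _ fun y => ?_)
  simp only [gauss_eq p.1 hp.2 y]

theorem hasFDerivAt_integral_gauss (hF : AEStronglyMeasurable F) {C : ℝ}
    (hC : ∀ y, ‖F y‖ ≤ C * (1 + ‖y‖ ^ 2)) (x : E n) {s : ℝ} (hs : 0 < s) :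
    ∃ L : E n →L[ℝ] W, HasFDerivAt (fun x => ∫ y, gauss x s y • F y) L x ∧
      ∀ h, Integrable (fun y => gauss x s y • ((inner ℝ (y - x) h / s) • F y)) ∧
        L h = ∫ y, gauss x s y • ((inner ℝ (y - x) h / s) • F y) := by
  have hℓ := (continuous_gaussFun (n := n)).aestronglyMeasurable (μ := volume)
  have hE := expIntegrableOn_gaussFun hF hC
  have hθ : gaussParam x s ∈ {θ : E n × ℝ × ℝ | 0 < θ.2.1} := by
    simp only [gaussParam, mem_ofPred_eq]
    positivity
  have h1 := hE.hasFDerivAt hℓ hθ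
  have h2 : HasFDerivAt (fun x : E n => gaussParam x s)
      ((s⁻¹ • ContinuousLinearMap.id ℝ (E n)).prod ((0 : E n →L[ℝ] ℝ).prod
        ((2 * s)⁻¹ • (2 • innerSL ℝ x)))) x := by
    unfold gaussParam
    have e1 : HasFDerivAt (fun z : E n => s⁻¹ • z) (s⁻¹ • ContinuousLinearMap.id ℝ (E n)) x :=
      (hasFDerivAt_id x).const_smul s⁻¹
    refine HasFDerivAt.prodMk e1
      (HasFDerivAt.prodMk (hasFDerivAt_const _ _) ?_)
    have := (hasStrictFDerivAt_norm_sq x).hasFDerivAt.const_mul (2 * s)⁻¹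
    simpa [div_eq_inv_mul] using this
  have h3 := h1.comp x h2
  have hsame : ∀ h y, Real.exp (gaussFun y (gaussParam x s)) •
      ((gaussFun y).smulRight (F y)) (((s⁻¹ • ContinuousLinearMap.id ℝ (E n)).prod
        ((0 : E n →L[ℝ] ℝ).prod ((2 * s)⁻¹ • (2 • innerSL ℝ x)))) h) =
      gauss x s y • ((inner ℝ (y - x) h / s) • F y) := by
    intro h y
    rw [gauss_eq x hs, ContinuousLinearMap.smulRight_apply]
    congr 2
    simp only [ContinuousLinearMap.prod_apply, gaussFun_apply]
    simp [inner_smul_right, inner_sub_left]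
    field_simp
  have hint := (hE.smulRight hℓ).integrable_exp_smul hℓ hθ
  refine ⟨_, h3.congr_of_eventuallyEq (Eventually.of_forall fun z => ?_), fun h => ⟨?_, ?_⟩⟩
  · simp only [Function.comp, gauss_eq z hs]
  · have := hint.apply_continuousLinearMap (((s⁻¹ • ContinuousLinearMap.id ℝ (E n)).prod
        ((0 : E n →L[ℝ] ℝ).prod ((2 * s)⁻¹ • (2 • innerSL ℝ x)))) h)
    refine this.congr (ae_of_all _ fun y => ?_)
    simp only [← hsame]
    rfl
  · rw [ContinuousLinearMap.comp_apply, ContinuousLinearMap.integral_apply hint]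
    refine integral_congr_ae (ae_of_all _ fun y => ?_)
    simp only [← hsame]
    rfl

theorem hasDerivAt_integral_gauss (hF : AEStronglyMeasurable F) {C : ℝ}
    (hC : ∀ y, ‖F y‖ ≤ C * (1 + ‖y‖ ^ 2)) (x : E n) {s : ℝ} (hs : 0 < s) :
    HasDerivAt (fun s => ∫ y, gauss x s y • F y)
      (∫ y, gauss x s y • ((‖x - y‖ ^ 2 / (2 * s ^ 2)) • F y)) s := by
  have hℓ := (continuous_gaussFun (n := n)).aestronglyMeasurable (μ := volume)
  have hE := expIntegrableOn_gaussFun hF hC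
  have hθ : gaussParam x s ∈ {θ : E n × ℝ × ℝ | 0 < θ.2.1} := by
    simp only [gaussParam, mem_ofPred_eq]
    positivity
  have h1 := hE.hasFDerivAt hℓ hθ
  have h2 : HasDerivAt (fun s : ℝ => gaussParam x s)
      ((-(s ^ 2)⁻¹) • x, -(2 * (s ^ 2))⁻¹, -(‖x‖ ^ 2 / (2 * s ^ 2))) s := by
    unfold gaussParam
    have hi : HasDerivAt (fun s : ℝ => (2 * s)⁻¹) (-(2 * (s ^ 2))⁻¹) s := by
      have := ((hasDerivAt_id s).const_mul 2).inv (by simpa using hs.ne')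
      refine this.congr_deriv ?_
      change -(2 * 1) / (2 * s) ^ 2 = _
      field_simp
    refine HasDerivAt.prodMk ?_ (HasDerivAt.prodMk hi ?_)
    · exact (hasDerivAt_inv hs.ne').smul_const x
    · have := hi.const_mul (‖x‖ ^ 2)
      simp only [div_eq_mul_inv]
      exact this.congr_deriv (by ring)
  have h3 := h1.comp_hasDerivAt s h2
  have hint := (hE.smulRight hℓ).integrable_exp_smul hℓ hθ
  rw [ContinuousLinearMap.integral_apply hint] at h3
  refine (h3.congr_of_eventuallyEq ?_).congr_deriv ?_
  · filter_upwards [lt_mem_nhds hs] with z hz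
    simp only [Function.comp, gauss_eq x hz]
  · refine integral_congr_ae (ae_of_all _ fun y => ?_)
    simp only [smul_apply, ContinuousLinearMap.smulRight_apply, gauss_eq x hs,
      gaussFun_apply]
    congr 2
    rw [norm_sub_sq_real, inner_smul_right, real_inner_comm]
    field_simp
    ring

end Class

end Gauss

end ViscousHJ

/-! ### Calculus on space-time: slices and the Laplacian. -/

namespace ViscousHJ

variable {n : ℕ}

theorem isOpen_spaceTime : IsOpen (spaceTime n) := isOpen_univ.prod isOpen_Ioi

theorem mem_spaceTime {p : E n × ℝ} : p ∈ spaceTime n ↔ 0 < p.2 := by simp [spaceTime]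

section Slices

variable {F : Type} [NormedAddCommGroup F] [NormedSpace ℝ F]

theorem contDiffAt_of_contDiffOn_spaceTime {S : E n → ℝ → F} {m : ℕ∞ω}
    (h : ContDiffOn ℝ m (fun p : E n × ℝ => S p.1 p.2) (spaceTime n)) (x : E n) {t : ℝ}
    (ht : 0 < t) : ContDiffAt ℝ m (fun p : E n × ℝ => S p.1 p.2) (x, t) :=
  h.contDiffAt (isOpen_spaceTime.mem_nhds (mem_spaceTime.2 ht))

theorem contDiff_slice_of_contDiffOn_spaceTime {S : E n → ℝ → F} {m : ℕ∞ω}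
    (h : ContDiffOn ℝ m (fun p : E n × ℝ => S p.1 p.2) (spaceTime n)) {t : ℝ}
    (ht : 0 < t) : ContDiff ℝ m (fun z => S z t) := by
  rw [contDiff_iff_contDiffAt]
  intro x
  exact (contDiffAt_of_contDiffOn_spaceTime h x ht).comp x
    (contDiffAt_id.prodMk contDiffAt_const)

theorem contDiffAt_time_of_contDiffOn_spaceTime {S : E n → ℝ → F} {m : ℕ∞ω}
    (h : ContDiffOn ℝ m (fun p : E n × ℝ => S p.1 p.2) (spaceTime n)) (x : E n) {t : ℝ}
    (ht : 0 < t) : ContDiffAt ℝ m (fun s => S x s) t :=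
  (contDiffAt_of_contDiffOn_spaceTime h x ht).comp t (contDiffAt_const.prodMk contDiffAt_id)

end Slices

section Laplacian

theorem hasFDerivAt_fderiv_apply {f : E n → ℝ} {x : E n} (hf : ContDiffAt ℝ 2 f x) (v : E n) :
    HasFDerivAt (fun z => fderiv ℝ f z v) ((fderiv ℝ (fderiv ℝ f) x).flip v) x := by
  have h1 : DifferentiableAt ℝ (fderiv ℝ f) x :=
    (hf.fderiv_right (m := 1) (by norm_num)).differentiableAt (by norm_num)
  have := h1.hasFDerivAt.clm_apply (hasFDerivAt_const v x)
  simpa using this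

theorem laplacian_eq_sum_fderiv {f : E n → ℝ} {x : E n} (hf : ContDiffAt ℝ 2 f x) :
    Laplacian.laplacian f x = ∑ i, fderiv ℝ (fun z => fderiv ℝ f z (EuclideanSpace.single i 1)) x
      (EuclideanSpace.single i 1) := by
  rw [InnerProductSpace.laplacian_eq_iteratedFDeriv_orthonormalBasis f
    (EuclideanSpace.basisFun (Fin n) ℝ)]
  refine Finset.sum_congr rfl fun i _ => ?_
  rw [iteratedFDeriv_two_apply, (hasFDerivAt_fderiv_apply hf _).fderiv]
  simp

theorem laplacian_norm_sq (x : E n) :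
    Laplacian.laplacian (fun z : E n => ‖z‖ ^ 2) x = 2 * n := by
  have hc : ContDiff ℝ 2 (fun z : E n => ‖z‖ ^ 2) := contDiff_id.norm_sq ℝ
  rw [laplacian_eq_sum_fderiv hc.contDiffAt]
  have : ∀ i : Fin n, fderiv ℝ (fun z : E n => fderiv ℝ (fun z : E n => ‖z‖ ^ 2) z
      (EuclideanSpace.single i 1)) x (EuclideanSpace.single i 1) = 2 := by
    intro i
    have e : (fun z : E n => fderiv ℝ (fun z : E n => ‖z‖ ^ 2) z (EuclideanSpace.single i 1)) =
        fun z => (2 • innerSL ℝ (EuclideanSpace.single i (1 : ℝ))) z := by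
      ext z
      rw [(hasStrictFDerivAt_norm_sq z).hasFDerivAt.fderiv]
      simpa using real_inner_comm _ _
    rw [e, ContinuousLinearMap.fderiv]
    simp
  rw [Finset.sum_congr rfl fun i _ => this i]
  simp [mul_comm]

theorem laplacian_nonpos_of_isLocalMax {f : E n → ℝ} {x : E n} (hf : ContDiffAt ℝ 2 f x)
    (hx : IsLocalMax f x) : Laplacian.laplacian f x ≤ 0 := by
  rw [laplacian_eq_sum_fderiv hf]
  refine Finset.sum_nonpos fun i _ => ?_
  set e : E n := EuclideanSpace.single i 1
  by_contra! hpos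
  set g : ℝ → ℝ := fun r => f (x + r • e) with hg
  have hl : ∀ r : ℝ, HasDerivAt (fun r : ℝ => x + r • e) e r := fun r => by
    simpa using ((hasDerivAt_id r).smul_const e).const_add x
  have hl0 : x + (0 : ℝ) • e = x := by simp
  have hcont : Tendsto (fun r : ℝ => x + r • e) (𝓝 0) (𝓝 x) := by
    have := (hl 0).continuousAt.tendsto
    rwa [hl0] at this
  have hd : ∀ᶠ z in 𝓝 x, DifferentiableAt ℝ f z :=
    (hf.eventually (by simp)).mono fun z hz => hz.differentiableAt (by norm_num)
  have hg1 : deriv g =ᶠ[𝓝 0] fun r => fderiv ℝ f (x + r • e) e := by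
    filter_upwards [hcont.eventually hd] with r hr
    exact (hr.hasFDerivAt.comp_hasDerivAt r (hl r)).deriv
  have hg2 : deriv (deriv g) 0 = fderiv ℝ (fun z => fderiv ℝ f z e) x e := by
    rw [hg1.deriv_eq]
    have h1 := hasFDerivAt_fderiv_apply hf e
    rw [h1.fderiv]
    rw [← hl0] at h1
    have := h1.comp_hasDerivAt (0 : ℝ) (hl 0)
    rw [hl0] at this
    exact this.deriv
  have hmax : IsLocalMax g 0 := by
    have hx' : ∀ᶠ z in 𝓝 x, f z ≤ f x := hx
    filter_upwards [hcont.eventually hx'] with r hr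
    simpa [hg] using hr
  have hgc : ContinuousAt g 0 := by
    have h2 : DifferentiableAt ℝ f (x + (0 : ℝ) • e) := by
      rw [hl0]; exact hd.self_of_nhds
    exact (h2.hasFDerivAt.comp_hasDerivAt (0 : ℝ) (hl 0)).continuousAt
  -- A positive second derivative would make `0` a local minimum as well, so `g` would be locally
  -- constant and its second derivative would vanish.
  have hmin := isLocalMin_of_deriv_deriv_pos (hg2 ▸ hpos) hmax.deriv_eq_zero hgc
  have hconst : g =ᶠ[𝓝 0] fun _ => g 0 := by
    filter_upwards [hmax, hmin] with r h1 h2 using le_antisymm h1 h2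
  have h0 : deriv g =ᶠ[𝓝 0] fun _ => 0 := by
    have := hconst.deriv
    simpa using this
  have : deriv (deriv g) 0 = 0 := by
    rw [h0.deriv_eq]; simp
  linarith

theorem norm_sq_gradient_eq_sum (f : E n → ℝ) (x : E n) :
    ‖gradient f x‖ ^ 2 = ∑ i, (fderiv ℝ f x (EuclideanSpace.single i 1)) ^ 2 := by
  rw [EuclideanSpace.norm_sq_eq]
  refine Finset.sum_congr rfl fun i _ => ?_
  have : gradient f x i = fderiv ℝ f x (EuclideanSpace.single i 1) := by
    have h := InnerProductSpace.toDual_symm_apply (𝕜 := ℝ) (x := EuclideanSpace.single i 1)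
      (y := fderiv ℝ f x)
    rw [EuclideanSpace.inner_single_right] at h
    rw [← h, gradient]
    simp
  rw [this, Real.norm_eq_abs, sq_abs]

/-- The squared gradient produced by the chain rule is what cancels the nonlinearity of the viscous
equation. The identity is used again to compute the mean squared error. -/
theorem laplacian_exp_neg_div {f : E n → ℝ} (hf : ContDiff ℝ 2 f) {c : ℝ} (hc : c ≠ 0) (x : E n) :
    Laplacian.laplacian (fun z => Real.exp (-f z / c)) x =
      Real.exp (-f x / c) * (‖gradient f x‖ ^ 2 / c ^ 2 - Laplacian.laplacian f x / c) := by
  have hw : ContDiff ℝ 2 fun z => Real.exp (-f z / c) := (hf.neg.div_const c).exp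
  have hd : ∀ z, HasFDerivAt f (fderiv ℝ f z) z := fun z =>
    (hf.differentiable (by norm_num) z).hasFDerivAt
  have hdw : ∀ z, HasFDerivAt (fun z => Real.exp (-f z / c))
      (Real.exp (-f z / c) • (-c⁻¹ • fderiv ℝ f z)) z := by
    intro z
    have := ((hd z).const_mul (-c⁻¹)).exp
    refine (this.congr_of_eventuallyEq (Eventually.of_forall fun y => ?_)).congr_fderiv ?_
    · simp only; congr 1; field_simp
    · congr 2; field_simp
  rw [laplacian_eq_sum_fderiv hw.contDiffAt, laplacian_eq_sum_fderiv hf.contDiffAt,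
    norm_sq_gradient_eq_sum, Finset.sum_div, Finset.sum_div, ← Finset.sum_sub_distrib,
    Finset.mul_sum]
  refine Finset.sum_congr rfl fun i _ => ?_
  set e : E n := EuclideanSpace.single i 1
  have e1 : (fun z => fderiv ℝ (fun z => Real.exp (-f z / c)) z e) =
      fun z => Real.exp (-f z / c) * (-c⁻¹ * fderiv ℝ f z e) := by
    ext z
    rw [(hdw z).fderiv]
    simp
  have h2 : HasFDerivAt (fun z => Real.exp (-f z / c) * (-c⁻¹ * fderiv ℝ f z e)) _ x :=
    (hdw x).mul ((hasFDerivAt_fderiv_apply hf.contDiffAt e).const_mul (-c⁻¹))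
  rw [e1, h2.fderiv, (hasFDerivAt_fderiv_apply hf.contDiffAt e).fderiv]
  simp
  field_simp
  ring

end Laplacian

/-! ### The maximum principle for the heat equation. -/

section MaxPrinciple

/-- A maximum over a space-time cylinder may sit at the final time, where only earlier times are
available for comparison. -/
theorem le_of_hasDerivAt_of_le_left {f : ℝ → ℝ} {d t : ℝ} (ht : 0 < t) (hf : HasDerivAt f d t)
    (h : ∀ s ∈ Ioo 0 t, f s ≤ f t) : 0 ≤ d := by
  have h1 : Tendsto (slope f t) (𝓝[<] t) (𝓝 d) :=
    (hasDerivAt_iff_tendsto_slope.1 hf).mono_left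
      (nhdsWithin_mono _ fun z hz => (mem_Iio.1 hz).ne)
  refine ge_of_tendsto h1 ?_
  filter_upwards [Ioo_mem_nhdsLT ht] with s hs
  rw [slope_def_field]
  exact div_nonneg_of_nonpos (by linarith [h s hs]) (by linarith [hs.2])

/-- The maximum principle for bounded solutions of the heat equation on the whole space. -/
theorem nonpos_of_bounded_heat_subsolution {v : E n → ℝ → ℝ} {c C : ℝ} (hc : 0 < c)
    (hbd : ∀ x t, 0 ≤ t → v x t ≤ C)
    (hcont : ContinuousOn (fun p : E n × ℝ => v p.1 p.2) (univ ×ˢ Ici 0))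
    (h0 : ∀ x, v x 0 ≤ 0) (hsm : ∀ t > 0, ContDiff ℝ 2 fun x => v x t)
    (hd : ∀ x, ∀ t > 0, HasDerivAt (fun s => v x s)
      (c * Laplacian.laplacian (fun z => v z t) x) t) (x : E n) {t : ℝ} (ht : 0 ≤ t) :
    v x t ≤ 0 := by
  -- The barrier `δ * (‖x‖ ^ 2 + D * t)` must be a strict supersolution: the Laplacian of `‖x‖ ^ 2`
  -- is `2 * n`, and the extra `1` gives strictness.
  set D : ℝ := 2 * c * n + 1 with hD
  have hD0 : 0 < D := by positivity
  have key : ∀ δ > 0, v x t ≤ δ * (‖x‖ ^ 2 + D * t) := by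
    intro δ hδ
    by_contra! hlt
    set ψ : E n × ℝ → ℝ := fun p => v p.1 p.2 - δ * (‖p.1‖ ^ 2 + D * p.2) with hψ
    -- On the sphere of radius `R` the barrier exceeds the bound `C`, so a positive maximum of `ψ`
    -- is interior in space.
    obtain ⟨R, hRx, hR⟩ : ∃ R, ‖x‖ ≤ R ∧ C < δ * R ^ 2 := by
      refine ⟨max ‖x‖ (|C| / δ + 1), le_max_left _ _, ?_⟩
      have h1 : |C| / δ + 1 ≤ max ‖x‖ (|C| / δ + 1) := le_max_right _ _
      have h2 : (0 : ℝ) ≤ |C| / δ := by positivity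
      have h3 : |C| / δ + 1 ≤ max ‖x‖ (|C| / δ + 1) ^ 2 := by nlinarith
      calc C ≤ |C| := le_abs_self C
        _ < δ * (|C| / δ + 1) := by
            rw [mul_add, mul_div_cancel₀ _ hδ.ne']; linarith
        _ ≤ _ := by gcongr
    have hK : IsCompact (Metric.closedBall (0 : E n) R ×ˢ Icc 0 t) :=
      (isCompact_closedBall _ _).prod isCompact_Icc
    have hxK : (x, t) ∈ Metric.closedBall (0 : E n) R ×ˢ Icc 0 t :=
      ⟨by simpa using hRx, ht, le_rfl⟩
    have hψc : ContinuousOn ψ (Metric.closedBall (0 : E n) R ×ˢ Icc 0 t) := by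
      refine (hcont.mono ?_).sub (by fun_prop)
      exact prod_mono (subset_univ _) Icc_subset_Ici_self
    obtain ⟨⟨y, s⟩, hyK, hmax⟩ := hK.exists_isMaxOn ⟨_, hxK⟩ hψc
    have hpos : 0 < ψ (y, s) := lt_of_lt_of_le (by simp only [hψ]; linarith) (hmax hxK)
    have hs0 : 0 ≤ s := hyK.2.1
    have hst : s ≤ t := hyK.2.2
    have hyR : ‖y‖ < R := by
      by_contra! hRy
      have h1 := hbd y s hs0
      have hR0 : 0 ≤ R := (norm_nonneg x).trans hRx
      have h2 : δ * R ^ 2 ≤ δ * (‖y‖ ^ 2 + D * s) := by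
        gcongr
        have : R ^ 2 ≤ ‖y‖ ^ 2 := by gcongr
        have : 0 ≤ D * s := by positivity
        linarith
      simp only [hψ] at hpos
      linarith
    have hs : 0 < s := by
      refine lt_of_le_of_ne hs0 fun h => ?_
      subst h
      have h1 := h0 y
      have : 0 ≤ δ * (‖y‖ ^ 2 + D * 0) := by positivity
      simp only [hψ] at hpos
      linarith
    have hlap : Laplacian.laplacian (fun z => v z s) y ≤ 2 * n * δ := by
      have hq : ContDiff ℝ 2 (fun z : E n => ‖z‖ ^ 2) := contDiff_id.norm_sq ℝ
      have hq' : ContDiff ℝ 2 (δ • fun z : E n => ‖z‖ ^ 2) := contDiff_const.smul hq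
      have h1 : IsLocalMax ((fun z => v z s) - (δ • fun z : E n => ‖z‖ ^ 2)) y := by
        have : ∀ᶠ z in 𝓝 y, z ∈ Metric.ball (0 : E n) R :=
          Metric.isOpen_ball.mem_nhds (by simpa using hyR)
        filter_upwards [this] with z hz
        have h2 : ψ (z, s) ≤ ψ (y, s) := hmax ⟨Metric.ball_subset_closedBall hz, hs0, hst⟩
        simp only [hψ] at h2
        simp only [Pi.sub_apply, Pi.smul_apply, smul_eq_mul]
        linarith
      have h2 : Laplacian.laplacian ((fun z => v z s) - (δ • fun z : E n => ‖z‖ ^ 2)) y ≤ 0 :=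
        laplacian_nonpos_of_isLocalMax (((hsm s hs).sub hq').contDiffAt) h1
      rw [(hsm s hs).contDiffAt.laplacian_sub hq'.contDiffAt,
        InnerProductSpace.laplacian_smul _ hq.contDiffAt, laplacian_norm_sq] at h2
      simp only [smul_eq_mul] at h2
      linarith
    have hder : 0 ≤ c * Laplacian.laplacian (fun z => v z s) y - δ * D := by
      have h1 : HasDerivAt (fun r => v y r - δ * (‖y‖ ^ 2 + D * r))
          (c * Laplacian.laplacian (fun z => v z s) y - δ * D) s := by
        refine (hd y s hs).sub ?_
        have := (((hasDerivAt_id s).const_mul D).const_add (‖y‖ ^ 2)).const_mul δ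
        simpa using this
      refine le_of_hasDerivAt_of_le_left hs h1 fun r hr => ?_
      exact hmax (show (y, r) ∈ _ from ⟨hyK.1, hr.1.le, hr.2.le.trans hst⟩)
    have : c * Laplacian.laplacian (fun z => v z s) y ≤ c * (2 * n * δ) := by gcongr
    rw [hD] at hder
    nlinarith
  have hlim : Tendsto (fun δ : ℝ => δ * (‖x‖ ^ 2 + D * t)) (𝓝[>] 0) (𝓝 0) := by
    have : Tendsto (fun δ : ℝ => δ * (‖x‖ ^ 2 + D * t)) (𝓝 0) (𝓝 (0 * (‖x‖ ^ 2 + D * t))) :=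
      (continuous_mul_const _).tendsto 0
    rw [zero_mul] at this
    exact this.mono_left nhdsWithin_le_nhds
  exact ge_of_tendsto hlim (eventually_nhdsWithin_of_forall key)

end MaxPrinciple

end ViscousHJ

/-! ### The heat semigroup and uniqueness of bounded solutions. -/

namespace ViscousHJ

variable {n : ℕ}

theorem two_le_infty : (2 : ℕ∞ω) ≤ ∞ := ENat.LEInfty.out

/-- The integral of `f` against the Gaussian weight. -/
def gaussInt (f : E n → ℝ) (x : E n) (s : ℝ) : ℝ := ∫ y, gauss x s y * f y

/-- The solution of the heat equation `∂ₛ P = ½ Δ P` with initial data `f`. -/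
def heat (f : E n → ℝ) (x : E n) (s : ℝ) : ℝ :=
  1 / (2 * Real.pi * s) ^ ((n : ℝ) / 2) * gaussInt f x s

section

variable {f : E n → ℝ} {C : ℝ}

theorem norm_le_mul_one_add_sq (hC : ∀ y, |f y| ≤ C) (y : E n) :
    ‖f y‖ ≤ C * (1 + ‖y‖ ^ 2) := by
  have h0 : 0 ≤ C := (abs_nonneg _).trans (hC 0)
  have h1 := hC y
  rw [Real.norm_eq_abs]
  nlinarith [sq_nonneg ‖y‖, mul_nonneg h0 (sq_nonneg ‖y‖)]

theorem norm_inner_smul_le (hC : ∀ y, |f y| ≤ C) (v y : E n) :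
    ‖inner ℝ y v • f y‖ ≤ C * ‖v‖ * (1 + ‖y‖ ^ 2) := by
  have h0 : 0 ≤ C := (abs_nonneg _).trans (hC 0)
  have h1 := hC y
  rw [norm_smul, Real.norm_eq_abs (f y)]
  calc ‖inner ℝ y v‖ * |f y| ≤ (‖y‖ * ‖v‖) * C := by
        gcongr
        · exact norm_inner_le_norm y v
    _ = C * ‖v‖ * ‖y‖ := by ring
    _ ≤ _ := by
        gcongr
        nlinarith [sq_nonneg (‖y‖ - 1), norm_nonneg y]

theorem integrable_gauss_mul (hf : AEStronglyMeasurable f) (hC : ∀ y, |f y| ≤ C) (x : E n)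
    {s : ℝ} (hs : 0 < s) : Integrable fun y => gauss x s y * f y :=
  integrable_gauss_smul hf (norm_le_mul_one_add_sq hC) x hs

theorem contDiffOn_gaussInt (hf : AEStronglyMeasurable f) (hC : ∀ y, |f y| ≤ C) :
    ContDiffOn ℝ ∞ (fun p : E n × ℝ => gaussInt f p.1 p.2) (spaceTime n) :=
  contDiffOn_integral_gauss hf (norm_le_mul_one_add_sq hC)

theorem contDiffOn_heat (hf : AEStronglyMeasurable f) (hC : ∀ y, |f y| ≤ C) :
    ContDiffOn ℝ ∞ (fun p : E n × ℝ => heat f p.1 p.2) (spaceTime n) := by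
  have h : ∀ p ∈ spaceTime n, 0 < 2 * Real.pi * p.2 := fun p hp => by
    have := mem_spaceTime.1 hp
    positivity
  refine ContDiffOn.mul ?_ (contDiffOn_gaussInt hf hC)
  refine contDiffOn_const.div ?_ fun p hp => (Real.rpow_pos_of_pos (h p hp) _).ne'
  exact (contDiffOn_const.mul contDiffOn_snd).rpow_const_of_ne fun p hp => (h p hp).ne'

theorem hasFDerivAt_gaussInt (hf : AEStronglyMeasurable f) (hC : ∀ y, |f y| ≤ C) (x : E n)
    {s : ℝ} (hs : 0 < s) :
    ∃ L : E n →L[ℝ] ℝ, HasFDerivAt (fun x => gaussInt f x s) L x ∧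
      ∀ h, L h = ((∫ y, gauss x s y * (inner ℝ y h * f y)) - inner ℝ x h * gaussInt f x s) / s := by
  obtain ⟨L, hL, hLi⟩ := hasFDerivAt_integral_gauss hf (norm_le_mul_one_add_sq hC) x hs
  refine ⟨L, hL, fun h => ?_⟩
  rw [(hLi h).2, gaussInt, ← integral_const_mul, ← integral_sub, ← integral_div]
  · refine integral_congr_ae (ae_of_all _ fun y => ?_)
    simp only [smul_eq_mul, inner_sub_left]
    ring
  · refine integrable_gauss_smul (F := fun y => inner ℝ y h * f y) ?_ (norm_inner_smul_le hC h) x hs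
    exact (Continuous.aestronglyMeasurable (by fun_prop)).mul hf
  · exact (integrable_gauss_mul hf hC x hs).const_mul _

/-- The first derivative is again built from Gaussian integrals, of `⟪y, v⟫ f y` and of `f`, so the
first-order formula applies a second time. Integrability is recorded for the later sum over
coordinates. -/
theorem fderiv_fderiv_gaussInt (hf : AEStronglyMeasurable f) (hC : ∀ y, |f y| ≤ C) (x v : E n)
    {s : ℝ} (hs : 0 < s) :
    Integrable (fun y => gauss x s y * (inner ℝ (y - x) v ^ 2 * f y)) ∧
    fderiv ℝ (fun z => fderiv ℝ (fun z => gaussInt f z s) z v) x v =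
      (∫ y, gauss x s y * (inner ℝ (y - x) v ^ 2 * f y)) / s ^ 2
        - ‖v‖ ^ 2 * gaussInt f x s / s := by
  have hc : Continuous fun y : E n => (inner ℝ y v : ℝ) := by fun_prop
  have hFm : AEStronglyMeasurable (fun y => inner ℝ y v • f y) :=
    hc.aestronglyMeasurable.smul hf
  have e : (fun z => fderiv ℝ (fun z => gaussInt f z s) z v) =
      fun z => ((∫ y, gauss z s y • (inner ℝ y v • f y)) - inner ℝ z v * gaussInt f z s) * s⁻¹ := by
    ext z
    obtain ⟨L, hL, hLi⟩ := hasFDerivAt_gaussInt hf hC z hs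
    rw [hL.fderiv, hLi, div_eq_mul_inv]
    rfl
  obtain ⟨L1, hL1, hL1i⟩ := hasFDerivAt_integral_gauss hFm (norm_inner_smul_le hC v) x hs
  obtain ⟨L2, hL2, hL2i⟩ := hasFDerivAt_integral_gauss hf (norm_le_mul_one_add_sq hC) x hs
  have hv : HasFDerivAt (fun z : E n => inner ℝ z v) (innerSL ℝ v) x := by
    refine (innerSL ℝ v).hasFDerivAt.congr_of_eventuallyEq (Eventually.of_forall fun z => ?_)
    simp [real_inner_comm]
  have h3 : HasFDerivAt (fun z => ((∫ y, gauss z s y • (inner ℝ y v • f y)) -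
      inner ℝ z v * gaussInt f z s) * s⁻¹) _ x := (hL1.sub (hv.mul hL2)).mul_const s⁻¹
  have hsplit : ∀ y, gauss x s y * (inner ℝ (y - x) v ^ 2 * f y) =
      s * (gauss x s y • ((inner ℝ (y - x) v / s) • (inner ℝ y v • f y))
        - inner ℝ x v * (gauss x s y • ((inner ℝ (y - x) v / s) • f y))) := by
    intro y
    simp only [smul_eq_mul, inner_sub_left]
    field_simp
  have hi := ((hL1i v).1.sub ((hL2i v).1.const_mul (inner ℝ x v))).const_mul s
  refine ⟨hi.congr (ae_of_all _ fun y => (hsplit y).symm), ?_⟩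
  rw [e, h3.fderiv, integral_congr_ae (ae_of_all _ hsplit), integral_const_mul,
    integral_sub (hL1i v).1 ((hL2i v).1.const_mul _), integral_const_mul, ← (hL1i v).2,
    ← (hL2i v).2]
  simp only [smul_apply, sub_apply, add_apply, innerSL_apply_apply, smul_eq_mul,
    real_inner_self_eq_norm_sq, gaussInt]
  field_simp
  ring

theorem sum_inner_single_sq (y : E n) :
    ∑ i, inner ℝ y (EuclideanSpace.single i (1 : ℝ)) ^ 2 = ‖y‖ ^ 2 := by
  rw [EuclideanSpace.norm_sq_eq]
  refine Finset.sum_congr rfl fun i _ => ?_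
  rw [EuclideanSpace.inner_single_right]
  simp

theorem contDiff_gaussInt (hf : AEStronglyMeasurable f) (hC : ∀ y, |f y| ≤ C)
    {s : ℝ} (hs : 0 < s) : ContDiff ℝ ∞ fun x => gaussInt f x s :=
  contDiff_slice_of_contDiffOn_spaceTime (contDiffOn_gaussInt hf hC) hs

theorem laplacian_gaussInt (hf : AEStronglyMeasurable f) (hC : ∀ y, |f y| ≤ C) (x : E n)
    {s : ℝ} (hs : 0 < s) :
    Laplacian.laplacian (fun x => gaussInt f x s) x =
      (∫ y, gauss x s y * (‖x - y‖ ^ 2 * f y)) / s ^ 2 - n * gaussInt f x s / s := by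
  rw [laplacian_eq_sum_fderiv ((contDiff_gaussInt hf hC hs).contDiffAt.of_le two_le_infty),
    Finset.sum_congr rfl fun i _ => (fderiv_fderiv_gaussInt hf hC x _ hs).2,
    Finset.sum_sub_distrib, ← Finset.sum_div,
    ← integral_finsetSum _ fun i _ => (fderiv_fderiv_gaussInt hf hC x _ hs).1]
  congr 2
  · refine integral_congr_ae (ae_of_all _ fun y => ?_)
    simp only
    rw [← Finset.mul_sum, ← Finset.sum_mul, sum_inner_single_sq, norm_sub_rev]
  · simp
    ring

/-- Both sides reduce to the second moment of `f` about `x`; the derivative of the normalizing power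
of `s` accounts for the term `-n / s` in the Laplacian. -/
theorem hasDerivAt_heat (hf : AEStronglyMeasurable f) (hC : ∀ y, |f y| ≤ C) (x : E n)
    {s : ℝ} (hs : 0 < s) :
    HasDerivAt (fun s => heat f x s) (1 / 2 * Laplacian.laplacian (fun x => heat f x s) x) s := by
  have hps : 0 < 2 * Real.pi * s := by positivity
  have h1 := hasDerivAt_integral_gauss hf (norm_le_mul_one_add_sq hC) x hs
  have h2 : HasDerivAt (fun s : ℝ => 1 / (2 * Real.pi * s) ^ ((n : ℝ) / 2))
      (-(n / (2 * s)) * (1 / (2 * Real.pi * s) ^ ((n : ℝ) / 2))) s := by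
    have h3 : HasDerivAt (fun s : ℝ => 2 * Real.pi * s) (2 * Real.pi) s := by
      simpa using (hasDerivAt_id s).const_mul (2 * Real.pi)
    have := (h3.rpow_const (p := -((n : ℝ) / 2)) (Or.inl hps.ne'))
    refine (this.congr_of_eventuallyEq ?_).congr_deriv ?_
    · filter_upwards [lt_mem_nhds hs] with z hz
      rw [Real.rpow_neg (by positivity), one_div]
    · rw [Real.rpow_sub_one hps.ne', Real.rpow_neg hps.le]
      field_simp
  have hlap : Laplacian.laplacian (fun x => heat f x s) x =
      1 / (2 * Real.pi * s) ^ ((n : ℝ) / 2) * Laplacian.laplacian (fun x => gaussInt f x s) x := by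
    have := InnerProductSpace.laplacian_smul (𝕜 := ℝ) (x := x)
      (1 / (2 * Real.pi * s) ^ ((n : ℝ) / 2))
      ((contDiff_gaussInt hf hC hs).contDiffAt.of_le two_le_infty)
    exact this
  rw [hlap, laplacian_gaussInt hf hC x hs]
  have h4 : HasDerivAt (fun s => heat f x s) _ s := h2.mul h1
  refine h4.congr_deriv ?_
  have e : ∫ y, gauss x s y • ((‖x - y‖ ^ 2 / (2 * s ^ 2)) • f y) =
      (∫ y, gauss x s y * (‖x - y‖ ^ 2 * f y)) / (2 * s ^ 2) := by
    rw [← integral_div]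
    refine integral_congr_ae (ae_of_all _ fun y => ?_)
    simp only [smul_eq_mul]
    ring
  rw [e]
  field_simp
  ring

theorem integral_gauss (x : E n) {s : ℝ} (hs : 0 < s) :
    ∫ y, gauss x s y = (2 * Real.pi * s) ^ ((n : ℝ) / 2) := by
  have h := GaussianFourier.integral_rexp_neg_mul_sq_norm (V := E n) (b := (2 * s)⁻¹)
    (by positivity)
  have e : ∫ y, gauss x s y = ∫ y : E n, Real.exp (-(2 * s)⁻¹ * ‖y‖ ^ 2) := by
    rw [← integral_sub_left_eq_self _ volume x]
    refine integral_congr_ae (ae_of_all _ fun y => ?_)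
    simp only [gauss, div_eq_inv_mul, sub_sub_cancel, neg_mul]
  rw [e, h]
  congr 1
  · field_simp
  · simp

theorem integrable_gauss (x : E n) {s : ℝ} (hs : 0 < s) : Integrable (gauss x s) := by
  simpa using integrable_gauss_mul (f := fun _ => 1) (C := 1) aestronglyMeasurable_const
    (by simp) x hs

/-- The substitution `y = x + √t • z` moves `t` from the kernel into the argument of `f`. The
right-hand side still makes sense at `t = 0`, where the kernel itself degenerates. -/
theorem heat_mul_eq_integral (f : E n → ℝ) (x : E n) {t σ : ℝ} (ht : 0 < t) (hσ : 0 < σ) :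
    heat f x (t * σ) =
      ∫ z, 1 / (2 * Real.pi * σ) ^ ((n : ℝ) / 2) * gauss 0 σ z * f (x + √t • z) := by
  have hst : 0 < √t := Real.sqrt_pos.2 ht
  have h1 : ∫ y, gauss x (t * σ) y * f y = ∫ y, gauss x (t * σ) (x + y) * f (x + y) :=
    (integral_add_left_eq_self (fun y => gauss x (t * σ) y * f y) x).symm
  have h2 := Measure.integral_comp_smul volume
    (fun y => gauss x (t * σ) (x + y) * f (x + y)) √t
  have e : ∀ z, gauss x (t * σ) (x + √t • z) = gauss 0 σ z := by
    intro z
    simp only [gauss, sub_add_cancel_left, zero_sub, norm_neg, norm_smul, mul_pow]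
    rw [Real.norm_of_nonneg hst.le, Real.sq_sqrt ht.le]
    congr 2
    field_simp
  have h3 : √t ^ n = t ^ ((n : ℝ) / 2) := by
    rw [Real.sqrt_eq_rpow, ← Real.rpow_natCast, ← Real.rpow_mul ht.le]
    congr 1
    ring
  have h4 : (2 * Real.pi * (t * σ)) ^ ((n : ℝ) / 2) =
      √t ^ n * (2 * Real.pi * σ) ^ ((n : ℝ) / 2) := by
    rw [h3, ← Real.mul_rpow ht.le (by positivity)]
    congr 1
    ring
  simp only [e, finrank_euclideanSpace, Fintype.card_fin, smul_eq_mul] at h2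
  rw [abs_of_pos (by positivity)] at h2
  rw [heat, gaussInt, h1, h4]
  simp_rw [mul_assoc]
  rw [integral_const_mul, h2]
  have := (pow_pos hst n).ne'
  field_simp

theorem integral_normalized_gauss {σ : ℝ} (hσ : 0 < σ) :
    ∫ z : E n, 1 / (2 * Real.pi * σ) ^ ((n : ℝ) / 2) * gauss 0 σ z = 1 := by
  rw [integral_const_mul, integral_gauss 0 hσ, one_div, inv_mul_cancel₀]
  positivity

theorem integrable_normalized_gauss {σ : ℝ} (hσ : 0 < σ) :
    Integrable fun z : E n => 1 / (2 * Real.pi * σ) ^ ((n : ℝ) / 2) * gauss 0 σ z :=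
  (integrable_gauss 0 hσ).const_mul _

/-- The heat semigroup in the form that makes sense up to the initial time. -/
def heatAverage (σ : ℝ) (f : E n → ℝ) (x : E n) (t : ℝ) : ℝ :=
  ∫ z, 1 / (2 * Real.pi * σ) ^ ((n : ℝ) / 2) * gauss 0 σ z * f (x + √t • z)

theorem heatAverage_zero {σ : ℝ} (hσ : 0 < σ) (f : E n → ℝ) (x : E n) :
    heatAverage σ f x 0 = f x := by
  simp only [heatAverage, Real.sqrt_zero, zero_smul, add_zero]
  rw [integral_mul_const, integral_normalized_gauss hσ, one_mul]

theorem normalized_gauss_nonneg {σ : ℝ} (hσ : 0 < σ) (z : E n) :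
    0 ≤ 1 / (2 * Real.pi * σ) ^ ((n : ℝ) / 2) * gauss 0 σ z :=
  mul_nonneg (by positivity) (gauss_pos _ _ _).le

theorem continuous_heatAverage {σ : ℝ} (hσ : 0 < σ) (hf : Continuous f) (hC : ∀ y, |f y| ≤ C) :
    Continuous fun p : E n × ℝ => heatAverage σ f p.1 p.2 := by
  refine continuous_of_dominated (bound := fun z =>
    (1 / (2 * Real.pi * σ) ^ ((n : ℝ) / 2) * gauss 0 σ z) * C) (fun p => ?_)
    (fun p => ae_of_all _ fun z => ?_) ((integrable_normalized_gauss hσ).mul_const C)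
    (ae_of_all _ fun z => by fun_prop)
  · have := continuous_gauss (n := n) 0 σ
    exact Continuous.aestronglyMeasurable (by fun_prop)
  · rw [norm_mul, Real.norm_of_nonneg (normalized_gauss_nonneg hσ z), Real.norm_eq_abs]
    gcongr
    · exact normalized_gauss_nonneg hσ z
    · exact hC _

theorem abs_heatAverage_le {σ : ℝ} (hσ : 0 < σ) (hC : ∀ y, |f y| ≤ C)
    (x : E n) (t : ℝ) : |heatAverage σ f x t| ≤ C := by
  rw [← Real.norm_eq_abs]
  calc ‖heatAverage σ f x t‖
      ≤ ∫ z : E n, (1 / (2 * Real.pi * σ) ^ ((n : ℝ) / 2) * gauss 0 σ z) * C := by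
        refine norm_integral_le_of_norm_le ((integrable_normalized_gauss hσ).mul_const C)
          (ae_of_all _ fun z => ?_)
        rw [norm_mul, Real.norm_of_nonneg (normalized_gauss_nonneg hσ z), Real.norm_eq_abs]
        gcongr
        · exact normalized_gauss_nonneg hσ z
        · exact hC _
    _ = C := by rw [integral_mul_const, integral_normalized_gauss hσ, one_mul]

/-- The heat semigroup converges at the points of continuity of a bounded function. -/
theorem tendsto_heat_of_continuousAt {σ : ℝ} (hσ : 0 < σ) (hf : Measurable f)
    (hC : ∀ y, |f y| ≤ C) {x : E n} (hx : ContinuousAt f x) :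
    Tendsto (fun t => heat f x (t * σ)) (𝓝[>] 0) (𝓝 (f x)) := by
  have h0 : Tendsto (fun t => heatAverage σ f x t) (𝓝[>] 0) (𝓝 (heatAverage σ f x 0)) := by
    refine tendsto_integral_filter_of_dominated_convergence (fun z =>
      (1 / (2 * Real.pi * σ) ^ ((n : ℝ) / 2) * gauss 0 σ z) * C) (Eventually.of_forall fun t => ?_)
      (Eventually.of_forall fun t => ae_of_all _ fun z => ?_)
      ((integrable_normalized_gauss hσ).mul_const C) (ae_of_all _ fun z => ?_)
    · have := continuous_gauss (n := n) 0 σ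
      exact (Continuous.aestronglyMeasurable (by fun_prop)).mul
        (hf.comp (by fun_prop)).aestronglyMeasurable
    · rw [norm_mul, Real.norm_of_nonneg (normalized_gauss_nonneg hσ z), Real.norm_eq_abs]
      gcongr
      · exact normalized_gauss_nonneg hσ z
      · exact hC _
    · refine Tendsto.const_mul _ ?_
      have h1 : Tendsto (fun t : ℝ => x + √t • z) (𝓝[>] 0) (𝓝 (x + √0 • z)) := by
        have : Continuous fun t : ℝ => x + √t • z := by fun_prop
        exact (this.tendsto 0).mono_left nhdsWithin_le_nhds
      have h2 : ContinuousAt f (x + √0 • z) := by simpa using hx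
      exact h2.tendsto.comp h1
  rw [heatAverage_zero hσ] at h0
  refine h0.congr' ?_
  filter_upwards [self_mem_nhdsWithin] with t ht
  exact (heat_mul_eq_integral f x ht hσ).symm

end

/-- Bounded smooth solutions of the heat equation are given by the heat semigroup. -/
theorem eq_heat_of_bounded_solution {w : E n → ℝ → ℝ} {ε C : ℝ} (hε : 0 < ε)
    (hC : ∀ x, ∀ t > 0, |w x t| ≤ C)
    (hw : ContDiffOn ℝ ∞ (fun p : E n × ℝ => w p.1 p.2) (spaceTime n))
    (heq : ∀ x, ∀ t > 0, deriv (fun s => w x s) t =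
      ε / 2 * Laplacian.laplacian (fun z => w z t) x) (x : E n) {τ t : ℝ} (hτ : 0 < τ)
    (ht : 0 < t) : w x (t + τ) = heat (fun y => w y τ) x (t * ε) := by
  set f : E n → ℝ := fun y => w y τ with hfdef
  have hfc : Continuous f := (contDiff_slice_of_contDiffOn_spaceTime hw hτ).continuous
  have hfC : ∀ y, |f y| ≤ C := fun y => hC y τ hτ
  have hfm : AEStronglyMeasurable f := hfc.aestronglyMeasurable
  have hh := contDiffOn_heat hfm hfC
  have hA : ∀ x, ∀ t > 0, heatAverage ε f x t = heat f x (t * ε) := fun x t ht =>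
    (heat_mul_eq_integral f x ht hε).symm
  have h2 : (2 : ℕ∞ω) ≤ ∞ := two_le_infty
  have hwc : ∀ t, 0 < t → ContDiff ℝ 2 fun z => w z t := fun t ht =>
    (contDiff_slice_of_contDiffOn_spaceTime hw ht).of_le h2
  have hhc : ∀ t, 0 < t → ContDiff ℝ 2 fun z => heatAverage ε f z t := by
    intro t ht
    simp_rw [hA _ t ht]
    exact (contDiff_slice_of_contDiffOn_spaceTime hh (by positivity)).of_le h2
  have hwd : ∀ x, ∀ t, 0 < t → HasDerivAt (fun s => w x (s + τ))
      (ε / 2 * Laplacian.laplacian (fun z => w z (t + τ)) x) t := by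
    intro x t ht
    have ht' : 0 < t + τ := by positivity
    have h1 : HasDerivAt (fun s => w x s) _ (t + τ) :=
      ((contDiffAt_time_of_contDiffOn_spaceTime hw x ht').differentiableAt
        (by simp)).hasDerivAt
    rw [heq x _ ht'] at h1
    exact h1.comp_add_const t τ
  have hhd : ∀ x, ∀ t, 0 < t → HasDerivAt (fun s => heatAverage ε f x s)
      (ε / 2 * Laplacian.laplacian (fun z => heatAverage ε f z t) x) t := by
    intro x t ht
    have h1 := hasDerivAt_heat hfm hfC x (mul_pos ht hε)
    have h3 := h1.comp t ((hasDerivAt_id t).mul_const ε)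
    refine (h3.congr_of_eventuallyEq ?_).congr_deriv ?_
    · filter_upwards [lt_mem_nhds ht] with z hz
      exact hA x z hz
    · simp_rw [hA _ t ht]
      ring
  have hwcont : ContinuousOn (fun p : E n × ℝ => w p.1 (p.2 + τ)) (univ ×ˢ Ici 0) := by
    refine hw.continuousOn.comp (f := fun p : E n × ℝ => (p.1, p.2 + τ)) (by fun_prop) ?_
    rintro p ⟨-, hp⟩
    exact mem_spaceTime.2 (by have := mem_Ici.1 hp; simp only; linarith)
  have hhcont := (continuous_heatAverage hε hfc hfC).continuousOn (s := univ ×ˢ Ici 0)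
  have hbw : ∀ x t, 0 ≤ t → |w x (t + τ)| ≤ C := fun x t ht => hC x _ (by linarith)
  have hbh : ∀ x t, |heatAverage ε f x t| ≤ C := fun x t => abs_heatAverage_le hε hfC x t
  -- Starting from time `τ` the initial data are continuous and bounded. The maximum principle is
  -- applied to the difference with each sign.
  have main1 : w x (t + τ) - heatAverage ε f x t ≤ 0 := by
    refine nonpos_of_bounded_heat_subsolution
      (v := fun x t => w x (t + τ) - heatAverage ε f x t) (c := ε / 2) (C := 2 * C) (by positivity)
      ?_ (hwcont.sub hhcont) ?_ ?_ ?_ x ht.le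
    · intro x t ht
      have := abs_le.1 (hbw x t ht)
      have := abs_le.1 (hbh x t)
      linarith
    · intro x
      simp [heatAverage_zero hε, hfdef]
    · intro t ht
      exact (hwc (t + τ) (by positivity)).sub (hhc t ht)
    · intro x t ht
      have h4 : Laplacian.laplacian ((fun z => w z (t + τ)) - fun z => heatAverage ε f z t) x = _ :=
        (hwc (t + τ) (by positivity)).contDiffAt.laplacian_sub (hhc t ht).contDiffAt
      refine ((hwd x t ht).sub (hhd x t ht)).congr_deriv ?_
      rw [← mul_sub, ← h4]
      rfl
  have main2 : heatAverage ε f x t - w x (t + τ) ≤ 0 := by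
    refine nonpos_of_bounded_heat_subsolution
      (v := fun x t => heatAverage ε f x t - w x (t + τ)) (c := ε / 2) (C := 2 * C) (by positivity)
      ?_ (hhcont.sub hwcont) ?_ ?_ ?_ x ht.le
    · intro x t ht
      have := abs_le.1 (hbw x t ht)
      have := abs_le.1 (hbh x t)
      linarith
    · intro x
      simp [heatAverage_zero hε, hfdef]
    · intro t ht
      exact (hhc t ht).sub (hwc (t + τ) (by positivity))
    · intro x t ht
      have h4 : Laplacian.laplacian ((fun z => heatAverage ε f z t) - fun z => w z (t + τ)) x = _ :=
        (hhc t ht).contDiffAt.laplacian_sub (hwc (t + τ) (by positivity)).contDiffAt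
      refine ((hhd x t ht).sub (hwd x t ht)).congr_deriv ?_
      rw [← mul_sub, ← h4]
      rfl
  rw [← hA x t ht]
  linarith

/-- A bounded smooth solution of the heat equation with initial data `f` almost everywhere is given
by the heat semigroup. -/
theorem eq_heat_of_bounded_solution_of_tendsto {w : E n → ℝ → ℝ} {f : E n → ℝ} {ε C : ℝ}
    (hε : 0 < ε) (hC : ∀ x, ∀ t > 0, |w x t| ≤ C)
    (hw : ContDiffOn ℝ ∞ (fun p : E n × ℝ => w p.1 p.2) (spaceTime n))
    (heq : ∀ x, ∀ t > 0, deriv (fun s => w x s) t =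
      ε / 2 * Laplacian.laplacian (fun z => w z t) x)
    (hf : ∀ᵐ y, Tendsto (fun t => w y t) (𝓝[>] 0) (𝓝 (f y))) (x : E n) {t : ℝ}
    (ht : 0 < t) : w x t = heat f x (t * ε) := by
  -- Let `τ → 0` in the representation from time `τ`: the left side is continuous in time, and on
  -- the right the integrands are dominated by `C` times the kernel.
  have h1 : Tendsto (fun τ => w x (t + τ)) (𝓝[>] 0) (𝓝 (w x t)) := by
    have hc : ContinuousAt (fun s => w x s) t :=
      (contDiffAt_time_of_contDiffOn_spaceTime hw x ht).continuousAt
    have h2 : Tendsto (fun τ : ℝ => t + τ) (𝓝[>] 0) (𝓝 t) := by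
      have : Tendsto (fun τ : ℝ => t + τ) (𝓝 0) (𝓝 (t + 0)) := (continuous_const_add t).tendsto 0
      rw [add_zero] at this
      exact this.mono_left nhdsWithin_le_nhds
    exact hc.tendsto.comp h2
  have h2 : Tendsto (fun τ => heat (fun y => w y τ) x (t * ε)) (𝓝[>] 0)
      (𝓝 (heat f x (t * ε))) := by
    refine Tendsto.const_mul _ ?_
    refine tendsto_integral_filter_of_dominated_convergence (fun y => gauss x (t * ε) y * C)
      ?_ ?_ ((integrable_gauss x (mul_pos ht hε)).mul_const C) ?_
    · filter_upwards [self_mem_nhdsWithin] with τ hτ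
      exact ((continuous_gauss _ _).mul
        (contDiff_slice_of_contDiffOn_spaceTime hw hτ).continuous).aestronglyMeasurable
    · filter_upwards [self_mem_nhdsWithin] with τ hτ
      refine ae_of_all _ fun y => ?_
      rw [norm_mul, Real.norm_of_nonneg (gauss_pos _ _ _).le, Real.norm_eq_abs]
      exact mul_le_mul_of_nonneg_left (hC y τ hτ) (gauss_pos _ _ _).le
    · filter_upwards [hf] with y hy
      exact hy.const_mul _
  refine tendsto_nhds_unique (h1.congr' ?_) h2
  filter_upwards [self_mem_nhdsWithin] with τ hτ
  exact eq_heat_of_bounded_solution hε hC hw heq x hτ ht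

end ViscousHJ

/-! ### Convexity of `J`, subgradients and the Lax–Oleinik function. -/

namespace ViscousHJ

variable {n : ℕ} {J : E n → EReal}

/-- The real-valued version of `J`, meaningful on `dom J`. -/
def realJ (J : E n → EReal) (y : E n) : ℝ := (J y).toReal

theorem mem_effDom {y : E n} : y ∈ effDom J ↔ J y < ⊤ := Iff.rfl

theorem eq_top_of_notMem_effDom {y : E n} (hy : y ∉ effDom J) : J y = ⊤ :=
  not_lt_top_iff.1 hy

namespace IsRegularizer

variable (hJ : IsRegularizer J)
include hJ

theorem nonneg (y : E n) : 0 ≤ J y := hJ.iInf_eq_zero ▸ iInf_le J y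

theorem coe_realJ {y : E n} (hy : y ∈ effDom J) : (realJ J y : EReal) = J y :=
  EReal.coe_toReal (mem_effDom.1 hy).ne (hJ.gammaZero.ne_bot y)

theorem realJ_nonneg (y : E n) : 0 ≤ realJ J y := EReal.toReal_nonneg (hJ.nonneg y)

theorem convexOn_realJ : ConvexOn ℝ (effDom J) (realJ J) := by
  refine ⟨hJ.gammaZero.dom_convex, fun x hx y hy a b ha hb hab => ?_⟩
  rcases ha.eq_or_lt with rfl | ha
  · obtain rfl : b = 1 := by linarith
    simp
  rcases hb.eq_or_lt with rfl | hb
  · obtain rfl : a = 1 := by linarith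
    simp
  obtain rfl : b = 1 - a := by linarith
  have h := hJ.gammaZero.convex x hx y hy a ha (by linarith)
  rw [← hJ.coe_realJ hx, ← hJ.coe_realJ hy, ← hJ.coe_realJ
    (hJ.gammaZero.dom_convex hx hy ha.le hb.le hab)] at h
  exact_mod_cast h

theorem measurable : Measurable J := hJ.gammaZero.lsc.measurable

theorem measurable_realJ : Measurable (realJ J) := hJ.measurable.ereal_toReal

theorem measurableSet_effDom : MeasurableSet (effDom J) :=
  measurableSet_lt hJ.measurable measurable_const

theorem continuousOn_realJ : ContinuousOn (realJ J) (interior (effDom J)) :=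
  hJ.convexOn_realJ.continuousOn_interior

theorem convexOn_realJ_interior : ConvexOn ℝ (interior (effDom J)) (realJ J) :=
  hJ.convexOn_realJ.subset interior_subset hJ.gammaZero.dom_convex.interior

/-- Hahn–Banach separates `(x, J x)` from the open strict epigraph over the interior. The vertical
component `α` of the functional is negative, so dividing by `-α` turns it into a slope. -/
theorem exists_subgradient {x : E n} (hx : x ∈ interior (effDom J)) :
    ∃ p : E n, ∀ y ∈ effDom J, realJ J x + inner ℝ p (y - x) ≤ realJ J y := by
  set D := interior (effDom J) with hD
  set s : Set (E n × ℝ) := {q | q.1 ∈ D ∧ realJ J q.1 < q.2} with hs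
  have hsc : Convex ℝ s := hJ.convexOn_realJ_interior.convex_strict_epigraph
  have hso : IsOpen s := by
    have h1 : ContinuousOn (fun q : E n × ℝ => q.2 - realJ J q.1) (D ×ˢ univ) :=
      continuousOn_snd.sub (hJ.continuousOn_realJ.comp continuousOn_fst fun q hq => hq.1)
    have h2 := h1.isOpen_inter_preimage (isOpen_interior.prod isOpen_univ) (isOpen_Ioi (a := 0))
    convert h2 using 1
    ext q
    simp [hs, hD]
  obtain ⟨f, hf⟩ := geometric_hahn_banach_open_point hsc hso
    (x := (x, realJ J x)) (fun h => lt_irrefl _ h.2)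
  have hsplit : ∀ y r, f (y, r) = f (y, 0) + r * f (0, 1) := by
    intro y r
    have : ((y, r) : E n × ℝ) = (y, 0) + r • (0, 1) := by simp
    rw [this, map_add, map_smul, smul_eq_mul]
  set α := f (0, 1) with hα
  have hα0 : α < 0 := by
    have := hf (x, realJ J x + 1) ⟨hx, by simp⟩
    rw [hsplit, hsplit x (realJ J x)] at this
    nlinarith
  have hle : ∀ y ∈ D, f (y, 0) + realJ J y * α ≤ f (x, 0) + realJ J x * α := by
    intro y hy
    refine le_of_forall_pos_lt_add fun e he => ?_
    have h3 := hf (y, realJ J y + e / (-α)) ⟨hy, by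
      have : 0 < e / (-α) := div_pos he (by linarith)
      simp only; linarith⟩
    rw [hsplit, hsplit x (realJ J x), add_mul] at h3
    have : e / (-α) * α = -e := by
      have := hα0.ne
      field_simp
    linarith
  set p : E n := (-α)⁻¹ • (InnerProductSpace.toDual ℝ (E n)).symm
    (f.comp (ContinuousLinearMap.inl ℝ (E n) ℝ)) with hp
  have hpi : ∀ v, inner ℝ p v = (-α)⁻¹ * f (v, 0) := by
    intro v
    rw [hp, real_inner_smul_left, InnerProductSpace.toDual_symm_apply]
    simp
  have hint : ∀ y ∈ D, realJ J x + inner ℝ p (y - x) ≤ realJ J y := by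
    intro y hy
    have h1 := hle y hy
    have h2 : f (y - x, 0) = f (y, 0) - f (x, 0) := by
      rw [← map_sub]; simp
    rw [hpi, h2]
    have h3 : (-α)⁻¹ * (f (y, 0) - f (x, 0)) ≤ (-α)⁻¹ * ((-α) * (realJ J y - realJ J x)) := by
      refine mul_le_mul_of_nonneg_left (by linarith) (inv_nonneg.2 (by linarith))
    rw [inv_mul_cancel_left₀ (by linarith)] at h3
    linarith
  refine ⟨p, fun y hy => ?_⟩
  -- So far only interior `y` are covered. For any `y` in the domain, its midpoint with `x` is
  -- interior, and convexity transfers the inequality from the midpoint to `y`.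
  have hm : (1 / 2 : ℝ) • x + (1 / 2 : ℝ) • y ∈ D :=
    hJ.gammaZero.dom_convex.combo_interior_self_mem_interior hx hy (by norm_num) (by norm_num)
      (by norm_num)
  have h1 := hint _ hm
  have h2 := hJ.convexOn_realJ.2 (interior_subset hx) hy (by norm_num : (0 : ℝ) ≤ 1 / 2)
    (by norm_num : (0 : ℝ) ≤ 1 / 2) (by norm_num)
  have h3 : (1 / 2 : ℝ) • x + (1 / 2 : ℝ) • y - x = (1 / 2 : ℝ) • (y - x) := by module
  rw [h3, inner_smul_right] at h1
  simp only [smul_eq_mul] at h2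
  linarith

theorem interior_subset_subdiffDom : interior (effDom J) ⊆ subdiffDom J := by
  intro x hx
  obtain ⟨p, hp⟩ := hJ.exists_subgradient hx
  refine ⟨interior_subset hx, p, fun y => ?_⟩
  by_cases hy : y ∈ effDom J
  · rw [← hJ.coe_realJ hy, ← hJ.coe_realJ (interior_subset hx)]
    exact_mod_cast hp y hy
  · rw [eq_top_of_notMem_effDom hy]
    exact le_top

theorem effDom_ae_eq_interior : effDom J =ᵐ[volume] interior (effDom J) :=
  (interior_ae_eq_of_null_frontier (hJ.gammaZero.dom_convex.addHaar_frontier volume)).symm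

theorem effDom_ae_eq_subdiffDom : effDom J =ᵐ[volume] subdiffDom J := by
  refine Filter.EventuallyLE.antisymm ?_ ?_
  · exact hJ.effDom_ae_eq_interior.le.trans (ae_of_all _ fun x hx =>
      hJ.interior_subset_subdiffDom hx)
  · exact ae_of_all _ fun x hx => hx.1

/-! ### The Lax–Oleinik function -/

theorem mapCost_of_mem (x : E n) (t : ℝ) {y : E n} (hy : y ∈ effDom J) :
    mapCost J x t y = ((‖x - y‖ ^ 2 / (2 * t) + realJ J y : ℝ) : EReal) := by
  rw [mapCost, ← hJ.coe_realJ hy]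
  norm_cast

omit hJ in
theorem mapCost_of_notMem (x : E n) (t : ℝ) {y : E n} (hy : y ∉ effDom J) :
    mapCost J x t y = ⊤ := by
  rw [mapCost, eq_top_of_notMem_effDom hy, EReal.coe_add_top]

theorem lowerSemicontinuous_mapCost (x : E n) (t : ℝ) : LowerSemicontinuous (mapCost J x t) := by
  refine LowerSemicontinuous.add' (Continuous.lowerSemicontinuous ?_) hJ.gammaZero.lsc fun y =>
    EReal.continuousAt_add (Or.inl (EReal.coe_ne_top _)) (Or.inl (EReal.coe_ne_bot _))
  exact continuous_coe_real_ereal.comp (by fun_prop)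

theorem exists_forall_mapCost_le (x : E n) {t : ℝ} (ht : 0 < t) :
    ∃ u, ∀ y, mapCost J x t u ≤ mapCost J x t y := by
  obtain ⟨x0, hx0⟩ := hJ.gammaZero.dom_nonempty
  set M := ‖x - x0‖ ^ 2 / (2 * t) + realJ J x0 with hM
  have hM0 : 0 ≤ M := by
    have := hJ.realJ_nonneg x0
    positivity
  set R := 2 * t * M + 1 + ‖x - x0‖ with hR
  have hx0R : x0 ∈ Metric.closedBall x R := by
    rw [mem_closedBall_iff_norm', hR]
    have : 0 ≤ 2 * t * M := by positivity
    linarith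
  obtain ⟨u, -, hu⟩ := LowerSemicontinuousOn.exists_isMinOn ⟨x0, hx0R⟩
    (isCompact_closedBall x R) ((hJ.lowerSemicontinuous_mapCost x t).lowerSemicontinuousOn _)
  refine ⟨u, fun y => ?_⟩
  by_cases hy : y ∈ Metric.closedBall x R
  · exact hu hy
  refine (hu hx0R).trans ?_
  by_cases hyd : y ∈ effDom J
  · rw [hJ.mapCost_of_mem x t hyd, hJ.mapCost_of_mem x t hx0, ← hM]
    rw [mem_closedBall_iff_norm', not_le] at hy
    have h2 := hJ.realJ_nonneg y
    have h3 : M ≤ ‖x - y‖ ^ 2 / (2 * t) := by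
      rw [le_div_iff₀ (by positivity)]
      have h4 : 0 ≤ 2 * t * M := by positivity
      have h5 : 2 * t * M + 1 ≤ ‖x - y‖ := by
        have := norm_nonneg (x - x0)
        linarith
      nlinarith
    exact_mod_cast (by linarith : M ≤ ‖x - y‖ ^ 2 / (2 * t) + realJ J y)
  · rw [mapCost_of_notMem x t hyd]
    exact le_top

theorem mapCost_uMAP_le (x : E n) {t : ℝ} (ht : 0 < t) (y : E n) :
    mapCost J x t (uMAP J x t) ≤ mapCost J x t y :=
  Classical.epsilon_spec (hJ.exists_forall_mapCost_le x ht) y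

theorem mem_effDom_of_forall_le {x u : E n} {t : ℝ}
    (hu : ∀ y, mapCost J x t u ≤ mapCost J x t y) : u ∈ effDom J := by
  obtain ⟨x0, hx0⟩ := hJ.gammaZero.dom_nonempty
  by_contra h
  have := hu x0
  rw [mapCost_of_notMem x t h, hJ.mapCost_of_mem x t hx0] at this
  exact absurd (top_le_iff.1 this) (EReal.coe_ne_top _)

/-- This is the optimality condition: `(x - u) / t` is a subgradient of `J` at the minimizer `u`. It
comes from comparing `u` with `(1 - s) • u + s • y`, dividing by `s` and letting `s → 0`. -/
theorem inner_le_of_forall_le {x u : E n} {t : ℝ} (ht : 0 < t)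
    (hu : ∀ y, mapCost J x t u ≤ mapCost J x t y) {y : E n} (hy : y ∈ effDom J) :
    inner ℝ (x - u) (y - u) ≤ t * (realJ J y - realJ J u) := by
  have hud := hJ.mem_effDom_of_forall_le hu
  have key : ∀ s ∈ Ioo (0 : ℝ) 1, inner ℝ (x - u) (y - u) - s * ‖y - u‖ ^ 2 / 2 ≤
      t * (realJ J y - realJ J u) := by
    rintro s ⟨hs0, hs1⟩
    have hmem := hJ.gammaZero.dom_convex hud hy (a := 1 - s) (b := s) (by linarith) hs0.le (by ring)
    have h1 := hu ((1 - s) • u + s • y)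
    rw [hJ.mapCost_of_mem x t hud, hJ.mapCost_of_mem x t hmem, EReal.coe_le_coe_iff] at h1
    have h2 := hJ.convexOn_realJ.2 hud hy (by linarith : (0 : ℝ) ≤ 1 - s) hs0.le (by ring)
    simp only [smul_eq_mul] at h2
    have h3 : x - ((1 - s) • u + s • y) = (x - u) - s • (y - u) := by module
    have h4 : ‖(x - u) - s • (y - u)‖ ^ 2 =
        ‖x - u‖ ^ 2 - 2 * s * inner ℝ (x - u) (y - u) + s ^ 2 * ‖y - u‖ ^ 2 := by
      rw [norm_sub_sq_real, inner_smul_right, norm_smul, mul_pow, Real.norm_eq_abs, sq_abs]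
      ring
    rw [h3, h4] at h1
    have h5 : ‖x - u‖ ^ 2 / (2 * t) ≤ (‖x - u‖ ^ 2 - 2 * s * inner ℝ (x - u) (y - u) +
        s ^ 2 * ‖y - u‖ ^ 2) / (2 * t) + s * (realJ J y - realJ J u) := by linarith
    rw [div_add' _ _ _ (by positivity), div_le_div_iff_of_pos_right (by positivity)] at h5
    have h6 : s * (inner ℝ (x - u) (y - u) - s * ‖y - u‖ ^ 2 / 2) ≤
      s * (t * (realJ J y - realJ J u)) := by linarith
    exact le_of_mul_le_mul_left h6 hs0
  have hlim : Tendsto (fun s : ℝ => inner ℝ (x - u) (y - u) - s * ‖y - u‖ ^ 2 / 2) (𝓝[>] 0)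
      (𝓝 (inner ℝ (x - u) (y - u) - 0 * ‖y - u‖ ^ 2 / 2)) := by
    have : Continuous fun s : ℝ => (inner ℝ (x - u) (y - u) : ℝ) - s * ‖y - u‖ ^ 2 / 2 := by
      fun_prop
    exact (this.tendsto 0).mono_left nhdsWithin_le_nhds
  have := le_of_tendsto hlim (eventually_of_mem (Ioo_mem_nhdsGT one_pos) key)
  linarith

/-- The cost is strongly convex with modulus `1 / t`, hence grows quadratically away from its
minimizer. Uniqueness of the minimizer and the comparison with `S_ε` rest on this. -/
theorem add_norm_sq_le_cost {x u : E n} {t : ℝ} (ht : 0 < t)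
    (hu : ∀ y, mapCost J x t u ≤ mapCost J x t y) {y : E n} (hy : y ∈ effDom J) :
    ‖x - u‖ ^ 2 / (2 * t) + realJ J u + ‖u - y‖ ^ 2 / (2 * t) ≤
      ‖x - y‖ ^ 2 / (2 * t) + realJ J y := by
  have h := hJ.inner_le_of_forall_le ht hu hy
  have e : ‖x - y‖ ^ 2 = ‖x - u‖ ^ 2 - 2 * inner ℝ (x - u) (y - u) + ‖u - y‖ ^ 2 := by
    rw [← norm_neg (u - y), neg_sub, ← norm_sub_sq_real, sub_sub_sub_cancel_right]
  rw [e]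
  have h2 : (inner ℝ (x - u) (y - u) : ℝ) / t ≤ realJ J y - realJ J u := by
    rw [div_le_iff₀ ht]; linarith
  have h3 : (‖x - u‖ ^ 2 - 2 * inner ℝ (x - u) (y - u) + ‖u - y‖ ^ 2) / (2 * t) =
    ‖x - u‖ ^ 2 / (2 * t) + ‖u - y‖ ^ 2 / (2 * t) - inner ℝ (x - u) (y - u) / t := by
    field_simp
    ring
  linarith

theorem eq_uMAP {x v : E n} {t : ℝ} (ht : 0 < t)
    (hv : ∀ y, mapCost J x t v ≤ mapCost J x t y) : v = uMAP J x t := by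
  have hu := hJ.mapCost_uMAP_le x ht
  have h1 := hJ.add_norm_sq_le_cost ht hu (hJ.mem_effDom_of_forall_le hv)
  have h2 := hJ.add_norm_sq_le_cost ht hv (hJ.mem_effDom_of_forall_le hu)
  have h3 : 0 ≤ ‖v - uMAP J x t‖ ^ 2 / (2 * t) := by positivity
  have h4 : ‖uMAP J x t - v‖ ^ 2 / (2 * t) ≤ 0 := by linarith
  have h5 : ‖uMAP J x t - v‖ ^ 2 ≤ 0 := by
    rwa [div_le_iff₀ (by positivity), zero_mul] at h4
  have h6 : ‖uMAP J x t - v‖ = 0 := by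
    have := norm_nonneg (uMAP J x t - v)
    nlinarith
  exact (sub_eq_zero.1 (norm_eq_zero.1 h6)).symm

theorem uMAP_mem (x : E n) {t : ℝ} (ht : 0 < t) : uMAP J x t ∈ effDom J :=
  hJ.mem_effDom_of_forall_le (hJ.mapCost_uMAP_le x ht)

theorem iInf_mapCost (x : E n) {t : ℝ} (ht : 0 < t) :
    ⨅ y, mapCost J x t y =
      ((‖x - uMAP J x t‖ ^ 2 / (2 * t) + realJ J (uMAP J x t) : ℝ) : EReal) := by
  rw [← hJ.mapCost_of_mem x t (hJ.uMAP_mem x ht)]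
  exact le_antisymm (iInf_le _ _) (le_iInf (hJ.mapCost_uMAP_le x ht))

theorem S0_eq (x : E n) {t : ℝ} (ht : 0 < t) :
    S0 J x t = ‖x - uMAP J x t‖ ^ 2 / (2 * t) + realJ J (uMAP J x t) := by
  rw [S0, hJ.iInf_mapCost x ht, EReal.toReal_coe]

theorem coe_S0 (x : E n) {t : ℝ} (ht : 0 < t) : (S0 J x t : EReal) = ⨅ y, mapCost J x t y := by
  rw [hJ.S0_eq x ht, hJ.iInf_mapCost x ht]

theorem S0_nonneg (x : E n) {t : ℝ} (ht : 0 < t) : 0 ≤ S0 J x t := by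
  rw [hJ.S0_eq x ht]
  have := hJ.realJ_nonneg (uMAP J x t)
  positivity

theorem S0_add_norm_sq_le (x : E n) {t : ℝ} (ht : 0 < t) {y : E n} (hy : y ∈ effDom J) :
    S0 J x t + ‖uMAP J x t - y‖ ^ 2 / (2 * t) ≤ ‖x - y‖ ^ 2 / (2 * t) + realJ J y := by
  rw [hJ.S0_eq x ht]
  exact hJ.add_norm_sq_le_cost ht (hJ.mapCost_uMAP_le x ht) hy

theorem S0_le (x : E n) {t : ℝ} (ht : 0 < t) {y : E n} (hy : y ∈ effDom J) :
    S0 J x t ≤ ‖x - y‖ ^ 2 / (2 * t) + realJ J y := by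
  have := hJ.S0_add_norm_sq_le x ht hy
  have h2 : 0 ≤ ‖uMAP J x t - y‖ ^ 2 / (2 * t) := by positivity
  linarith

omit hJ in
/-- The slope `(x - u) / t` at the minimizer `u`. -/
def _root_.ViscousHJ.slopeMAP (J : E n → EReal) (x : E n) (t : ℝ) : E n := t⁻¹ • (x - uMAP J x t)

/-- The slope `p` is a subgradient of `J` at `u`, and expanding a square gives `⟪p, X⟫ - t' ‖p‖² / 2
≤ ‖X‖² / (2 t')`. Adding the two produces an affine minorant touching `S_0` at `(x, t)`; its time
slope `-‖p‖² / 2` encodes the Hamilton–Jacobi equation. -/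
theorem affine_le_S0 (x x' : E n) {t t' : ℝ} (ht : 0 < t) (ht' : 0 < t') :
    S0 J x t + (inner ℝ (slopeMAP J x t) (x' - x) - ‖slopeMAP J x t‖ ^ 2 / 2 * (t' - t)) ≤
      S0 J x' t' := by
  set u := uMAP J x t with hu
  set u' := uMAP J x' t' with hu'
  set p := slopeMAP J x t with hp
  have hxu : x - u = t • p := by
    rw [hp, slopeMAP, smul_smul, mul_inv_cancel₀ ht.ne', one_smul]
  have h1 := hJ.inner_le_of_forall_le ht (hJ.mapCost_uMAP_le x ht) (hJ.uMAP_mem x' ht')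
  rw [← hu, ← hu', hxu, real_inner_smul_left] at h1
  have h1' : inner ℝ p (u' - u) ≤ realJ J u' - realJ J u := le_of_mul_le_mul_left h1 ht
  rw [hJ.S0_eq x ht, hJ.S0_eq x' ht', ← hu, ← hu', hxu]
  have h2 : 0 ≤ ‖(x' - u') - t' • p‖ ^ 2 / (2 * t') := by positivity
  have h3 : ‖(x' - u') - t' • p‖ ^ 2 / (2 * t') =
      ‖x' - u'‖ ^ 2 / (2 * t') - inner ℝ p (x' - u') + t' * ‖p‖ ^ 2 / 2 := by
    rw [norm_sub_sq_real, inner_smul_right, norm_smul, Real.norm_of_nonneg ht'.le,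
      real_inner_comm]
    field_simp
  have h4 : ‖t • p‖ ^ 2 / (2 * t) = t * ‖p‖ ^ 2 / 2 := by
    rw [norm_smul, Real.norm_of_nonneg ht.le]
    field_simp
  have h5 : x' - x = (x' - u') + (u' - u) - t • p := by rw [← hxu]; abel
  rw [h4, h5, inner_sub_right, inner_add_right, inner_smul_right, real_inner_self_eq_norm_sq]
  linarith

theorem convexOn_S0 : ConvexOn ℝ (spaceTime n) (fun p : E n × ℝ => S0 J p.1 p.2) := by
  have hconv : Convex ℝ (spaceTime n) := convex_univ.prod (convex_Ioi 0)
  refine ⟨hconv, fun P hP Q hQ a b ha hb hab => ?_⟩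
  have hR := hconv hP hQ ha hb hab
  set R := a • P + b • Q with hRdef
  have h1 := hJ.affine_le_S0 R.1 P.1 (mem_spaceTime.1 hR) (mem_spaceTime.1 hP)
  have h2 := hJ.affine_le_S0 R.1 Q.1 (mem_spaceTime.1 hR) (mem_spaceTime.1 hQ)
  have h3 := add_le_add (mul_le_mul_of_nonneg_left h1 ha) (mul_le_mul_of_nonneg_left h2 hb)
  have e1 : R.1 = a • P.1 + b • Q.1 := rfl
  have e2 : R.2 = a * P.2 + b * Q.2 := rfl
  have e3 : a * inner ℝ (slopeMAP J R.1 R.2) (P.1 - R.1) +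
      b * inner ℝ (slopeMAP J R.1 R.2) (Q.1 - R.1) = 0 := by
    rw [← inner_smul_right, ← inner_smul_right, ← inner_add_right, smul_sub, smul_sub]
    have : a • P.1 - a • R.1 + (b • Q.1 - b • R.1) = R.1 - (a + b) • R.1 := by
      rw [e1]; module
    rw [this, hab, one_smul, sub_self, inner_zero_right]
  have e4 : a * (P.2 - R.2) + b * (Q.2 - R.2) = 0 := by
    have : a * (P.2 - R.2) + b * (Q.2 - R.2) = (a * P.2 + b * Q.2) - (a + b) * R.2 := by ring
    rw [this, hab, ← e2]
    ring
  have e5 : S0 J R.1 R.2 = (a + b) * S0 J R.1 R.2 := by rw [hab, one_mul]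
  simp only [smul_eq_mul]
  linear_combination h3 + e5 - e3 + ‖slopeMAP J R.1 R.2‖ ^ 2 / 2 * e4

/-- Freezing the minimizer `u` gives a smooth majorant `q`. It touches `S_0` at `(x, t)` and has the
differential of the affine minorant there, so `S_0` is squeezed between them. -/
theorem hasFDerivAt_S0 (x : E n) {t : ℝ} (ht : 0 < t) :
    HasFDerivAt (fun p : E n × ℝ => S0 J p.1 p.2)
      ((innerSL ℝ (slopeMAP J x t)).comp (ContinuousLinearMap.fst ℝ (E n) ℝ) -
        (‖slopeMAP J x t‖ ^ 2 / 2) • ContinuousLinearMap.snd ℝ (E n) ℝ) (x, t) := by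
  set p := slopeMAP J x t with hp
  set u := uMAP J x t with hu
  set L := (innerSL ℝ p).comp (ContinuousLinearMap.fst ℝ (E n) ℝ) -
    (‖p‖ ^ 2 / 2) • ContinuousLinearMap.snd ℝ (E n) ℝ with hL
  have hxu : x - u = t • p := by
    rw [hp, slopeMAP, smul_smul, mul_inv_cancel₀ ht.ne', one_smul]
  set q : E n × ℝ → ℝ := fun z => ‖z.1 - u‖ ^ 2 / (2 * z.2) + realJ J u with hq
  have hqd : HasFDerivAt q L (x, t) := by
    have h1 : HasFDerivAt (fun z : E n × ℝ => ‖z.1 - u‖ ^ 2)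
        ((2 • innerSL ℝ (x - u)).comp (ContinuousLinearMap.fst ℝ (E n) ℝ)) (x, t) :=
      HasFDerivAt.comp (g := fun w : E n => ‖w‖ ^ 2) (f := fun z : E n × ℝ => z.1 - u) (x, t)
        (hasStrictFDerivAt_norm_sq (x - u)).hasFDerivAt
        ((hasFDerivAt_fst (𝕜 := ℝ) (p := (x, t))).sub_const u)
    have h2 : HasFDerivAt (fun z : E n × ℝ => (2 * z.2)⁻¹)
        ((-(2 * t ^ 2)⁻¹) • ContinuousLinearMap.snd ℝ (E n) ℝ) (x, t) := by
      have h3 : HasDerivAt (fun s : ℝ => (2 * s)⁻¹) (-(2 * t ^ 2)⁻¹) t := by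
        have := ((hasDerivAt_id t).const_mul 2).inv (by simpa using ht.ne')
        refine this.congr_deriv ?_
        change -(2 * 1) / (2 * t) ^ 2 = _
        field_simp
      have h4 : HasFDerivAt ((fun s : ℝ => (2 * s)⁻¹) ∘ Prod.snd) _ (x, t) :=
        HasDerivAt.comp_hasFDerivAt (x, t) h3 (hasFDerivAt_snd (𝕜 := ℝ) (p := (x, t)))
      exact h4
    have h3 : HasFDerivAt (fun z : E n × ℝ => ‖z.1 - u‖ ^ 2 * (2 * z.2)⁻¹ + realJ J u) _ (x, t) :=
      (h1.mul h2).add_const _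
    simp only [hq, div_eq_mul_inv]
    refine h3.congr_fderiv ?_
    ext v
    · simp [hL, hxu, norm_smul]
      field_simp
    · simp [hL, hxu, norm_smul]
      field_simp
      rw [sq_abs]
      ring
  have hqS : q (x, t) = S0 J x t := by
    rw [hJ.S0_eq x ht]
  rw [hasFDerivAt_iff_isLittleO] at hqd ⊢
  refine (Asymptotics.IsBigO.of_bound 1 ?_).trans_isLittleO hqd
  have hev : ∀ᶠ z in 𝓝 (x, t), z ∈ spaceTime n :=
    isOpen_spaceTime.mem_nhds (mem_spaceTime.2 ht)
  filter_upwards [hev] with z hz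
  have hz2 := mem_spaceTime.1 hz
  have h1 := hJ.affine_le_S0 x z.1 ht hz2
  have h2 : S0 J z.1 z.2 ≤ q z := hJ.S0_le z.1 hz2 (hJ.uMAP_mem x ht)
  have hLz : L (z - (x, t)) = inner ℝ p (z.1 - x) - ‖p‖ ^ 2 / 2 * (z.2 - t) := by
    simp [hL]
  rw [hqS, hLz, one_mul, Real.norm_of_nonneg (by linarith), Real.norm_of_nonneg (by linarith)]
  linarith

/-- Monotonicity of the subdifferential: the two optimality conditions are added, one rescaled by
`t' / t` so that the values of `J` cancel. -/
theorem norm_uMAP_sub_le (x x' : E n) {t t' : ℝ} (ht : 0 < t) (ht' : 0 < t') :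
    ‖uMAP J x' t' - uMAP J x t‖ ≤ ‖x' - x‖ + |1 - t' / t| * ‖x - uMAP J x t‖ := by
  set u := uMAP J x t with hu
  set u' := uMAP J x' t' with hu'
  have h1 := hJ.inner_le_of_forall_le ht (hJ.mapCost_uMAP_le x ht) (hJ.uMAP_mem x' ht')
  have h2 := hJ.inner_le_of_forall_le ht' (hJ.mapCost_uMAP_le x' ht') (hJ.uMAP_mem x ht)
  rw [← hu, ← hu'] at h1 h2
  have hr : 0 ≤ t' / t := by positivity
  have h3 : t' / t * inner ℝ (x - u) (u' - u) ≤ t' * (realJ J u' - realJ J u) := by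
    calc t' / t * inner ℝ (x - u) (u' - u) ≤ t' / t * (t * (realJ J u' - realJ J u)) := by gcongr
      _ = _ := by field_simp
  have h4 : t' / t * inner ℝ (x - u) (u' - u) + inner ℝ (x' - u') (u - u') ≤ 0 := by linarith
  have h5 : ‖u' - u‖ ^ 2 = t' / t * inner ℝ (x - u) (u' - u) + inner ℝ (x' - u') (u - u') +
      inner ℝ ((x' - x) + (1 - t' / t) • (x - u)) (u' - u) := by
    rw [← real_inner_self_eq_norm_sq, ← real_inner_smul_left, ← neg_sub u' u, inner_neg_right,
      ← sub_eq_add_neg, ← inner_sub_left, ← inner_add_left]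
    congr 1
    module
  have h6 : inner ℝ ((x' - x) + (1 - t' / t) • (x - u)) (u' - u) ≤
      (‖x' - x‖ + |1 - t' / t| * ‖x - u‖) * ‖u' - u‖ := by
    refine (real_inner_le_norm _ _).trans ?_
    gcongr
    refine (norm_add_le _ _).trans ?_
    rw [norm_smul, Real.norm_eq_abs]
  have h7 : ‖u' - u‖ * ‖u' - u‖ ≤ (‖x' - x‖ + |1 - t' / t| * ‖x - u‖) * ‖u' - u‖ := by
    rw [← sq]; linarith
  rcases (norm_nonneg (u' - u)).eq_or_lt with h | h
  · rw [← h]; positivity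
  · exact le_of_mul_le_mul_right h7 h

theorem continuousOn_uMAP : ContinuousOn (fun p : E n × ℝ => uMAP J p.1 p.2) (spaceTime n) := by
  rintro ⟨x, t⟩ hp
  have ht : 0 < t := mem_spaceTime.1 hp
  refine ContinuousAt.continuousWithinAt ?_
  rw [ContinuousAt, tendsto_iff_norm_sub_tendsto_zero]
  have hlim : Tendsto (fun p : E n × ℝ => ‖p.1 - x‖ + |1 - p.2 / t| * ‖x - uMAP J x t‖) (𝓝 (x, t))
      (𝓝 0) := by
    have hc : Continuous fun p : E n × ℝ =>
        ‖p.1 - x‖ + |1 - p.2 / t| * ‖x - uMAP J x t‖ := by fun_prop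
    have := hc.tendsto (x, t)
    simpa [ht.ne'] using this
  refine tendsto_of_tendsto_of_tendsto_of_le_of_le' tendsto_const_nhds hlim
    (Eventually.of_forall fun _ => norm_nonneg _) ?_
  filter_upwards [isOpen_spaceTime.mem_nhds hp] with p hp'
  exact hJ.norm_uMAP_sub_le x p.1 ht (mem_spaceTime.1 hp')

theorem continuousOn_slopeMAP :
    ContinuousOn (fun p : E n × ℝ => slopeMAP J p.1 p.2) (spaceTime n) := by
  refine ContinuousOn.smul (continuousOn_snd.inv₀ fun p hp => (mem_spaceTime.1 hp).ne')
    (continuousOn_fst.sub hJ.continuousOn_uMAP)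

theorem contDiffOn_S0 : ContDiffOn ℝ 1 (fun p : E n × ℝ => S0 J p.1 p.2) (spaceTime n) := by
  have h1 : (1 : ℕ∞ω) = 0 + 1 := by norm_num
  rw [h1, contDiffOn_succ_iff_fderiv_of_isOpen isOpen_spaceTime]
  refine ⟨fun p hp => (hJ.hasFDerivAt_S0 p.1
    (mem_spaceTime.1 hp)).differentiableAt.differentiableWithinAt, by simp, ?_⟩
  rw [contDiffOn_zero]
  have hc := hJ.continuousOn_slopeMAP
  have h2 : ContinuousOn (fun p : E n × ℝ => (innerSL ℝ (slopeMAP J p.1 p.2)).comp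
      (ContinuousLinearMap.fst ℝ (E n) ℝ) -
        (‖slopeMAP J p.1 p.2‖ ^ 2 / 2) • ContinuousLinearMap.snd ℝ (E n) ℝ) (spaceTime n) := by
    fun_prop
  exact h2.congr fun p hp => (hJ.hasFDerivAt_S0 p.1 (mem_spaceTime.1 hp)).fderiv

theorem gradX_S0 (x : E n) {t : ℝ} (ht : 0 < t) : gradX (S0 J) x t = slopeMAP J x t := by
  refine HasGradientAt.gradient ?_
  rw [hasGradientAt_iff_hasFDerivAt]
  have h : HasFDerivAt (fun z : E n => (z, t)) (ContinuousLinearMap.inl ℝ (E n) ℝ) x :=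
    hasFDerivAt_prodMk_left x t
  refine ((hJ.hasFDerivAt_S0 x ht).comp x h).congr_fderiv ?_
  ext v
  simp

theorem hasDerivAt_S0 (x : E n) {t : ℝ} (ht : 0 < t) :
    HasDerivAt (fun s => S0 J x s) (-(‖slopeMAP J x t‖ ^ 2 / 2)) t := by
  have h : HasDerivAt (fun s : ℝ => (x, s)) ((0, 1) : E n × ℝ) t :=
    (hasDerivAt_const t x).prodMk (hasDerivAt_id t)
  refine ((hJ.hasFDerivAt_S0 x ht).comp_hasDerivAt t h).congr_deriv ?_
  simp

theorem derivT_S0 (x : E n) {t : ℝ} (ht : 0 < t) :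
    derivT (S0 J) x t = -(‖slopeMAP J x t‖ ^ 2 / 2) := (hJ.hasDerivAt_S0 x ht).deriv

theorem uMAP_eq (x : E n) {t : ℝ} (ht : 0 < t) : uMAP J x t = x - t • gradX (S0 J) x t := by
  rw [hJ.gradX_S0 x ht, slopeMAP, smul_smul, mul_inv_cancel₀ ht.ne', one_smul, sub_sub_cancel]

/-- If the minimizer is near `x`, lower semicontinuity bounds `J` there from below; if it stays at
distance `r`, the term `r ^ 2 / (2 * t)` blows up as `t → 0`. -/
theorem eventually_lt_S0 (x : E n) {a : EReal} (ha : a < J x) :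
    ∀ᶠ t in 𝓝[>] (0 : ℝ), a < (S0 J x t : EReal) := by
  have h1 : ∀ᶠ y in 𝓝 x, a < J y := hJ.gammaZero.lsc x a ha
  obtain ⟨r, hr, hball⟩ := Metric.eventually_nhds_iff.1 h1
  obtain ⟨c, hc, -⟩ := EReal.lt_iff_exists_real_btwn.1 (lt_of_lt_of_le ha le_top)
  have h2 : Ioo (0 : ℝ) (r ^ 2 / (2 * (|c| + 1))) ∈ 𝓝[>] (0 : ℝ) :=
    Ioo_mem_nhdsGT (by positivity)
  filter_upwards [h2] with t ht
  obtain ⟨ht0, ht1⟩ := ht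
  have hu := hJ.uMAP_mem x ht0
  have hS := hJ.S0_eq x ht0
  by_cases hd : dist (uMAP J x t) x < r
  · refine lt_of_lt_of_le (hball hd) ?_
    rw [← hJ.coe_realJ hu, EReal.coe_le_coe_iff, hS]
    have : 0 ≤ ‖x - uMAP J x t‖ ^ 2 / (2 * t) := by positivity
    linarith
  · refine hc.trans_le ?_
    rw [EReal.coe_le_coe_iff, hS]
    have h3 : r ≤ ‖x - uMAP J x t‖ := by
      rw [← dist_eq_norm, dist_comm]; exact not_lt.1 hd
    have h4 : |c| ≤ ‖x - uMAP J x t‖ ^ 2 / (2 * t) := by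
      rw [le_div_iff₀ (by positivity)]
      rw [lt_div_iff₀ (by positivity)] at ht1
      have : r ^ 2 ≤ ‖x - uMAP J x t‖ ^ 2 := by gcongr
      nlinarith
    have := hJ.realJ_nonneg (uMAP J x t)
    have := le_abs_self c
    linarith

theorem S0_le_coe (x : E n) {t : ℝ} (ht : 0 < t) : (S0 J x t : EReal) ≤ J x := by
  rw [hJ.coe_S0 x ht]
  refine (iInf_le _ x).trans ?_
  simp [mapCost]

theorem isFirstOrderSolution_S0 : IsFirstOrderSolution J (S0 J) where
  contDiff := hJ.contDiffOn_S0
  convex := hJ.convexOn_S0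
  pde := by
    intro x t ht
    rw [hJ.derivT_S0 x ht, hJ.gradX_S0 x ht]
    ring
  initial := by
    intro x
    refine tendsto_order.2 ⟨fun a ha => hJ.eventually_lt_S0 x ha, fun a ha => ?_⟩
    filter_upwards [self_mem_nhdsWithin] with t ht
    exact (hJ.S0_le_coe x ht).trans_lt ha

end IsRegularizer

end ViscousHJ

/-! ### Hopf–Cole transform, existence, uniqueness and initial limits. -/

namespace ViscousHJ

variable {n : ℕ} {J : E n → EReal}

open Classical in
/-- The prior density `exp (-J / ε)`. -/
def prior (J : E n → EReal) (ε : ℝ) (y : E n) : ℝ :=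
  if J y = ⊤ then 0 else Real.exp (-realJ J y / ε)

theorem prior_of_mem {ε : ℝ} {y : E n} (hy : y ∈ effDom J) :
    prior J ε y = Real.exp (-realJ J y / ε) := if_neg (mem_effDom.1 hy).ne

theorem prior_of_notMem {ε : ℝ} {y : E n} (hy : y ∉ effDom J) : prior J ε y = 0 :=
  if_pos (eq_top_of_notMem_effDom hy)

theorem prior_nonneg (ε : ℝ) (y : E n) : 0 ≤ prior J ε y := by
  by_cases hy : y ∈ effDom J
  · rw [prior_of_mem hy]; positivity
  · rw [prior_of_notMem hy]

theorem weight_eq (J : E n → EReal) (x : E n) (t ε : ℝ) (y : E n) :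
    weight J x t ε y = gauss x (t * ε) y * prior J ε y := by
  by_cases hy : J y = ⊤
  · simp [weight, prior, hy]
  · simp only [weight, prior, hy, if_false, gauss, realJ]
    rw [← Real.exp_add]
    congr 1
    rw [neg_add, add_div, ← mul_assoc, neg_div, div_div]

theorem partitionFn_eq (J : E n → EReal) (x : E n) (t ε : ℝ) :
    partitionFn J x t ε = gaussInt (prior J ε) x (t * ε) := by
  simp only [partitionFn, gaussInt, weight_eq]

theorem Seps_eq (J : E n → EReal) (ε : ℝ) (x : E n) (t : ℝ) :
    Seps J ε x t = -ε * Real.log (heat (prior J ε) x (t * ε)) := by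
  simp only [Seps, heat, partitionFn_eq, mul_assoc]

/-- The Hopf–Cole transform. Existence uses the passage from the heat equation to `S`, uniqueness
the converse for an arbitrary solution, hence the equivalence. -/
theorem deriv_exp_eq_iff {S : E n → ℝ → ℝ} {ε : ℝ} (hε : 0 < ε)
    (hS : ContDiffOn ℝ ∞ (fun p : E n × ℝ => S p.1 p.2) (spaceTime n)) (x : E n) {t : ℝ}
    (ht : 0 < t) :
    derivT S x t + 1 / 2 * ‖gradX S x t‖ ^ 2 = ε / 2 * lapX S x t ↔
      deriv (fun s => Real.exp (-S x s / ε)) t =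
        ε / 2 * Laplacian.laplacian (fun z => Real.exp (-S z t / ε)) x := by
  have h1 : HasDerivAt (fun s => S x s) (derivT S x t) t :=
    ((contDiffAt_time_of_contDiffOn_spaceTime hS x ht).differentiableAt (by simp)).hasDerivAt
  have h2 : HasDerivAt (fun s => Real.exp (-S x s / ε)) _ t := (h1.fun_neg.div_const ε).exp
  rw [h2.deriv, laplacian_exp_neg_div
    ((contDiff_slice_of_contDiffOn_spaceTime hS ht).of_le two_le_infty) hε.ne']
  have he := Real.exp_pos (-S x t / ε)
  have e : ε / 2 * (Real.exp (-S x t / ε) * (‖gradient (fun z => S z t) x‖ ^ 2 / ε ^ 2 -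
      Laplacian.laplacian (fun z => S z t) x / ε)) = Real.exp (-S x t / ε) *
      ((1 / 2 * ‖gradX S x t‖ ^ 2 - ε / 2 * lapX S x t) / ε) := by
    simp only [gradX, lapX]
    field_simp
  rw [e, mul_right_inj' he.ne', div_left_inj' hε.ne']
  constructor <;> intro h <;> linarith

theorem IsViscousSolution.tendsto_exp {ε : ℝ} (hε : 0 < ε) (hJ : IsRegularizer J) {S : ℝ → ℝ}
    {y : E n} (hS : Tendsto (fun t => (S t : EReal)) (𝓝[>] 0) (𝓝 (J y))) :
    Tendsto (fun t => Real.exp (-S t / ε)) (𝓝[>] 0) (𝓝 (prior J ε y)) := by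
  by_cases hy : y ∈ effDom J
  · rw [prior_of_mem hy]
    rw [← hJ.coe_realJ hy, EReal.tendsto_coe] at hS
    exact (Real.continuous_exp.tendsto _).comp (hS.neg.div_const ε)
  · rw [prior_of_notMem hy]
    rw [eq_top_of_notMem_effDom hy, EReal.tendsto_coe_nhds_top_iff] at hS
    have : Tendsto (fun t => -S t / ε) (𝓝[>] 0) atBot :=
      (tendsto_neg_atTop_atBot.comp hS).atBot_div_const hε
    exact Real.tendsto_exp_atBot.comp this

namespace IsRegularizer

variable (hJ : IsRegularizer J)
include hJ

theorem measurable_prior (ε : ℝ) : Measurable (prior J ε) :=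
  Measurable.ite (hJ.measurable (measurableSet_singleton ⊤)) measurable_const
    (Real.measurable_exp.comp (hJ.measurable_realJ.neg.div_const ε))

theorem abs_prior_le_one {ε : ℝ} (hε : 0 < ε) (y : E n) : |prior J ε y| ≤ 1 := by
  rw [abs_of_nonneg (prior_nonneg _ _)]
  by_cases hy : y ∈ effDom J
  · rw [prior_of_mem hy]
    refine Real.exp_le_one_iff.2 ?_
    exact div_nonpos_of_nonpos_of_nonneg (neg_nonpos.2 (hJ.realJ_nonneg y)) hε.le
  · rw [prior_of_notMem hy]; exact zero_le_one

theorem integrable_weight (x : E n) {t ε : ℝ} (ht : 0 < t) (hε : 0 < ε) :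
    Integrable (weight J x t ε) := by
  rw [funext (weight_eq J x t ε)]
  exact integrable_gauss_mul (hJ.measurable_prior ε).aestronglyMeasurable
    (hJ.abs_prior_le_one hε) x (mul_pos ht hε)

omit hJ in
theorem _root_.ViscousHJ.weight_nonneg (J : E n → EReal) (x : E n) (t ε : ℝ) (y : E n) :
    0 ≤ weight J x t ε y := by
  rw [weight_eq]
  exact mul_nonneg (gauss_pos _ _ _).le (prior_nonneg _ _)

omit hJ in
theorem _root_.ViscousHJ.weight_of_notMem (x : E n) (t ε : ℝ) {y : E n} (hy : y ∉ effDom J) :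
    weight J x t ε y = 0 := if_pos (eq_top_of_notMem_effDom hy)

omit hJ in
theorem _root_.ViscousHJ.weight_of_mem (x : E n) (t ε : ℝ) {y : E n} (hy : y ∈ effDom J) :
    weight J x t ε y = Real.exp (-(‖x - y‖ ^ 2 / (2 * t) + realJ J y) / ε) :=
  if_neg (mem_effDom.1 hy).ne

omit hJ in
theorem _root_.ViscousHJ.weight_pos (x : E n) (t ε : ℝ) {y : E n} (hy : y ∈ effDom J) :
    0 < weight J x t ε y := by
  rw [weight_of_mem x t ε hy]
  exact Real.exp_pos _

omit hJ in
theorem _root_.ViscousHJ.support_weight (x : E n) (t ε : ℝ) :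
    Function.support (weight J x t ε) = effDom J := by
  ext y
  refine ⟨fun h => ?_, fun h => (weight_pos x t ε h).ne'⟩
  by_contra hy
  exact h (weight_of_notMem x t ε hy)

theorem volume_effDom_pos : 0 < volume (effDom J) :=
  (isOpen_interior.measure_pos volume hJ.interior_dom_nonempty).trans_le
    (measure_mono interior_subset)

theorem partitionFn_pos (x : E n) {t ε : ℝ} (ht : 0 < t) (hε : 0 < ε) :
    0 < partitionFn J x t ε := by
  rw [partitionFn, integral_pos_iff_support_of_nonneg (weight_nonneg J x t ε)
    (hJ.integrable_weight x ht hε), support_weight]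
  exact hJ.volume_effDom_pos

omit hJ in
theorem _root_.ViscousHJ.partitionFn_eq_setIntegral (x : E n) (t ε : ℝ) :
    partitionFn J x t ε = ∫ y in effDom J, weight J x t ε y :=
  (setIntegral_eq_integral_of_forall_compl_eq_zero fun _ hy => weight_of_notMem x t ε hy).symm

theorem heat_prior_pos (x : E n) {t ε : ℝ} (ht : 0 < t) (hε : 0 < ε) :
    0 < heat (prior J ε) x (t * ε) := by
  have := hJ.partitionFn_pos x ht hε
  rw [partitionFn_eq] at this
  unfold heat
  positivity

theorem exp_neg_Seps_div (x : E n) {t ε : ℝ} (ht : 0 < t) (hε : 0 < ε) :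
    Real.exp (-Seps J ε x t / ε) = heat (prior J ε) x (t * ε) := by
  rw [Seps_eq, neg_mul, neg_neg, mul_div_cancel_left₀ _ hε.ne',
    Real.exp_log (hJ.heat_prior_pos x ht hε)]

theorem contDiffOn_heat_prior {ε : ℝ} (hε : 0 < ε) :
    ContDiffOn ℝ ∞ (fun p : E n × ℝ => heat (prior J ε) p.1 (p.2 * ε)) (spaceTime n) := by
  refine (contDiffOn_heat (hJ.measurable_prior ε).aestronglyMeasurable
    (hJ.abs_prior_le_one hε)).comp (f := fun p : E n × ℝ => (p.1, p.2 * ε))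
    (contDiffOn_fst.prodMk (contDiffOn_snd.mul contDiffOn_const)) fun p hp => ?_
  exact mem_spaceTime.2 (mul_pos (mem_spaceTime.1 hp) hε)

theorem contDiffOn_Seps {ε : ℝ} (hε : 0 < ε) :
    ContDiffOn ℝ ∞ (fun p : E n × ℝ => Seps J ε p.1 p.2) (spaceTime n) := by
  simp_rw [Seps_eq]
  exact contDiffOn_const.mul ((hJ.contDiffOn_heat_prior hε).log fun p hp =>
    (hJ.heat_prior_pos p.1 (mem_spaceTime.1 hp) hε).ne')

/-- Quadratic growth of the cost bounds the weight by `exp (-S_0 / ε)` times a Gaussian centred at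
the minimizer, and the mass of that Gaussian is exactly the normalizing factor in `S_ε`. -/
theorem S0_le_Seps (x : E n) {t ε : ℝ} (ht : 0 < t) (hε : 0 < ε) :
    S0 J x t ≤ Seps J ε x t := by
  have hs : 0 < t * ε := mul_pos ht hε
  set u := uMAP J x t
  have hle : ∀ y, weight J x t ε y ≤ Real.exp (-S0 J x t / ε) * gauss u (t * ε) y := by
    intro y
    by_cases hy : y ∈ effDom J
    · rw [weight_of_mem x t ε hy, gauss, ← Real.exp_add]
      refine Real.exp_le_exp.2 ?_
      have h := hJ.S0_add_norm_sq_le x ht hy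
      have e : -S0 J x t / ε + -(‖u - y‖ ^ 2 / (2 * (t * ε))) =
          -(S0 J x t + ‖u - y‖ ^ 2 / (2 * t)) / ε := by
        field_simp
        ring
      rw [e]
      gcongr
    · rw [weight_of_notMem x t ε hy]
      exact mul_nonneg (Real.exp_pos _).le (gauss_pos _ _ _).le
  have h1 : partitionFn J x t ε ≤
      Real.exp (-S0 J x t / ε) * (2 * Real.pi * (t * ε)) ^ ((n : ℝ) / 2) := by
    rw [← integral_gauss u hs, ← integral_const_mul]
    exact integral_mono (hJ.integrable_weight x ht hε) ((integrable_gauss u hs).const_mul _) hle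
  have h2 : Real.exp (-Seps J ε x t / ε) ≤ Real.exp (-S0 J x t / ε) := by
    rw [hJ.exp_neg_Seps_div x ht hε, heat, ← partitionFn_eq]
    have hp : 0 < (2 * Real.pi * (t * ε)) ^ ((n : ℝ) / 2) := by positivity
    rw [one_div, inv_mul_le_iff₀ hp, mul_comm]
    exact h1
  rw [Real.exp_le_exp, div_le_div_iff_of_pos_right hε] at h2
  linarith

theorem continuousAt_prior {ε : ℝ} {x : E n} (hx : x ∈ interior (effDom J)) :
    ContinuousAt (prior J ε) x := by
  have hD := isOpen_interior.mem_nhds hx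
  have h1 : ContinuousAt (fun y => Real.exp (-realJ J y / ε)) x := by
    have := hJ.continuousOn_realJ.continuousAt hD
    fun_prop
  refine h1.congr ?_
  filter_upwards [hD] with y hy
  exact (prior_of_mem (interior_subset hy)).symm

theorem tendsto_Seps_of_mem_interior {ε : ℝ} (hε : 0 < ε) {x : E n}
    (hx : x ∈ interior (effDom J)) :
    Tendsto (fun t => (Seps J ε x t : EReal)) (𝓝[>] 0) (𝓝 (J x)) := by
  have h1 := tendsto_heat_of_continuousAt hε (hJ.measurable_prior ε) (hJ.abs_prior_le_one hε)
    (hJ.continuousAt_prior (ε := ε) hx)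
  rw [prior_of_mem (interior_subset hx)] at h1
  have h2 := (h1.log (Real.exp_pos _).ne').const_mul (-ε)
  rw [Real.log_exp] at h2
  rw [← hJ.coe_realJ (interior_subset hx), EReal.tendsto_coe,
    funext (Seps_eq J ε x)]
  convert h2 using 2
  field_simp

theorem eventually_lt_Seps {ε : ℝ} (hε : 0 < ε) (x : E n) {a : EReal} (ha : a < J x) :
    ∀ᶠ t in 𝓝[>] (0 : ℝ), a < (Seps J ε x t : EReal) := by
  filter_upwards [hJ.eventually_lt_S0 x ha, self_mem_nhdsWithin] with t h1 ht
  exact h1.trans_le (EReal.coe_le_coe_iff.2 (hJ.S0_le_Seps x ht hε))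

theorem le_liminf_Seps {ε : ℝ} (hε : 0 < ε) (x : E n) :
    J x ≤ liminf (fun t => (Seps J ε x t : EReal)) (𝓝[>] 0) := by
  refine le_of_forall_lt fun a ha => ?_
  obtain ⟨b, hab, hb⟩ := exists_between ha
  exact hab.trans_le (le_liminf_of_le (by isBoundedDefault)
    ((hJ.eventually_lt_Seps hε x hb).mono fun _ h => h.le))

theorem isViscousSolution_Seps {ε : ℝ} (hε : 0 < ε) : IsViscousSolution J ε (Seps J ε) where
  nonneg x t ht := (hJ.S0_nonneg x ht).trans (hJ.S0_le_Seps x ht hε)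
  smooth := hJ.contDiffOn_Seps hε
  pde := by
    intro x t ht
    rw [deriv_exp_eq_iff hε (hJ.contDiffOn_Seps hε) x ht]
    have h1 := hasDerivAt_heat (hJ.measurable_prior ε).aestronglyMeasurable
      (hJ.abs_prior_le_one hε) x (mul_pos ht hε)
    have h2 := h1.comp t ((hasDerivAt_id t).mul_const ε)
    have e : (fun s => Real.exp (-Seps J ε x s / ε)) =ᶠ[𝓝 t]
        ((fun s => heat (prior J ε) x s) ∘ fun s => id s * ε) := by
      filter_upwards [lt_mem_nhds ht] with s hs
      exact hJ.exp_neg_Seps_div x hs hε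
    rw [e.deriv_eq, h2.deriv]
    simp_rw [hJ.exp_neg_Seps_div _ ht hε]
    ring
  initial := by
    intro x hx
    by_cases hxd : x ∈ effDom J
    · refine hJ.tendsto_Seps_of_mem_interior hε ?_
      by_contra h
      exact hx ⟨hxd, h⟩
    · refine tendsto_order.2 ⟨fun a ha => hJ.eventually_lt_Seps hε x ha, fun a ha => ?_⟩
      rw [eq_top_of_notMem_effDom hxd] at ha
      exact absurd ha not_top_lt

theorem ae_notMem_boundary : ∀ᵐ y, y ∉ effDom J \ interior (effDom J) := by
  filter_upwards [hJ.effDom_ae_eq_interior.le] with y hy h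
  exact h.2 (hy h.1)

/-- Nonnegativity of `S` is what bounds its Hopf–Cole transform. The points where no initial limit
is assumed form a null set and do not affect the heat integral. -/
theorem eq_Seps_of_isViscousSolution {ε : ℝ} (hε : 0 < ε) {S : E n → ℝ → ℝ}
    (hS : IsViscousSolution J ε S) (x : E n) {t : ℝ} (ht : 0 < t) : S x t = Seps J ε x t := by
  have h := eq_heat_of_bounded_solution_of_tendsto (w := fun x t => Real.exp (-S x t / ε))
    (f := prior J ε) (C := 1) hε (fun x t ht => by
      rw [Real.abs_exp]
      exact Real.exp_le_one_iff.2
        (div_nonpos_of_nonpos_of_nonneg (neg_nonpos.2 (hS.nonneg x t ht)) hε.le))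
    (hS.smooth.neg.div_const ε).exp
    (fun x t ht => (deriv_exp_eq_iff hε hS.smooth x ht).1 (hS.pde x t ht))
    (by
      filter_upwards [hJ.ae_notMem_boundary] with y hy
      exact IsViscousSolution.tendsto_exp hε hJ (hS.initial y hy)) x ht
  rw [← hJ.exp_neg_Seps_div x ht hε, Real.exp_eq_exp, div_left_inj' hε.ne'] at h
  exact neg_injective h

/-- Convexity on the segment from `x` to `x + z` gives `J (x + √t z) ≤ (1 - √t) J x + √t J (x + z)`.
The resulting lower bound for the heat integral tends to `exp (-J x / ε)` times `K`, the Gaussian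
mass of `dom J` seen from `x`. -/
theorem limsup_Seps_le {ε : ℝ} (hε : 0 < ε) {x : E n} (hx : x ∈ effDom J) :
    limsup (fun t => (Seps J ε x t : EReal)) (𝓝[>] 0) ≤
      J x - ((ε * Real.log (1 / (2 * Real.pi * ε) ^ ((n : ℝ) / 2) *
        ∫ y in effDom J, Real.exp (-(1 / (2 * ε)) * ‖x - y‖ ^ 2)) : ℝ) : EReal) := by
  classical
  set N : E n → ℝ := fun z => 1 / (2 * Real.pi * ε) ^ ((n : ℝ) / 2) * gauss 0 ε z with hN
  have hN0 : ∀ z, 0 ≤ N z := normalized_gauss_nonneg hε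
  have hNi : Integrable N := integrable_normalized_gauss hε
  have hNc : Continuous N := continuous_const.mul (continuous_gauss 0 ε)
  -- With `r = √t`, this is the lower bound for the prior at `x + r • z`.
  set k : ℝ → E n → ℝ := fun r z => if x + z ∈ effDom J then
    Real.exp (-((1 - r) * realJ J x + r * realJ J (x + z)) / ε) else 0 with hk
  have hkm : ∀ r, Measurable (k r) := fun r => by
    have ha : Measurable fun z : E n => x + z := measurable_const_add x
    refine Measurable.ite (hJ.measurableSet_effDom.preimage ha) ?_ measurable_const
    have := hJ.measurable_realJ.comp ha
    simp only [Function.comp_def] at this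
    fun_prop
  have hk0 : ∀ r z, 0 ≤ k r z := fun r z => by
    simp only [hk]; split_ifs <;> positivity
  have hk1 : ∀ r ∈ Icc (0 : ℝ) 1, ∀ z, k r z ≤ 1 := fun r hr z => by
    simp only [hk]
    split_ifs
    · refine Real.exp_le_one_iff.2 (div_nonpos_of_nonpos_of_nonneg (neg_nonpos.2 ?_) hε.le)
      have h1 := hJ.realJ_nonneg x
      have h2 := hJ.realJ_nonneg (x + z)
      have h3 := hr.1
      have h4 : 0 ≤ 1 - r := by linarith [hr.2]
      positivity
    · exact zero_le_one
  set I : ℝ → ℝ := fun r => ∫ z, N z * k r z with hI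
  have hint : ∀ r ∈ Icc (0 : ℝ) 1, Integrable fun z => N z * k r z := fun r hr => by
    refine hNi.mono' (hNc.aestronglyMeasurable.mul (hkm r).aestronglyMeasurable)
      (ae_of_all _ fun z => ?_)
    rw [Real.norm_of_nonneg (mul_nonneg (hN0 z) (hk0 r z))]
    exact mul_le_of_le_one_right (hN0 z) (hk1 r hr z)
  have hlow : ∀ t ∈ Ioo (0 : ℝ) 1, I √t ≤ heat (prior J ε) x (t * ε) := by
    intro t ht
    have hs0 : 0 ≤ √t := Real.sqrt_nonneg t
    have hs1 : √t ≤ 1 := Real.sqrt_le_one.2 ht.2.le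
    rw [heat_mul_eq_integral _ x ht.1 hε]
    refine integral_mono (hint _ ⟨hs0, hs1⟩) ?_ fun z => ?_
    · refine hNi.mono' (hNc.aestronglyMeasurable.mul ((hJ.measurable_prior ε).comp
        (by fun_prop)).aestronglyMeasurable) (ae_of_all _ fun z => ?_)
      rw [norm_mul, Real.norm_of_nonneg (hN0 z)]
      exact mul_le_of_le_one_right (hN0 z) (hJ.abs_prior_le_one hε _)
    · refine mul_le_mul_of_nonneg_left ?_ (hN0 z)
      simp only [hk]
      split_ifs with hz
      · have e : x + √t • z = (1 - √t) • x + √t • (x + z) := by module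
        have hmem := hJ.gammaZero.dom_convex hx hz (by linarith : 0 ≤ 1 - √t) hs0 (by ring)
        have hcv := hJ.convexOn_realJ.2 hx hz (by linarith : 0 ≤ 1 - √t) hs0 (by ring)
        simp only [smul_eq_mul] at hcv
        rw [e, prior_of_mem hmem]
        gcongr
      · exact prior_nonneg _ _
  have hlim : Tendsto (fun t => I √t) (𝓝[>] 0) (𝓝 (I 0)) := by
    refine tendsto_integral_filter_of_dominated_convergence N
      (Eventually.of_forall fun t => hNc.aestronglyMeasurable.mul (hkm _).aestronglyMeasurable) ?_
      hNi (ae_of_all _ fun z => ?_)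
    · filter_upwards [Ioo_mem_nhdsGT (one_pos (α := ℝ))] with t ht
      refine ae_of_all _ fun z => ?_
      rw [Real.norm_of_nonneg (mul_nonneg (hN0 z) (hk0 _ z))]
      exact mul_le_of_le_one_right (hN0 z) (hk1 _ ⟨Real.sqrt_nonneg _,
        Real.sqrt_le_one.2 ht.2.le⟩ z)
    · have hc : Continuous fun t : ℝ => N z * k √t z := by
        simp only [hk]
        split_ifs <;> fun_prop
      have := hc.tendsto 0
      rw [Real.sqrt_zero] at this
      exact this.mono_left nhdsWithin_le_nhds
  set K : ℝ := 1 / (2 * Real.pi * ε) ^ ((n : ℝ) / 2) *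
    ∫ y in effDom J, Real.exp (-(1 / (2 * ε)) * ‖x - y‖ ^ 2) with hK
  have hI0 : I 0 = Real.exp (-realJ J x / ε) * K := by
    rw [hK, ← integral_indicator hJ.measurableSet_effDom,
      ← integral_add_left_eq_self _ x, ← integral_const_mul, ← integral_const_mul]
    refine integral_congr_ae (ae_of_all _ fun z => ?_)
    simp only [hk, hN, indicator]
    split_ifs
    · rw [gauss]
      have e : -(‖0 - z‖ ^ 2 / (2 * ε)) = -(1 / (2 * ε)) * ‖x - (x + z)‖ ^ 2 := by
        rw [zero_sub, sub_add_cancel_left]; ring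
      rw [e]
      ring_nf
    · ring
  have hKpos : 0 < K := by
    have : 0 < ∫ y in effDom J, Real.exp (-(1 / (2 * ε)) * ‖x - y‖ ^ 2) := by
      have e : ∀ y, Real.exp (-(1 / (2 * ε)) * ‖x - y‖ ^ 2) = gauss x ε y := fun y => by
        rw [gauss]; congr 1; ring
      simp_rw [e]
      rw [setIntegral_pos_iff_support_of_nonneg_ae
        (ae_of_all _ fun y => (gauss_pos x ε y).le) (integrable_gauss x hε).integrableOn]
      have : Function.support (gauss x ε) = univ := by
        ext y; simpa using (gauss_pos x ε y).ne'
      rw [this, univ_inter]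
      exact hJ.volume_effDom_pos
    positivity
  have hI0pos : 0 < I 0 := by rw [hI0]; positivity
  have hlog : Tendsto (fun t => -ε * Real.log (I √t)) (𝓝[>] 0)
      (𝓝 (realJ J x - ε * Real.log K)) := by
    have := (hlim.log hI0pos.ne').const_mul (-ε)
    rw [hI0, Real.log_mul (Real.exp_pos _).ne' hKpos.ne', Real.log_exp] at this
    convert this using 2
    field_simp
    ring
  rw [← hJ.coe_realJ hx, ← EReal.coe_sub, ← (EReal.tendsto_coe.2 hlog).limsup_eq]
  refine limsup_le_limsup ?_ (by isBoundedDefault) (by isBoundedDefault)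
  filter_upwards [Ioo_mem_nhdsGT (one_pos (α := ℝ)), hlim.eventually (lt_mem_nhds hI0pos)]
    with t ht hpos
  rw [EReal.coe_le_coe_iff, Seps_eq, neg_mul, neg_mul, neg_le_neg_iff]
  exact mul_le_mul_of_nonneg_left (Real.log_le_log hpos (hlow t ht)) hε.le

end IsRegularizer

end ViscousHJ

/-! ### Convexity and monotonicity of `S_ε`, and the posterior mean. -/

namespace ViscousHJ

section General

theorem ConvexOn.add_fderiv_le {V : Type*} [NormedAddCommGroup V] [NormedSpace ℝ V] {s : Set V}
    {f : V → ℝ} {L : V →L[ℝ] ℝ} {x y : V} (hf : ConvexOn ℝ s f) (hL : HasFDerivAt f L x)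
    (hx : x ∈ s) (hy : y ∈ s) : f x + L (y - x) ≤ f y := by
  have h1 := hf.comp_affineMap (AffineMap.lineMap (k := ℝ) x y)
  have h2 : HasDerivAt (f ∘ AffineMap.lineMap (k := ℝ) x y) (L (y - x)) 0 := by
    have h3 : HasFDerivAt f L (AffineMap.lineMap (k := ℝ) x y (0 : ℝ)) := by simpa using hL
    exact h3.comp_hasDerivAt (0 : ℝ) AffineMap.hasDerivAt_lineMap
  have h4 := h1.le_slope_of_hasDerivAt (x := 0) (y := 1) (by simpa) (by simpa) one_pos h2
  rw [slope_def_field] at h4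
  simp only [Function.comp_apply, AffineMap.lineMap_apply_one, AffineMap.lineMap_apply_zero,
    sub_zero, div_one] at h4
  linarith

variable {n : ℕ}

theorem toDual_symm_apply_single (φ : E n →L[ℝ] ℝ) (i : Fin n) :
    (InnerProductSpace.toDual ℝ (E n)).symm φ i = φ (EuclideanSpace.single i 1) := by
  have h := InnerProductSpace.toDual_symm_apply (𝕜 := ℝ) (x := EuclideanSpace.single i 1) (y := φ)
  rw [EuclideanSpace.inner_single_right] at h
  rw [← h]
  simp

/-- The inverse of the Riesz isomorphism as a continuous linear map. -/
def rieszInv (n : ℕ) : (E n →L[ℝ] ℝ) →L[ℝ] E n :=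
  LinearMap.mkContinuous
    { toFun := (InnerProductSpace.toDual ℝ (E n)).symm
      map_add' := fun φ ψ => map_add _ φ ψ
      map_smul' := fun c φ => by simp } 1 fun φ => by simp

theorem rieszInv_apply (φ : E n →L[ℝ] ℝ) :
    rieszInv n φ = (InnerProductSpace.toDual ℝ (E n)).symm φ := rfl

theorem hasFDerivAt_sub_smul_gradient {f : E n → ℝ} {x : E n} (hf : ContDiffAt ℝ 2 f x) (t : ℝ) :
    HasFDerivAt (fun z => z - t • gradient f z) (ContinuousLinearMap.id ℝ (E n) - t •
      (rieszInv n).comp (fderiv ℝ (fderiv ℝ f) x)) x := by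
  have h1 : DifferentiableAt ℝ (fderiv ℝ f) x :=
    (hf.fderiv_right (m := 1) (by norm_num)).differentiableAt (by norm_num)
  refine (hasFDerivAt_id x).sub (HasFDerivAt.const_smul ?_ t)
  exact (rieszInv n).hasFDerivAt.comp x h1.hasFDerivAt

theorem divergence_sub_smul_gradient {f : E n → ℝ} {x : E n} (hf : ContDiffAt ℝ 2 f x) (t : ℝ) :
    divergence (fun z => z - t • gradient f z) x = n - t * Laplacian.laplacian f x := by
  rw [divergence, (hasFDerivAt_sub_smul_gradient hf t).fderiv, laplacian_eq_sum_fderiv hf,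
    Finset.mul_sum]
  have : ∀ i : Fin n, ((ContinuousLinearMap.id ℝ (E n) - t •
      (rieszInv n).comp (fderiv ℝ (fderiv ℝ f) x))
          (EuclideanSpace.single i 1)) i = 1 - t *
      fderiv ℝ (fun z => fderiv ℝ f z (EuclideanSpace.single i 1)) x
        (EuclideanSpace.single i 1) := by
    intro i
    have := toDual_symm_apply_single (fderiv ℝ (fderiv ℝ f) x (EuclideanSpace.single i 1)) i
    rw [(hasFDerivAt_fderiv_apply hf _).fderiv]
    simp [rieszInv_apply, this]
  rw [Finset.sum_congr rfl fun i _ => this i]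
  simp

/-- A hyperplane cannot fill an open set. Integral inequalities become strict because their
pointwise equality cases lie in a hyperplane. -/
theorem exists_mem_inner_ne {U : Set (E n)} (hU : IsOpen U) (hne : U.Nonempty) {v : E n}
    (hv : v ≠ 0) (c : ℝ) : 0 < volume (U ∩ {y | inner ℝ v y ≠ c}) := by
  have ho : IsOpen (U ∩ {y : E n | inner ℝ v y ≠ c}) :=
    hU.inter (isOpen_ne_fun (by fun_prop) continuous_const)
  refine ho.measure_pos volume ?_
  obtain ⟨y, hy⟩ := hne
  by_cases hc : inner ℝ v y = c
  · have hl : Tendsto (fun r : ℝ => y + r • v) (𝓝[>] 0) (𝓝 y) := by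
      have : Continuous fun r : ℝ => y + r • v := by fun_prop
      have := this.tendsto 0
      rw [zero_smul, add_zero] at this
      exact this.mono_left nhdsWithin_le_nhds
    obtain ⟨r, hr, hr0⟩ := ((hl.eventually (hU.mem_nhds hy)).and self_mem_nhdsWithin).exists
    refine ⟨y + r • v, hr, ?_⟩
    have hvv : 0 < inner ℝ v v := real_inner_self_pos.2 hv
    simp only [mem_ofPred_eq, inner_add_right, inner_smul_right, hc]
    have : 0 < r * inner ℝ v v := mul_pos hr0 hvv
    linarith
  · exact ⟨y, hy, hc⟩

/-- The left side is affine in `(X, t)`, and the optimal `p = X / t` gives equality; the right side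
is thus a supremum of affine functions, which is why it is jointly convex. -/
theorem inner_sub_le_norm_sq_div (p X : E n) {t : ℝ} (ht : 0 < t) :
    inner ℝ p X - t * ‖p‖ ^ 2 / 2 ≤ ‖X‖ ^ 2 / (2 * t) := by
  have h2 : 0 ≤ ‖X - t • p‖ ^ 2 / (2 * t) := by positivity
  have h3 : ‖X - t • p‖ ^ 2 / (2 * t) =
      ‖X‖ ^ 2 / (2 * t) - inner ℝ p X + t * ‖p‖ ^ 2 / 2 := by
    rw [norm_sub_sq_real, inner_smul_right, norm_smul, Real.norm_of_nonneg ht.le,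
      real_inner_comm]
    field_simp
  linarith

/-- Joint convexity of `(X, t) ↦ ‖X‖ ^ 2 / (2 * t)`. -/
theorem norm_sq_div_convex (X Y : E n) {t s a b : ℝ} (ht : 0 < t) (hs : 0 < s) (ha : 0 < a)
    (hb : 0 < b) : ‖a • X + b • Y‖ ^ 2 / (2 * (a * t + b * s)) ≤
      a * (‖X‖ ^ 2 / (2 * t)) + b * (‖Y‖ ^ 2 / (2 * s)) := by
  have hT : 0 < a * t + b * s := by positivity
  set p := (a * t + b * s)⁻¹ • (a • X + b • Y) with hp
  have h1 := mul_le_mul_of_nonneg_left (inner_sub_le_norm_sq_div p X ht) ha.le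
  have h2 := mul_le_mul_of_nonneg_left (inner_sub_le_norm_sq_div p Y hs) hb.le
  have h3 : a • X + b • Y = (a * t + b * s) • p := by
    rw [hp, smul_smul, mul_inv_cancel₀ hT.ne', one_smul]
  have h4 : a * inner ℝ p X + b * inner ℝ p Y = (a * t + b * s) * ‖p‖ ^ 2 := by
    rw [← inner_smul_right, ← inner_smul_right, ← inner_add_right, h3, inner_smul_right,
      real_inner_self_eq_norm_sq]
  have h5 : ‖(a * t + b * s) • p‖ ^ 2 / (2 * (a * t + b * s)) = (a * t + b * s) * ‖p‖ ^ 2 / 2 := by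
    rw [norm_smul, Real.norm_of_nonneg hT.le]
    field_simp
  rw [h3, h5]
  linarith

theorem norm_combo_sq (X Y : E n) {a b : ℝ} (hab : a + b = 1) :
    ‖a • X + b • Y‖ ^ 2 + a * b * ‖X - Y‖ ^ 2 = a * ‖X‖ ^ 2 + b * ‖Y‖ ^ 2 := by
  obtain rfl : b = 1 - a := by linarith
  rw [norm_add_sq_real, norm_sub_sq_real, norm_smul, norm_smul, inner_smul_left, inner_smul_right,
    mul_pow, mul_pow, Real.norm_eq_abs, Real.norm_eq_abs, sq_abs, sq_abs]
  simp
  ring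

end General

variable {n : ℕ} {J : E n → EReal}

namespace IsRegularizer

variable (hJ : IsRegularizer J)
include hJ

theorem Seps_eq_sub_log (x : E n) {t ε : ℝ} (ht : 0 < t) (hε : 0 < ε) :
    Seps J ε x t = n * ε / 2 * Real.log (2 * Real.pi * t * ε) -
      ε * Real.log (partitionFn J x t ε) := by
  have hZ := hJ.partitionFn_pos x ht hε
  have h : 0 < 2 * Real.pi * t * ε := by positivity
  rw [Seps, Real.log_mul (by positivity) hZ.ne', one_div, Real.log_inv, Real.log_rpow h]
  ring

/-- Joint convexity of the cost in `(x, t, y)` is precisely the hypothesis of Prékopa–Leindler for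
the three weights. -/
theorem weight_rpow_mul_le {P Q : E n × ℝ} (hP : P ∈ spaceTime n) (hQ : Q ∈ spaceTime n)
    {a b ε : ℝ} (hε : 0 < ε) (ha : 0 < a) (hb : 0 < b) (hab : a + b = 1) (y z : E n) :
    ENNReal.ofReal (weight J P.1 P.2 ε y) ^ a * ENNReal.ofReal (weight J Q.1 Q.2 ε z) ^ b ≤
      ENNReal.ofReal (weight J (a • P + b • Q).1 (a • P + b • Q).2 ε (a • y + b • z)) := by
  by_cases hy : y ∈ effDom J
  swap
  · simp [weight_of_notMem _ _ _ hy, ha]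
  by_cases hz : z ∈ effDom J
  swap
  · simp [weight_of_notMem _ _ _ hz, hb]
  have hw := hJ.gammaZero.dom_convex hy hz ha.le hb.le hab
  rw [weight_of_mem _ _ _ hy, weight_of_mem _ _ _ hz, weight_of_mem _ _ _ hw,
    ENNReal.ofReal_rpow_of_pos (Real.exp_pos _), ENNReal.ofReal_rpow_of_pos (Real.exp_pos _),
    ← ENNReal.ofReal_mul (by positivity), ← Real.exp_mul, ← Real.exp_mul, ← Real.exp_add]
  refine ENNReal.ofReal_le_ofReal (Real.exp_le_exp.2 ?_)
  have h1 := hJ.convexOn_realJ.2 hy hz ha.le hb.le hab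
  have h2 := norm_sq_div_convex (P.1 - y) (Q.1 - z) (mem_spaceTime.1 hP) (mem_spaceTime.1 hQ) ha hb
  have e1 : (a • P + b • Q).1 - (a • y + b • z) = a • (P.1 - y) + b • (Q.1 - z) := by
    simp only [Prod.fst_add, Prod.smul_fst]
    module
  have e2 : (a • P + b • Q).2 = a * P.2 + b * Q.2 := rfl
  rw [e1, e2]
  simp only [smul_eq_mul] at h1
  rw [div_mul_eq_mul_div, div_mul_eq_mul_div, ← add_div]
  gcongr
  linarith

/-- **Prékopa's theorem** for the partition function. -/
theorem partitionFn_rpow_mul_le {P Q : E n × ℝ} (hP : P ∈ spaceTime n) (hQ : Q ∈ spaceTime n)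
    {a b ε : ℝ} (hε : 0 < ε) (ha : 0 < a) (hb : 0 < b) (hab : a + b = 1) :
    partitionFn J P.1 P.2 ε ^ a * partitionFn J Q.1 Q.2 ε ^ b ≤
      partitionFn J (a • P + b • Q).1 (a • P + b • Q).2 ε := by
  have hR : a • P + b • Q ∈ spaceTime n :=
    (convex_univ.prod (convex_Ioi 0)) hP hQ ha.le hb.le hab
  have hm : ∀ x t, Measurable fun y => ENNReal.ofReal (weight J x t ε y) := fun x t => by
    rw [funext (weight_eq J x t ε)]
    exact ((continuous_gauss x _).measurable.mul (hJ.measurable_prior ε)).ennreal_ofReal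
  have h := prekopaLeindler (hm P.1 P.2) (hm Q.1 Q.2) (hm (a • P + b • Q).1 (a • P + b • Q).2)
    ha hb hab (hJ.weight_rpow_mul_le hP hQ hε ha hb hab)
  have e : ∀ R ∈ spaceTime n, ∫⁻ y, ENNReal.ofReal (weight J R.1 R.2 ε y) =
      ENNReal.ofReal (partitionFn J R.1 R.2 ε) := fun R hR =>
    (ofReal_integral_eq_lintegral_ofReal (hJ.integrable_weight R.1 (mem_spaceTime.1 hR) hε)
      (ae_of_all _ (weight_nonneg J R.1 R.2 ε))).symm
  have hZP := hJ.partitionFn_pos P.1 (mem_spaceTime.1 hP) hε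
  have hZQ := hJ.partitionFn_pos Q.1 (mem_spaceTime.1 hQ) hε
  have hZR := hJ.partitionFn_pos (a • P + b • Q).1 (mem_spaceTime.1 hR) hε
  rw [e P hP, e Q hQ, e _ hR, ENNReal.ofReal_rpow_of_pos hZP, ENNReal.ofReal_rpow_of_pos hZQ,
    ← ENNReal.ofReal_mul (by positivity)] at h
  exact (ENNReal.ofReal_le_ofReal_iff hZR.le).1 h

/-- Subtracting `n * ε / 2 * log t` removes the `t`-dependence of the normalization; a constant
minus `ε * log Z` remains. -/
theorem convexOn_Seps_sub_log {ε : ℝ} (hε : 0 < ε) : ConvexOn ℝ (spaceTime n)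
    (fun p : E n × ℝ => Seps J ε p.1 p.2 - n * ε / 2 * Real.log p.2) := by
  have hconv : Convex ℝ (spaceTime n) := convex_univ.prod (convex_Ioi 0)
  have e : ∀ p ∈ spaceTime n, Seps J ε p.1 p.2 - n * ε / 2 * Real.log p.2 =
      n * ε / 2 * Real.log (2 * Real.pi * ε) - ε * Real.log (partitionFn J p.1 p.2 ε) := by
    intro p hp
    have hp2 := mem_spaceTime.1 hp
    rw [hJ.Seps_eq_sub_log p.1 hp2 hε, mul_right_comm (2 * Real.pi),
      Real.log_mul (by positivity) hp2.ne']
    ring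
  refine convexOn_iff_forall_pos.2 ⟨hconv, fun P hP Q hQ a b ha hb hab => ?_⟩
  have hR := hconv hP hQ ha.le hb.le hab
  have hZP := hJ.partitionFn_pos P.1 (mem_spaceTime.1 hP) hε
  have hZQ := hJ.partitionFn_pos Q.1 (mem_spaceTime.1 hQ) hε
  have h := Real.log_le_log (by positivity) (hJ.partitionFn_rpow_mul_le hP hQ hε ha hb hab)
  rw [Real.log_mul (by positivity) (by positivity), Real.log_rpow hZP, Real.log_rpow hZQ] at h
  simp only [smul_eq_mul]
  rw [e P hP, e Q hQ, e _ hR]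
  have h2 := mul_le_mul_of_nonneg_left h hε.le
  have h3 : n * ε / 2 * Real.log (2 * Real.pi * ε) =
    (a + b) * (n * ε / 2 * Real.log (2 * Real.pi * ε)) := by rw [hab, one_mul]
  linear_combination h2 + h3

theorem integral_pos_of_pos_off_hyperplane {h : E n → ℝ} (hi : Integrable h)
    (h0 : ∀ᵐ y, 0 ≤ h y) {v : E n} (hv : v ≠ 0) (c : ℝ)
    (hpos : ∀ y ∈ interior (effDom J), inner ℝ v y ≠ c → 0 < h y) : 0 < ∫ y, h y := by
  rw [integral_pos_iff_support_of_nonneg_ae h0 hi]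
  refine (exists_mem_inner_ne isOpen_interior hJ.interior_dom_nonempty hv c).trans_le
    (measure_mono ?_)
  rintro y ⟨hy, hc⟩
  exact (hpos y hy hc).ne'

theorem partitionFn_lt_partitionFn (hn : 1 ≤ n) (x : E n) {t t' ε ε' : ℝ} (ht : 0 < t)
    (ht' : 0 < t') (hε : 0 < ε) (hε' : 0 < ε')
    (hle : ∀ y ∈ effDom J, (‖x - y‖ ^ 2 / (2 * t') + realJ J y) / ε' ≤
      (‖x - y‖ ^ 2 / (2 * t) + realJ J y) / ε)
    (hlt : ∀ y ∈ effDom J, y ≠ x → (‖x - y‖ ^ 2 / (2 * t') + realJ J y) / ε' <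
      (‖x - y‖ ^ 2 / (2 * t) + realJ J y) / ε) :
    partitionFn J x t ε < partitionFn J x t' ε' := by
  have hi := hJ.integrable_weight x ht hε
  have hi' := hJ.integrable_weight x ht' hε'
  -- A coordinate direction exists because `1 ≤ n`. The hyperplane through `x` normal to it contains
  -- the only possible equality point, `y = x`.
  have hv : (EuclideanSpace.single (⟨0, hn⟩ : Fin n) (1 : ℝ)) ≠ 0 := by simp
  have := hJ.integral_pos_of_pos_off_hyperplane (hi'.sub hi) (ae_of_all _ fun y => ?_) hv
    (inner ℝ (EuclideanSpace.single (⟨0, hn⟩ : Fin n) (1 : ℝ)) x) fun y hy hne => ?_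
  · simp only [Pi.sub_apply] at this
    rw [integral_sub hi' hi] at this
    exact sub_pos.1 this
  · rw [Pi.sub_apply, sub_nonneg]
    by_cases hy : y ∈ effDom J
    · rw [weight_of_mem _ _ _ hy, weight_of_mem _ _ _ hy, Real.exp_le_exp, neg_div, neg_div]
      exact neg_le_neg (hle y hy)
    · rw [weight_of_notMem _ _ _ hy, weight_of_notMem _ _ _ hy]
  · have hyd := interior_subset hy
    rw [Pi.sub_apply, sub_pos, weight_of_mem _ _ _ hyd, weight_of_mem _ _ _ hyd, Real.exp_lt_exp,
      neg_div, neg_div]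
    exact neg_lt_neg (hlt y hyd fun h => hne (by rw [h]))

theorem strictAntiOn_time (hn : 1 ≤ n) {ε : ℝ} (hε : 0 < ε) (x : E n) :
    StrictAntiOn (fun t => Seps J ε x t - n * ε / 2 * Real.log t) (Ioi 0) := by
  intro t ht t' ht' htt'
  replace ht : 0 < t := ht
  replace ht' : 0 < t' := ht'
  have hZ := hJ.partitionFn_pos x ht hε
  have h : partitionFn J x t ε < partitionFn J x t' ε := by
    refine hJ.partitionFn_lt_partitionFn hn x ht ht' hε hε (fun y _ => ?_) fun y _ hy => ?_
    · gcongr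
    · have : 0 < ‖x - y‖ := norm_pos_iff.2 (sub_ne_zero.2 hy.symm)
      gcongr
  have h2 := mul_lt_mul_of_pos_left (Real.log_lt_log hZ h) hε
  simp only
  rw [hJ.Seps_eq_sub_log x ht hε, hJ.Seps_eq_sub_log x ht' hε, mul_right_comm (2 * Real.pi) t,
    mul_right_comm (2 * Real.pi) t', Real.log_mul (by positivity) ht.ne',
    Real.log_mul (by positivity) ht'.ne']
  linarith

theorem strictAntiOn_viscosity (hn : 1 ≤ n) (x : E n) {t : ℝ} (ht : 0 < t) :
    StrictAntiOn (fun ε => Seps J ε x t / ε - n / 2 * Real.log ε) (Ioi 0) := by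
  intro ε hε ε' hε' hlt
  replace hε : 0 < ε := hε
  replace hε' : 0 < ε' := hε'
  have hZ := hJ.partitionFn_pos x ht hε
  have h : partitionFn J x t ε < partitionFn J x t ε' := by
    refine hJ.partitionFn_lt_partitionFn hn x ht ht hε hε' (fun y _ => ?_) fun y _ hy => ?_
    · have := hJ.realJ_nonneg y
      gcongr
    · have : 0 < ‖x - y‖ := norm_pos_iff.2 (sub_ne_zero.2 hy.symm)
      have := hJ.realJ_nonneg y
      gcongr
  have h2 := Real.log_lt_log hZ h
  have e : ∀ ε, 0 < ε → Seps J ε x t / ε - n / 2 * Real.log ε =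
      n / 2 * Real.log (2 * Real.pi * t) - Real.log (partitionFn J x t ε) := by
    intro ε hε
    rw [hJ.Seps_eq_sub_log x ht hε, Real.log_mul (by positivity) hε.ne']
    field_simp
    ring
  simp only
  rw [e ε hε, e ε' hε']
  linarith

/-- Strict Hölder inequality. Up to an explicit Gaussian factor, the weight at `a • x₁ + b • x₂` is
the geometric mean of the weights at `x₁` and `x₂`. After normalization by `exp A` and `exp B`,
strict convexity of `exp` compares it with the arithmetic mean, whose integral is `1`. -/
theorem log_partitionFn_combo_lt {t ε : ℝ} (ht : 0 < t) (hε : 0 < ε) {x₁ x₂ : E n} (hne : x₁ ≠ x₂)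
    {a b : ℝ} (ha : 0 < a) (hb : 0 < b) (hab : a + b = 1) :
    Real.log (partitionFn J (a • x₁ + b • x₂) t ε) <
      a * b * ‖x₁ - x₂‖ ^ 2 / (2 * (t * ε)) + a * Real.log (partitionFn J x₁ t ε) +
        b * Real.log (partitionFn J x₂ t ε) := by
  have hs : 0 < t * ε := mul_pos ht hε
  have hZ₁ := hJ.partitionFn_pos x₁ ht hε
  have hZ₂ := hJ.partitionFn_pos x₂ ht hε
  have hZ := hJ.partitionFn_pos (a • x₁ + b • x₂) ht hε
  set A := Real.log (partitionFn J x₁ t ε)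
  set B := Real.log (partitionFn J x₂ t ε)
  set K := a * b * ‖x₁ - x₂‖ ^ 2 / (2 * (t * ε)) + a * A + b * B with hK
  set P : E n → ℝ := fun y => -(‖x₁ - y‖ ^ 2 / (2 * (t * ε))) - A with hP
  set Q : E n → ℝ := fun y => -(‖x₂ - y‖ ^ 2 / (2 * (t * ε))) - B with hQ
  have hP1 : ∀ y, (partitionFn J x₁ t ε)⁻¹ * weight J x₁ t ε y = prior J ε y * Real.exp (P y) := by
    intro y
    rw [weight_eq, gauss, hP, Real.exp_sub, Real.exp_log hZ₁]
    field_simp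
  have hQ1 : ∀ y, (partitionFn J x₂ t ε)⁻¹ * weight J x₂ t ε y = prior J ε y * Real.exp (Q y) := by
    intro y
    rw [weight_eq, gauss, hQ, Real.exp_sub, Real.exp_log hZ₂]
    field_simp
  have hPQ : ∀ y, Real.exp (-K) * weight J (a • x₁ + b • x₂) t ε y =
      prior J ε y * Real.exp (a * P y + b * Q y) := by
    intro y
    rw [weight_eq, gauss, ← mul_assoc, ← Real.exp_add, mul_comm]
    congr 2
    have h := norm_combo_sq (x₁ - y) (x₂ - y) hab
    have h1 : a • (x₁ - y) + b • (x₂ - y) = a • x₁ + b • x₂ - y := by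
      have : a • (x₁ - y) + b • (x₂ - y) = a • x₁ + b • x₂ - (a + b) • y := by module
      rw [this, hab, one_smul]
    rw [h1, sub_sub_sub_cancel_right] at h
    have h2 : ‖a • x₁ + b • x₂ - y‖ ^ 2 =
      a * ‖x₁ - y‖ ^ 2 + b * ‖x₂ - y‖ ^ 2 - a * b * ‖x₁ - x₂‖ ^ 2 := by linarith
    rw [h2, hK, hP, hQ]
    field_simp
    ring
  have hi₁ := (hJ.integrable_weight x₁ ht hε).const_mul (partitionFn J x₁ t ε)⁻¹
  have hi₂ := (hJ.integrable_weight x₂ ht hε).const_mul (partitionFn J x₂ t ε)⁻¹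
  have hi := (hJ.integrable_weight (a • x₁ + b • x₂) ht hε).const_mul (Real.exp (-K))
  have h12 : Integrable fun y => a * ((partitionFn J x₁ t ε)⁻¹ * weight J x₁ t ε y) +
      b * ((partitionFn J x₂ t ε)⁻¹ * weight J x₂ t ε y) := (hi₁.const_mul a).add (hi₂.const_mul b)
  have hint : ∀ x, ∫ y, weight J x t ε y = partitionFn J x t ε := fun x => rfl
  have key := hJ.integral_pos_of_pos_off_hyperplane
    (h := fun y => (a * ((partitionFn J x₁ t ε)⁻¹ * weight J x₁ t ε y) +
      b * ((partitionFn J x₂ t ε)⁻¹ * weight J x₂ t ε y)) -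
        Real.exp (-K) * weight J (a • x₁ + b • x₂) t ε y)
    (h12.sub hi) (ae_of_all _ fun y => ?_)
    (v := x₁ - x₂) (sub_ne_zero.2 hne)
    -- The equality `P y = Q y` means `⟪x₁ - x₂, y⟫` equals this constant, since the terms `‖y‖ ^ 2`
    -- cancel.
    ((‖x₁‖ ^ 2 - ‖x₂‖ ^ 2 + 2 * (t * ε) * (A - B)) / 2) fun y hy hc => ?_
  · rw [integral_sub h12 hi, integral_add (hi₁.const_mul a) (hi₂.const_mul b)] at key
    simp only [integral_const_mul, hint] at key
    rw [inv_mul_cancel₀ hZ₁.ne', inv_mul_cancel₀ hZ₂.ne', mul_one, mul_one, hab, sub_pos,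
      Real.exp_neg, inv_mul_lt_iff₀ (Real.exp_pos _), mul_one] at key
    exact (Real.log_lt_iff_lt_exp hZ).2 key
  · rw [hP1, hQ1, hPQ]
    have := convexOn_exp.2 (mem_univ (P y)) (mem_univ (Q y)) ha.le hb.le hab
    simp only [smul_eq_mul] at this
    have := mul_le_mul_of_nonneg_left this (prior_nonneg (J := J) ε y)
    linarith
  · simp only [hP1, hQ1, hPQ]
    have hne' : P y ≠ Q y := by
      intro h
      apply hc
      simp only [hP, hQ, norm_sub_sq_real] at h
      rw [inner_sub_left]
      field_simp at h
      linarith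
    have := strictConvexOn_exp.2 (mem_univ (P y)) (mem_univ (Q y)) hne' ha hb hab
    simp only [smul_eq_mul] at this
    have hp : 0 < prior J ε y := by
      rw [prior_of_mem (interior_subset hy)]; positivity
    have := mul_lt_mul_of_pos_left this hp
    linarith

theorem strictConvexOn_half_norm_sq_sub {t ε : ℝ} (ht : 0 < t) (hε : 0 < ε) :
    StrictConvexOn ℝ univ (fun x => 1 / 2 * ‖x‖ ^ 2 - t * Seps J ε x t) := by
  refine ⟨convex_univ, fun x₁ _ x₂ _ hne a b ha hb hab => ?_⟩
  have h := hJ.log_partitionFn_combo_lt ht hε hne ha hb hab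
  have h1 := norm_combo_sq x₁ x₂ hab
  have hs : 0 < t * ε := mul_pos ht hε
  simp only [smul_eq_mul]
  rw [hJ.Seps_eq_sub_log _ ht hε, hJ.Seps_eq_sub_log _ ht hε, hJ.Seps_eq_sub_log _ ht hε]
  have h2 := mul_lt_mul_of_pos_left h hs
  have h3 : t * ε * (a * b * ‖x₁ - x₂‖ ^ 2 / (2 * (t * ε)) + a * Real.log (partitionFn J x₁ t ε) +
      b * Real.log (partitionFn J x₂ t ε)) = a * b * ‖x₁ - x₂‖ ^ 2 / 2 + t * ε *
      (a * Real.log (partitionFn J x₁ t ε) + b * Real.log (partitionFn J x₂ t ε)) := by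
    field_simp
    ring
  rw [h3] at h2
  set c := t * (n * ε / 2 * Real.log (2 * Real.pi * t * ε)) with hc
  have h4 : c = a * c + b * c := by rw [← add_mul, hab, one_mul]
  linear_combination h2 + h1 / 2 - h4

/-! ### Posterior mean -/

theorem integrable_weight_smul_of_le {W : Type} [NormedAddCommGroup W] [NormedSpace ℝ W]
    {F : E n → W} (hF : Continuous F) {C : ℝ} (hC : ∀ y, ‖F y‖ ≤ C * (1 + ‖y‖ ^ 2)) (x : E n)
    {t ε : ℝ} (ht : 0 < t) (hε : 0 < ε) : Integrable fun y => weight J x t ε y • F y := by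
  have h : Integrable fun y => gauss x (t * ε) y • (prior J ε y • F y) := by
    refine integrable_gauss_smul (C := C)
      ((hJ.measurable_prior ε).aestronglyMeasurable.smul hF.aestronglyMeasurable)
      (fun y => ?_) x (mul_pos ht hε)
    rw [Pi.smul_apply', norm_smul, Real.norm_eq_abs]
    exact (mul_le_of_le_one_left (norm_nonneg _) (hJ.abs_prior_le_one hε y)).trans (hC y)
  simpa only [weight_eq, mul_smul] using h

theorem integrable_weight_smul_id (x : E n) {t ε : ℝ} (ht : 0 < t) (hε : 0 < ε) :
    Integrable fun y => weight J x t ε y • y := by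
  refine hJ.integrable_weight_smul_of_le (F := fun y => y) (C := 1) continuous_id (fun y => ?_) x ht
    hε
  nlinarith [sq_nonneg (‖y‖ - 1), norm_nonneg y]

theorem integrable_weight_smul_norm_sub_sq (x u : E n) {t ε : ℝ} (ht : 0 < t) (hε : 0 < ε) :
    Integrable fun y => weight J x t ε y • ‖y - u‖ ^ 2 := by
  refine hJ.integrable_weight_smul_of_le (F := fun y => ‖y - u‖ ^ 2) (C := 2 * (1 + ‖u‖ ^ 2))
    (by fun_prop) (fun y => ?_) x ht hε
  rw [Real.norm_of_nonneg (by positivity)]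
  have h1 : ‖y - u‖ ^ 2 ≤ (‖y‖ + ‖u‖) ^ 2 := by gcongr; exact norm_sub_le y u
  nlinarith [sq_nonneg (‖y‖ - ‖u‖), mul_nonneg (sq_nonneg ‖y‖) (sq_nonneg ‖u‖)]

omit hJ in
theorem _root_.ViscousHJ.smul_uPM {x : E n} {t ε : ℝ} (hZ : partitionFn J x t ε ≠ 0) :
    partitionFn J x t ε • uPM J x t ε = ∫ y, weight J x t ε y • y := by
  rw [uPM, expect, smul_smul, mul_inv_cancel₀ hZ, one_smul]

/-- Differentiating the kernel brings down `(y - x) / (t * ε)`, so the gradient of `log Z` is `(u_PM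
- x) / (t * ε)`. -/
theorem hasGradientAt_Seps (x : E n) {t ε : ℝ} (ht : 0 < t) (hε : 0 < ε) :
    HasGradientAt (fun z => Seps J ε z t) (t⁻¹ • (x - uPM J x t ε)) x := by
  have hs : 0 < t * ε := mul_pos ht hε
  have hZ := hJ.partitionFn_pos x ht hε
  obtain ⟨L, hL, hLi⟩ := hasFDerivAt_gaussInt (hJ.measurable_prior ε).aestronglyMeasurable
    (hJ.abs_prior_le_one hε) x hs
  simp_rw [← partitionFn_eq] at hL hLi
  rw [hasGradientAt_iff_hasFDerivAt]
  have h1 := ((hL.log hZ.ne').const_mul ε).const_sub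
    (n * ε / 2 * Real.log (2 * Real.pi * t * ε))
  have e : (fun z => Seps J ε z t) = fun z => n * ε / 2 * Real.log (2 * Real.pi * t * ε) -
      ε * Real.log (partitionFn J z t ε) := funext fun z => hJ.Seps_eq_sub_log z ht hε
  rw [e]
  refine h1.congr_fderiv ?_
  ext v
  have hm : ∫ y, gauss x (t * ε) y * (inner ℝ y v * prior J ε y) =
      partitionFn J x t ε * inner ℝ (uPM J x t ε) v := by
    rw [← real_inner_smul_left, smul_uPM hZ.ne', real_inner_comm,
      ← integral_inner (hJ.integrable_weight_smul_id x ht hε)]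
    refine integral_congr_ae (ae_of_all _ fun y => ?_)
    simp only [weight_eq, inner_smul_right, real_inner_comm]
    ring
  simp only [neg_apply, smul_apply, smul_eq_mul, hLi, hm, InnerProductSpace.toDual_apply_apply,
    real_inner_smul_left, inner_sub_left]
  field_simp
  ring

theorem gradX_Seps (x : E n) {t ε : ℝ} (ht : 0 < t) (hε : 0 < ε) :
    gradX (Seps J ε) x t = t⁻¹ • (x - uPM J x t ε) :=
  (hJ.hasGradientAt_Seps x ht hε).gradient

theorem uPM_eq (x : E n) {t ε : ℝ} (ht : 0 < t) (hε : 0 < ε) :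
    uPM J x t ε = x - t • gradX (Seps J ε) x t := by
  rw [hJ.gradX_Seps x ht hε, smul_smul, mul_inv_cancel₀ ht.ne', one_smul, sub_sub_cancel]

theorem contDiff_Seps {t ε : ℝ} (ht : 0 < t) (hε : 0 < ε) :
    ContDiff ℝ 2 fun z => Seps J ε z t :=
  (contDiff_slice_of_contDiffOn_spaceTime (hJ.contDiffOn_Seps hε) ht).of_le two_le_infty

theorem uPM_eq_fun {t ε : ℝ} (ht : 0 < t) (hε : 0 < ε) :
    (fun z => uPM J z t ε) = fun z => z - t • gradient (fun z => Seps J ε z t) z :=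
  funext fun z => hJ.uPM_eq z ht hε

theorem differentiable_uPM {t ε : ℝ} (ht : 0 < t) (hε : 0 < ε) :
    Differentiable ℝ fun x => uPM J x t ε := by
  rw [hJ.uPM_eq_fun ht hε]
  exact fun x => (hasFDerivAt_sub_smul_gradient
    (hJ.contDiff_Seps ht hε).contDiffAt t).differentiableAt

theorem divergence_uPM (x : E n) {t ε : ℝ} (ht : 0 < t) (hε : 0 < ε) :
    divergence (fun z => uPM J z t ε) x = n - t * lapX (Seps J ε) x t := by
  rw [hJ.uPM_eq_fun ht hε, divergence_sub_smul_gradient (hJ.contDiff_Seps ht hε).contDiffAt t]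
  rfl

/-- Expanding about `x`, the error is `M / Z - ‖x - u‖ ^ 2`. The second moment `M` is found by
computing the Laplacian of `exp (-S_ε / ε)` twice: by the chain rule and from the Gaussian integral.
-/
theorem mse_eq (x : E n) {t ε : ℝ} (ht : 0 < t) (hε : 0 < ε) :
    mse J x t ε = n * t * ε - t ^ 2 * ε * lapX (Seps J ε) x t := by
  have hs : 0 < t * ε := mul_pos ht hε
  have hZ := hJ.partitionFn_pos x ht hε
  set u := uPM J x t ε with hu
  set Z := partitionFn J x t ε with hZdef
  set M := ∫ y, weight J x t ε y * ‖x - y‖ ^ 2 with hM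
  have hfm := (hJ.measurable_prior ε).aestronglyMeasurable (μ := volume)
  have hfb := hJ.abs_prior_le_one hε
  have hi0 := hJ.integrable_weight x ht hε
  have hi1 := hJ.integrable_weight_smul_id x ht hε
  have hi2 : Integrable fun y => weight J x t ε y * ‖x - y‖ ^ 2 := by
    have := hJ.integrable_weight_smul_norm_sub_sq x x ht hε
    simpa only [norm_sub_rev x, smul_eq_mul] using this
  have hmse : mse J x t ε = M / Z - ‖x - u‖ ^ 2 := by
    have e : ∀ y, weight J x t ε y • ‖y - u‖ ^ 2 = weight J x t ε y * ‖x - y‖ ^ 2 +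
        (2 * inner ℝ (x - u) (weight J x t ε y • y) - weight J x t ε y *
          (2 * inner ℝ (x - u) x - ‖x - u‖ ^ 2)) := by
      intro y
      have h1 : y - u = (x - u) - (x - y) := by abel
      rw [h1, norm_sub_sq_real, inner_smul_right, inner_sub_right (x - u) x y, smul_eq_mul]
      ring
    have hI : ∫ y, weight J x t ε y • ‖y - u‖ ^ 2 = M + (2 * inner ℝ (x - u) (Z • u) -
        Z * (2 * inner ℝ (x - u) x - ‖x - u‖ ^ 2)) := by
      have hin := hi1.const_inner (𝕜 := ℝ) (x - u)
      have hsub : Integrable fun y => 2 * inner ℝ (x - u) (weight J x t ε y • y) -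
          weight J x t ε y * (2 * inner ℝ (x - u) x - ‖x - u‖ ^ 2) :=
        (hin.const_mul 2).sub (hi0.mul_const _)
      rw [integral_congr_ae (ae_of_all _ e), integral_add hi2 hsub, integral_sub (hin.const_mul 2) (hi0.mul_const _), integral_const_mul,
        integral_mul_const, integral_inner hi1, ← smul_uPM hZ.ne']
      rfl
    rw [mse, expect, ← hu, ← hZdef, hI, inner_smul_right, smul_eq_mul]
    have h2 : inner ℝ (x - u) x = ‖x - u‖ ^ 2 + inner ℝ (x - u) u := by
      rw [← real_inner_self_eq_norm_sq, ← inner_add_right, sub_add_cancel]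
    rw [h2]
    field_simp
    ring
  have hlap := laplacian_exp_neg_div (hJ.contDiff_Seps ht hε) hε.ne' x
  have hgrad : gradient (fun z => Seps J ε z t) x = t⁻¹ • (x - u) := hJ.gradX_Seps x ht hε
  have hc : 0 < 1 / (2 * Real.pi * (t * ε)) ^ ((n : ℝ) / 2) := by positivity
  set c := 1 / (2 * Real.pi * (t * ε)) ^ ((n : ℝ) / 2) with hcdef
  have e : ∀ z, Real.exp (-Seps J ε z t / ε) = c * gaussInt (prior J ε) z (t * ε) := fun z =>
    hJ.exp_neg_Seps_div z ht hε
  have hL : Laplacian.laplacian (fun z => Real.exp (-Seps J ε z t / ε)) x =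
      c * (M / (t * ε) ^ 2 - n * Z / (t * ε)) := by
    have h1 := InnerProductSpace.laplacian_smul (𝕜 := ℝ) (x := x) c
      ((contDiff_gaussInt hfm hfb hs).contDiffAt.of_le two_le_infty)
    rw [laplacian_gaussInt hfm hfb x hs, ← partitionFn_eq] at h1
    have h2 : ∫ y, gauss x (t * ε) y * (‖x - y‖ ^ 2 * prior J ε y) = M := by
      refine integral_congr_ae (ae_of_all _ fun y => ?_)
      simp only [weight_eq]
      ring
    rw [h2] at h1
    rw [funext e]
    exact h1
  rw [hL, e x, ← partitionFn_eq, ← hZdef, hgrad, norm_smul, Real.norm_of_nonneg (by positivity),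
    mul_assoc, mul_right_inj' hc.ne'] at hlap
  rw [hmse, lapX]
  have h3 : M / Z = (t * ε) ^ 2 * (‖x - u‖ ^ 2 * t⁻¹ ^ 2 / ε ^ 2 -
      Laplacian.laplacian (fun z => Seps J ε z t) x / ε + n / (t * ε)) := by
    rw [div_eq_iff hZ.ne']
    field_simp at hlap ⊢
    linear_combination hlap
  rw [h3]
  field_simp
  ring

end IsRegularizer

end ViscousHJ

/-! ### The posterior mean is a bijection onto the interior of the domain. -/

namespace ViscousHJ

variable {n : ℕ} {J : E n → EReal}

namespace IsRegularizer

variable (hJ : IsRegularizer J)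
include hJ

/-- Otherwise a linear functional `f` strictly separates the mean `u` from the interior. Then `f u -
f y` is positive for almost every `y` in the domain, although its posterior mean is zero. -/
theorem uPM_mem_interior (x : E n) {t ε : ℝ} (ht : 0 < t) (hε : 0 < ε) :
    uPM J x t ε ∈ interior (effDom J) := by
  by_contra hz
  have hZ := hJ.partitionFn_pos x ht hε
  obtain ⟨f, hf⟩ := geometric_hahn_banach_open_point hJ.gammaZero.dom_convex.interior
    isOpen_interior hz
  set u := uPM J x t ε with hu
  have hi0 := hJ.integrable_weight x ht hε
  have hi1 := hJ.integrable_weight_smul_id x ht hε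
  have hi : Integrable fun y => weight J x t ε y * f u - f (weight J x t ε y • y) :=
    (hi0.mul_const _).sub (f.integrable_comp hi1)
  have hint : ∫ y, (weight J x t ε y * f u - f (weight J x t ε y • y)) = 0 := by
    rw [integral_sub (hi0.mul_const _) (f.integrable_comp hi1), integral_mul_const,
      f.integral_comp_comm hi1, ← smul_uPM hZ.ne', map_smul, smul_eq_mul]
    exact sub_self _
  have hpos : 0 < ∫ y, (weight J x t ε y * f u - f (weight J x t ε y • y)) := by
    rw [integral_pos_iff_support_of_nonneg_ae _ hi]
    · refine (isOpen_interior.measure_pos volume hJ.interior_dom_nonempty).trans_le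
        (measure_mono fun y hy => ?_)
      rw [Function.mem_support, map_smul, smul_eq_mul, ← mul_sub]
      exact (mul_pos (weight_pos x t ε (interior_subset hy)) (sub_pos.2 (hf y hy))).ne'
    · filter_upwards [hJ.ae_notMem_boundary] with y hy
      rw [Pi.zero_apply, map_smul, smul_eq_mul, ← mul_sub]
      by_cases hyd : y ∈ effDom J
      · have hyi : y ∈ interior (effDom J) := by
          by_contra h
          exact hy ⟨hyd, h⟩
        exact mul_nonneg (weight_nonneg _ _ _ _ _) (sub_nonneg.2 (hf y hyi).le)
      · rw [weight_of_notMem _ _ _ hyd, zero_mul]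
  exact hpos.ne' hint

/-- The posterior mean is the gradient of a strictly convex potential; injectivity and surjectivity
both start from this. -/
theorem hasFDerivAt_half_norm_sq_sub (x : E n) {t ε : ℝ} (ht : 0 < t) (hε : 0 < ε) :
    HasFDerivAt (fun x => 1 / 2 * ‖x‖ ^ 2 - t * Seps J ε x t) (innerSL ℝ (uPM J x t ε)) x := by
  have h1 := (hasStrictFDerivAt_norm_sq x).hasFDerivAt.const_mul (1 / 2)
  have h2 := (hasGradientAt_iff_hasFDerivAt.1 (hJ.hasGradientAt_Seps x ht hε)).const_mul t
  refine (h1.sub h2).congr_fderiv ?_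
  ext v
  simp
  field_simp
  ring

theorem injective_uPM {t ε : ℝ} (ht : 0 < t) (hε : 0 < ε) :
    Function.Injective fun x => uPM J x t ε := by
  intro x₁ x₂ h
  by_contra hne
  have hsc := hJ.strictConvexOn_half_norm_sq_sub ht hε
  have h12 := hsc.2 (mem_univ x₁) (mem_univ x₂) hne (by norm_num : (0 : ℝ) < 1 / 2)
    (by norm_num : (0 : ℝ) < 1 / 2) (by norm_num)
  set m := (1 / 2 : ℝ) • x₁ + (1 / 2 : ℝ) • x₂ with hm
  have h1 := ConvexOn.add_fderiv_le hsc.convexOn (hJ.hasFDerivAt_half_norm_sq_sub x₁ ht hε)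
    (mem_univ _) (mem_univ m)
  have h2 := ConvexOn.add_fderiv_le hsc.convexOn (hJ.hasFDerivAt_half_norm_sq_sub x₂ ht hε)
    (mem_univ _) (mem_univ m)
  replace h : uPM J x₁ t ε = uPM J x₂ t ε := h
  rw [h] at h1
  have e1 : m - x₁ = (1 / 2 : ℝ) • (x₂ - x₁) := by rw [hm]; module
  have e2 : m - x₂ = -((1 / 2 : ℝ) • (x₂ - x₁)) := by rw [hm]; module
  rw [e1] at h1
  rw [e2, map_neg] at h2
  simp only [smul_eq_mul] at h12
  linarith

/-- The exponentially tilted partition function grows exponentially. -/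
theorem exists_mul_exp_le {z : E n} (hz : z ∈ interior (effDom J)) {t ε : ℝ} (ht : 0 < t)
    (hε : 0 < ε) : ∃ r > 0, ∃ c > 0, ∀ x, c * Real.exp (r * ‖x‖) ≤
      Real.exp ((1 / 2 * ‖x‖ ^ 2 - inner ℝ z x) / (t * ε)) * partitionFn J x t ε := by
  have hs : 0 < t * ε := mul_pos ht hε
  obtain ⟨R, hR, hball⟩ := Metric.nhds_basis_closedBall.mem_iff.1 (isOpen_interior.mem_nhds hz)
  set r := R / 2 with hr
  have hr0 : 0 < r := by positivity
  have hcont : ContinuousOn (fun y => Real.exp (-(‖y‖ ^ 2 / (2 * (t * ε)))) * prior J ε y)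
      (Metric.closedBall z R) := by
    refine ContinuousOn.mul (by fun_prop) fun y hy => ?_
    exact (hJ.continuousAt_prior (hball hy)).continuousWithinAt
  obtain ⟨y₀, hy₀, hmin⟩ := (isCompact_closedBall z R).exists_isMinOn
    ⟨z, Metric.mem_closedBall_self hR.le⟩ hcont
  set c₀ := Real.exp (-(‖y₀‖ ^ 2 / (2 * (t * ε)))) * prior J ε y₀ with hc₀
  have hc₀pos : 0 < c₀ := by
    rw [hc₀, prior_of_mem (interior_subset (hball hy₀))]
    positivity
  set V := (volume (Metric.ball (0 : E n) (r / 2))).toReal with hV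
  have hVpos : 0 < V := ENNReal.toReal_pos
    (Metric.measure_ball_pos volume _ (by positivity)).ne' measure_ball_lt_top.ne
  refine ⟨r / (2 * (t * ε)), by positivity, c₀ * V, by positivity, fun x => ?_⟩
  -- For `x = 0` the convention `0⁻¹ = 0` gives `e = 0`, and the estimates below still hold.
  set e : E n := ‖x‖⁻¹ • x with he
  have hen : ‖e‖ ≤ 1 := by
    rw [he, norm_smul, norm_inv, norm_norm]
    exact inv_mul_le_one_of_le₀ le_rfl (norm_nonneg x)
  have hxe : inner ℝ x e = ‖x‖ := by
    rw [he, inner_smul_right, real_inner_self_eq_norm_sq]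
    rcases eq_or_ne ‖x‖ 0 with h | h
    · simp [h]
    · field_simp
  -- This ball is shifted in the direction of `x` but stays within `R = 2 * r` of `z`; on it `⟪x, y
  -- - z⟫ ≥ r / 2 * ‖x‖`.
  set B := Metric.ball (z + r • e) (r / 2) with hB
  have hlow : ∀ y ∈ B, c₀ * Real.exp (r / (2 * (t * ε)) * ‖x‖) ≤
      Real.exp ((1 / 2 * ‖x‖ ^ 2 - inner ℝ z x) / (t * ε)) * weight J x t ε y := by
    intro y hy
    have hd : ‖y - (z + r • e)‖ < r / 2 := by rwa [hB, mem_ball_iff_norm] at hy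
    have hyR : y ∈ Metric.closedBall z R := by
      rw [mem_closedBall_iff_norm]
      have : y - z = (y - (z + r • e)) + r • e := by abel
      rw [this]
      refine (norm_add_le _ _).trans ?_
      have : ‖r • e‖ ≤ r := by
        rw [norm_smul, Real.norm_of_nonneg hr0.le]
        exact mul_le_of_le_one_right hr0.le hen
      linarith
    have hin : r / 2 * ‖x‖ ≤ inner ℝ x (y - z) := by
      have h1 : y - z = r • e + (y - (z + r • e)) := by abel
      rw [h1, inner_add_right, inner_smul_right, hxe]
      have h2 := (abs_le.1 (abs_real_inner_le_norm x (y - (z + r • e)))).1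
      have h3 : ‖x‖ * ‖y - (z + r • e)‖ ≤ ‖x‖ * (r / 2) := by gcongr
      linarith
    -- Once the squares cancel, `x` enters the tilted weight only through `⟪x, y - z⟫`.
    have hk : Real.exp ((1 / 2 * ‖x‖ ^ 2 - inner ℝ z x) / (t * ε)) * weight J x t ε y =
        (Real.exp (-(‖y‖ ^ 2 / (2 * (t * ε)))) * prior J ε y) *
          Real.exp (inner ℝ x (y - z) / (t * ε)) := by
      rw [weight_eq, gauss, ← mul_assoc, ← Real.exp_add, mul_right_comm, ← Real.exp_add]
      congr 2
      rw [norm_sub_sq_real, inner_sub_right, real_inner_comm x z]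
      field_simp
      ring
    rw [hk]
    have h1 : c₀ ≤ Real.exp (-(‖y‖ ^ 2 / (2 * (t * ε)))) * prior J ε y := hmin hyR
    have h2 : Real.exp (r / (2 * (t * ε)) * ‖x‖) ≤ Real.exp (inner ℝ x (y - z) / (t * ε)) := by
      refine Real.exp_le_exp.2 ?_
      rw [le_div_iff₀ hs]
      refine le_trans (le_of_eq ?_) hin
      field_simp
    exact mul_le_mul h1 h2 (Real.exp_pos _).le (hc₀pos.le.trans h1)
  have hvolB : (volume B).toReal = V := by
    rw [hV, hB, Measure.addHaar_ball_center]
  have hi := (hJ.integrable_weight x ht hε).const_mul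
    (Real.exp ((1 / 2 * ‖x‖ ^ 2 - inner ℝ z x) / (t * ε)))
  calc c₀ * V * Real.exp (r / (2 * (t * ε)) * ‖x‖)
      = ∫ _ in B, c₀ * Real.exp (r / (2 * (t * ε)) * ‖x‖) := by
        rw [setIntegral_const, smul_eq_mul, Measure.real, hvolB]
        ring
    _ ≤ ∫ y in B, Real.exp ((1 / 2 * ‖x‖ ^ 2 - inner ℝ z x) / (t * ε)) * weight J x t ε y :=
        setIntegral_mono_on (integrableOn_const (hs := measure_ball_lt_top.ne))
          hi.integrableOn Metric.isOpen_ball.measurableSet hlow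
    _ ≤ ∫ y, Real.exp ((1 / 2 * ‖x‖ ^ 2 - inner ℝ z x) / (t * ε)) * weight J x t ε y :=
        setIntegral_le_integral hi (ae_of_all _ fun y =>
          mul_nonneg (Real.exp_pos _).le (weight_nonneg _ _ _ _ _))
    _ = _ := integral_const_mul _ _

/-- The potential minus `⟪z, x⟫` grows at least linearly by `exists_mul_exp_le`, so it has a
minimizer; its gradient there, `u_PM - z`, vanishes. -/
theorem exists_uPM_eq {z : E n} (hz : z ∈ interior (effDom J)) {t ε : ℝ} (ht : 0 < t)
    (hε : 0 < ε) : ∃ x, uPM J x t ε = z := by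
  have hs : 0 < t * ε := mul_pos ht hε
  obtain ⟨r, hr, c, hc, hle⟩ := hJ.exists_mul_exp_le hz ht hε
  set φ : E n → ℝ := fun x => 1 / 2 * ‖x‖ ^ 2 - t * Seps J ε x t - inner ℝ z x with hφ
  have hd : ∀ x, HasFDerivAt φ (innerSL ℝ (uPM J x t ε) - innerSL ℝ z) x := fun x =>
    (hJ.hasFDerivAt_half_norm_sq_sub x ht hε).sub (innerSL ℝ z).hasFDerivAt
  have hlow : ∀ x, t * ε * r * ‖x‖ + (t * ε * Real.log c -
      t * (n * ε / 2 * Real.log (2 * Real.pi * t * ε))) ≤ φ x := by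
    intro x
    have hZ := hJ.partitionFn_pos x ht hε
    have h1 := Real.log_le_log (by positivity) (hle x)
    rw [Real.log_mul hc.ne' (Real.exp_pos _).ne', Real.log_mul (Real.exp_pos _).ne' hZ.ne',
      Real.log_exp, Real.log_exp] at h1
    have h2 := mul_le_mul_of_nonneg_left h1 hs.le
    rw [mul_add (t * ε) (_ / _), mul_div_cancel₀ _ hs.ne'] at h2
    simp only [hφ]
    rw [hJ.Seps_eq_sub_log x ht hε]
    linarith
  have htend : Tendsto φ (cocompact (E n)) atTop := by
    refine tendsto_atTop_mono hlow ?_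
    exact tendsto_atTop_add_const_right _ _
      ((tendsto_norm_cocompact_atTop (E := E n)).const_mul_atTop (by positivity))
  have hcont : Continuous φ := continuous_iff_continuousAt.2 fun x => (hd x).continuousAt
  obtain ⟨x, hx⟩ := hcont.exists_forall_le htend
  have hmin : IsLocalMin φ x := Eventually.of_forall hx
  have h0 := hmin.hasFDerivAt_eq_zero (hd x)
  refine ⟨x, ?_⟩
  rw [← map_sub] at h0
  have h1 : ‖uPM J x t ε - z‖ = 0 := by
    rw [← innerSL_apply_norm (𝕜 := ℝ), h0, norm_zero]
  exact sub_eq_zero.1 (norm_eq_zero.1 h1)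

theorem bijOn_uPM {t ε : ℝ} (ht : 0 < t) (hε : 0 < ε) :
    BijOn (fun x => uPM J x t ε) univ (interior (effDom J)) := by
  refine ⟨fun x _ => hJ.uPM_mem_interior x ht hε, (hJ.injective_uPM ht hε).injOn, fun z hz => ?_⟩
  obtain ⟨x, hx⟩ := hJ.exists_uPM_eq hz ht hε
  exact ⟨x, mem_univ _, hx⟩

end IsRegularizer

end ViscousHJ

/-! ### The limit of vanishing viscosity. -/

namespace ViscousHJ

section ConvexDerivatives

/-- Locally uniform convergence of convex functions to a continuously differentiable function
implies locally uniform convergence of the derivatives. -/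
theorem tendstoUniformlyOn_fderiv_of_convexOn {V : Type*} [NormedAddCommGroup V] [NormedSpace ℝ V]
    [FiniteDimensional ℝ V] {ι : Type*} {l : Filter ι} {U : Set V} (hU : IsOpen U)
    {F : ι → V → ℝ} {F' : ι → V → V →L[ℝ] ℝ} {f : V → ℝ} {f' : V → V →L[ℝ] ℝ}
    (hF : ∀ᶠ i in l, ConvexOn ℝ U (F i) ∧ ∀ p ∈ U, HasFDerivAt (F i) (F' i p) p)
    (hf : ConvexOn ℝ U f) (hf' : ∀ p ∈ U, HasFDerivAt f (f' p) p) (hc : ContinuousOn f' U)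
    (hlim : ∀ K ⊆ U, IsCompact K → TendstoUniformlyOn F f l K)
    {K : Set V} (hKU : K ⊆ U) (hK : IsCompact K) : TendstoUniformlyOn F' f' l K := by
  have := FiniteDimensional.proper ℝ V
  obtain ⟨δ, hδ, hδU⟩ := hK.exists_cthickening_subset_open hU hKU
  have hK' : IsCompact (Metric.cthickening δ K) := hK.cthickening
  have huc := hK'.uniformContinuousOn_of_continuous (hc.mono hδU)
  rw [Metric.uniformContinuousOn_iff] at huc
  rw [Metric.tendstoUniformlyOn_iff]
  intro η hη
  obtain ⟨r₀, hr₀, huc⟩ := huc (η / 4) (by positivity)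
  set r := min (r₀ / 2) δ with hr
  have hr0 : 0 < r := lt_min (by positivity) hδ
  have hσ : 0 < η * r / 16 := by positivity
  filter_upwards [hF, Metric.tendstoUniformlyOn_iff.1 (hlim _ hδU hK') _ hσ] with i hi hclose p hp
  have hpK' : p ∈ Metric.cthickening δ K := Metric.self_subset_cthickening K hp
  have hpU := hKU hp
  -- Gradient inequalities for `F i` at `p` and for `f` at `p + v` give `F' v ≤ f' (p + v) v + 2 σ`
  -- with `σ = η * r / 16`; uniform continuity of `f'` replaces `p + v` by `p`. Testing `v` and `-v`
  -- then bounds the operator norm.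
  have key : ∀ v : V, ‖v‖ = r → (F' i p - f' p) v ≤ η / 2 * r := by
    intro v hv
    have hqK' : p + v ∈ Metric.cthickening δ K := by
      refine Metric.mem_cthickening_of_dist_le (p + v) p δ K hp ?_
      rw [dist_eq_norm, add_sub_cancel_left, hv]
      exact min_le_right _ _
    have hqU := hδU hqK'
    have h1 := ConvexOn.add_fderiv_le hi.1 (hi.2 p hpU) hpU hqU
    have h2 := ConvexOn.add_fderiv_le hf (hf' _ hqU) hqU hpU
    rw [add_sub_cancel_left] at h1
    rw [sub_add_cancel_left, map_neg] at h2
    have h3 := abs_lt.1 (hclose p hpK')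
    have h4 := abs_lt.1 (hclose (p + v) hqK')
    have h5 : dist (f' (p + v)) (f' p) < η / 4 := by
      refine huc _ hqK' _ hpK' ?_
      rw [dist_eq_norm, add_sub_cancel_left, hv]
      exact (min_le_left _ _).trans_lt (by linarith)
    have h6 : (f' (p + v) - f' p) v ≤ η / 4 * r := by
      refine (le_abs_self _).trans (((f' (p + v) - f' p).le_opNorm v).trans ?_)
      rw [hv, ← dist_eq_norm]
      gcongr
    rw [sub_apply] at h6 ⊢
    linarith
  have hle : ‖F' i p - f' p‖ ≤ η / 2 := by
    refine ContinuousLinearMap.opNorm_le_of_unit_norm (by positivity) fun v hv => ?_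
    have hn : ∀ c : ℝ, |c| = 1 → ‖(c * r) • v‖ = r := by
      intro c hc
      rw [norm_smul, hv, norm_mul, Real.norm_eq_abs, hc, Real.norm_of_nonneg hr0.le]
      ring
    have h1 := key _ (hn 1 (by simp))
    have h2 := key _ (hn (-1) (by simp))
    rw [map_smul, smul_eq_mul] at h1 h2
    rw [Real.norm_eq_abs, abs_le]
    constructor <;> nlinarith
  rw [dist_comm, dist_eq_norm]
  linarith

end ConvexDerivatives

variable {n : ℕ} {J : E n → EReal}

theorem convergesLocUnif_of_compact {β : Type*} [PseudoMetricSpace β]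
    {F : ℝ → E n → ℝ → β} {f : E n → ℝ → β}
    (h : ∀ K : Set (E n × ℝ), K ⊆ spaceTime n → IsCompact K → ∀ η > 0,
      ∀ᶠ ε in 𝓝[>] (0 : ℝ), ∀ p ∈ K, dist (f p.1 p.2) (F ε p.1 p.2) < η) :
    ConvergesLocUnif F f := by
  have h2 : ∀ K : Set (E n × ℝ), K ⊆ spaceTime n → IsCompact K →
      TendstoUniformlyOn (fun ε (p : E n × ℝ) => F ε p.1 p.2) (fun p => f p.1 p.2) (𝓝[>] 0) K :=
    fun K hK hKc => Metric.tendstoUniformlyOn_iff.2 (h K hK hKc)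
  refine ⟨fun x t ht => ?_, h2⟩
  have h3 := h2 {(x, t)} (singleton_subset_iff.2 (mem_spaceTime.2 ht)) isCompact_singleton
  exact h3.tendsto_at (mem_singleton (x, t))

/-- The space-time differential in terms of the gradient and the time derivative. -/
def spaceTimeDeriv (g : E n) (d : ℝ) : E n × ℝ →L[ℝ] ℝ :=
  (innerSL ℝ g).comp (ContinuousLinearMap.fst ℝ (E n) ℝ) + d • ContinuousLinearMap.snd ℝ (E n) ℝ

theorem spaceTimeDeriv_apply (g : E n) (d : ℝ) (v : E n × ℝ) :
    spaceTimeDeriv g d v = inner ℝ g v.1 + d * v.2 := by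
  simp [spaceTimeDeriv]

theorem spaceTimeDeriv_sub (g g' : E n) (d d' : ℝ) :
    spaceTimeDeriv g d - spaceTimeDeriv g' d' = spaceTimeDeriv (g - g') (d - d') := by
  refine ContinuousLinearMap.ext fun v => ?_
  rw [sub_apply, spaceTimeDeriv_apply, spaceTimeDeriv_apply, spaceTimeDeriv_apply, inner_sub_left]
  ring

theorem norm_le_norm_spaceTimeDeriv (g : E n) (d : ℝ) : ‖g‖ ≤ ‖spaceTimeDeriv g d‖ := by
  rw [← innerSL_apply_norm (𝕜 := ℝ) g]
  refine ContinuousLinearMap.opNorm_le_bound _ (norm_nonneg _) fun v => ?_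
  have h := (spaceTimeDeriv g d).le_opNorm (v, 0)
  rw [spaceTimeDeriv_apply] at h
  simpa using h

theorem abs_le_norm_spaceTimeDeriv (g : E n) (d : ℝ) : |d| ≤ ‖spaceTimeDeriv g d‖ := by
  have h := (spaceTimeDeriv g d).le_opNorm (0, 1)
  rw [spaceTimeDeriv_apply] at h
  simpa using h

theorem hasFDerivAt_spaceTimeDeriv {S : E n → ℝ → ℝ} {x : E n} {t : ℝ}
    (h : DifferentiableAt ℝ (fun p : E n × ℝ => S p.1 p.2) (x, t)) :
    HasFDerivAt (fun p : E n × ℝ => S p.1 p.2) (spaceTimeDeriv (gradX S x t) (derivT S x t))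
      (x, t) := by
  set D := fderiv ℝ (fun p : E n × ℝ => S p.1 p.2) (x, t) with hD
  have hd : HasFDerivAt (fun p : E n × ℝ => S p.1 p.2) D (x, t) := h.hasFDerivAt
  have h1 : HasFDerivAt (fun z => S z t) (D.comp (ContinuousLinearMap.inl ℝ (E n) ℝ)) x :=
    HasFDerivAt.comp (g := fun p : E n × ℝ => S p.1 p.2) (f := fun z : E n => (z, t)) x hd
      (hasFDerivAt_prodMk_left x t)
  have h2 : HasDerivAt (fun s => S x s) (D (0, 1)) t :=
    hd.comp_hasDerivAt (f := fun s => (x, s)) t ((hasDerivAt_const t x).prodMk (hasDerivAt_id t))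
  have e1 : ∀ v, inner ℝ (gradX S x t) v = D (v, 0) := by
    intro v
    rw [gradX, gradient, h1.fderiv, InnerProductSpace.toDual_symm_apply]
    simp
  have e2 : derivT S x t = D (0, 1) := h2.deriv
  refine hd.congr_fderiv (ContinuousLinearMap.ext fun v => ?_)
  rw [spaceTimeDeriv_apply, e1, e2]
  have : v = (v.1, 0) + v.2 • ((0, 1) : E n × ℝ) := by ext <;> simp
  conv_lhs => rw [this]
  rw [map_add, map_smul, smul_eq_mul, mul_comm]

namespace IsRegularizer

variable (hJ : IsRegularizer J)
include hJ

/-- The integral is bounded below on a ball of radius `ε * r` obtained by contracting a ball in the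
interior of `dom J` towards the minimizer `u`, which may itself lie on the boundary. By convexity
the cost there exceeds `S_0` by `O(ε)`, and the volume `ε ^ n * V`, combined with the normalization,
contributes `-(n / 2) * ε * log ε`. Continuity of `B` makes the estimate locally uniform. -/
theorem exists_Seps_le : ∃ B : E n × ℝ → ℝ, ContinuousOn B (spaceTime n) ∧
    ∀ p ∈ spaceTime n, ∀ ε ∈ Ioc (0 : ℝ) 1,
      Seps J ε p.1 p.2 ≤ S0 J p.1 p.2 + (ε * B p - n / 2 * (Real.log ε * ε)) := by
  obtain ⟨x₀, hx₀⟩ := hJ.interior_dom_nonempty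
  obtain ⟨r, hr, hball⟩ := Metric.nhds_basis_closedBall.mem_iff.1 (isOpen_interior.mem_nhds hx₀)
  obtain ⟨M, hM⟩ := (isCompact_closedBall x₀ r).bddAbove_image
    (hJ.continuousOn_realJ.mono hball)
  replace hM : ∀ y ∈ Metric.closedBall x₀ r, realJ J y ≤ M := fun y hy =>
    hM (mem_image_of_mem _ hy)
  set V := (volume (Metric.ball (0 : E n) r)).toReal with hV
  have hVpos : 0 < V := ENNReal.toReal_pos
    (Metric.measure_ball_pos volume _ hr).ne' measure_ball_lt_top.ne
  set D : E n × ℝ → ℝ := fun p => ‖x₀ - uMAP J p.1 p.2‖ + r with hD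
  set A : E n × ℝ → ℝ := fun p =>
    (2 * ‖p.1 - uMAP J p.1 p.2‖ * D p + D p ^ 2) / (2 * p.2) + M with hA
  refine ⟨fun p => A p + n / 2 * Real.log (2 * Real.pi * p.2) - Real.log V, ?_, ?_⟩
  · have hu := hJ.continuousOn_uMAP
    have h1 : ContinuousOn D (spaceTime n) := by
      simp only [hD]
      fun_prop
    have h2 : ∀ p ∈ spaceTime n, 2 * p.2 ≠ 0 := fun p hp =>
      mul_ne_zero two_ne_zero (mem_spaceTime.1 hp).ne'
    have h3 : ∀ p ∈ spaceTime n, 2 * Real.pi * p.2 ≠ 0 := fun p hp =>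
      mul_ne_zero (by positivity) (mem_spaceTime.1 hp).ne'
    have h4 : ContinuousOn A (spaceTime n) := by
      refine (ContinuousOn.div (by fun_prop) (by fun_prop) h2).add continuousOn_const
    refine (h4.add (continuousOn_const.mul (ContinuousOn.log (by fun_prop) h3))).sub
      continuousOn_const
  · rintro ⟨x, t⟩ hp ε ⟨hε, hε1⟩
    have ht : 0 < t := mem_spaceTime.1 hp
    set u := uMAP J x t with hu
    have hud := hJ.uMAP_mem x ht
    have hg0 := hJ.realJ_nonneg u
    set w := (1 - ε) • u + ε • x₀ with hw
    set B := Metric.ball w (ε * r) with hB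
    have hcost : ∀ y ∈ B, Real.exp (-(S0 J x t + ε * A (x, t)) / ε) ≤ weight J x t ε y := by
      intro y hy
      have hyw : ‖y - w‖ < ε * r := by rwa [hB, mem_ball_iff_norm] at hy
      -- Undoing the contraction: `y = (1 - ε) • u + ε • y'` with `y'` in the fixed ball about `x₀`.
      set y' := x₀ + ε⁻¹ • (y - w) with hy'
      have hy'x : ‖y' - x₀‖ ≤ r := by
        rw [hy', add_sub_cancel_left, norm_smul, Real.norm_of_nonneg (by positivity),
          inv_mul_le_iff₀ hε]
        exact hyw.le
      have hy'b : y' ∈ Metric.closedBall x₀ r := mem_closedBall_iff_norm.2 hy'x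
      have hy'd := interior_subset (hball hy'b)
      have hyeq : y = (1 - ε) • u + ε • y' := by
        rw [hy', smul_add, smul_smul, mul_inv_cancel₀ hε.ne', one_smul, hw]
        abel
      have hyd : y ∈ effDom J := by
        rw [hyeq]
        exact hJ.gammaZero.dom_convex hud hy'd (by linarith) hε.le (by ring)
      have hgy : realJ J y ≤ realJ J u + ε * M := by
        have h1 := hJ.convexOn_realJ.2 hud hy'd (by linarith : 0 ≤ 1 - ε) hε.le (by ring)
        rw [← hyeq] at h1
        simp only [smul_eq_mul] at h1
        have h2 := mul_le_mul_of_nonneg_left (hM y' hy'b) hε.le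
        nlinarith
      have hDy : ‖y' - u‖ ≤ D (x, t) := by
        have : y' - u = (x₀ - u) + (y' - x₀) := by abel
        rw [this]
        exact (norm_add_le _ _).trans (by simp only [hD]; gcongr)
      have hnorm : ‖x - y‖ ^ 2 ≤ ‖x - u‖ ^ 2 +
          ε * (2 * ‖x - u‖ * D (x, t) + D (x, t) ^ 2) := by
        have h1 : x - y = (x - u) - ε • (y' - u) := by rw [hyeq]; module
        have h2 : ‖x - y‖ ≤ ‖x - u‖ + ε * D (x, t) := by
          rw [h1]
          refine (norm_sub_le _ _).trans ?_
          rw [norm_smul, Real.norm_of_nonneg hε.le]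
          gcongr
        have h3 : ‖x - y‖ ^ 2 ≤ (‖x - u‖ + ε * D (x, t)) ^ 2 := by gcongr
        have h4 : ε ^ 2 * D (x, t) ^ 2 ≤ ε * D (x, t) ^ 2 := by
          gcongr
          nlinarith
        nlinarith
      rw [weight_of_mem _ _ _ hyd, Real.exp_le_exp, div_le_div_iff_of_pos_right hε, neg_le_neg_iff,
        hJ.S0_eq x ht, ← hu]
      have h5 : ‖x - y‖ ^ 2 / (2 * t) ≤ (‖x - u‖ ^ 2 +
          ε * (2 * ‖x - u‖ * D (x, t) + D (x, t) ^ 2)) / (2 * t) := by gcongr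
      rw [add_div, mul_div_assoc] at h5
      simp only [hA]
      rw [mul_add]
      linarith
    have hvolB : (volume B).toReal = ε ^ n * V := by
      rw [hB, hV, Measure.addHaar_ball_mul_of_pos volume w hε, ENNReal.toReal_mul,
        ENNReal.toReal_ofReal (by positivity)]
      simp
    have hi := hJ.integrable_weight x ht hε
    have hZ : ε ^ n * V * Real.exp (-(S0 J x t + ε * A (x, t)) / ε) ≤ partitionFn J x t ε := by
      calc _ = ∫ _ in B, Real.exp (-(S0 J x t + ε * A (x, t)) / ε) := by
            rw [setIntegral_const, smul_eq_mul, Measure.real, hvolB]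
        _ ≤ ∫ y in B, weight J x t ε y :=
            setIntegral_mono_on (integrableOn_const (hs := measure_ball_lt_top.ne))
              hi.integrableOn Metric.isOpen_ball.measurableSet hcost
        _ ≤ _ := setIntegral_le_integral hi (ae_of_all _ (weight_nonneg J x t ε))
    have hlog := Real.log_le_log (by positivity) hZ
    rw [Real.log_mul (by positivity) (Real.exp_pos _).ne', Real.log_mul (by positivity) hVpos.ne',
      Real.log_pow, Real.log_exp] at hlog
    have h6 := mul_le_mul_of_nonneg_left hlog hε.le
    have h7 : ε * (-(S0 J x t + ε * A (x, t)) / ε) = -(S0 J x t + ε * A (x, t)) := by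
      field_simp
    rw [mul_add, h7] at h6
    simp only
    rw [hJ.Seps_eq_sub_log x ht hε, Real.log_mul (by positivity) hε.ne']
    linarith

theorem eventually_dist_Seps_lt {K : Set (E n × ℝ)} (hK : K ⊆ spaceTime n) (hKc : IsCompact K)
    {η : ℝ} (hη : 0 < η) :
    ∀ᶠ ε in 𝓝[>] (0 : ℝ), ∀ p ∈ K, dist (S0 J p.1 p.2) (Seps J ε p.1 p.2) < η := by
  obtain ⟨B, hB, hle⟩ := hJ.exists_Seps_le
  obtain ⟨b, hb⟩ := hKc.bddAbove_image (hB.mono hK)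
  have hlim : Tendsto (fun ε : ℝ => ε * b - n / 2 * (Real.log ε * ε)) (𝓝[>] 0) (𝓝 0) := by
    have h1 : Tendsto (fun ε : ℝ => ε * b) (𝓝[>] 0) (𝓝 0) := by
      have := (continuous_mul_const b).tendsto 0
      rw [zero_mul] at this
      exact this.mono_left nhdsWithin_le_nhds
    have h2 : Tendsto (fun ε : ℝ => Real.log ε * ε) (𝓝[>] 0) (𝓝 0) := by
      simpa using tendsto_log_mul_rpow_nhdsGT_zero one_pos
    simpa using h1.sub (h2.const_mul ((n : ℝ) / 2))
  filter_upwards [hlim.eventually (gt_mem_nhds hη), Ioc_mem_nhdsGT (one_pos (α := ℝ))]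
    with ε h1 hε p hp
  have ht := mem_spaceTime.1 (hK hp)
  have h2 := hle p (hK hp) ε hε
  have h3 := hJ.S0_le_Seps p.1 ht hε.1
  have h4 : ε * B p ≤ ε * b := mul_le_mul_of_nonneg_left (hb (mem_image_of_mem _ hp)) hε.1.le
  rw [dist_comm, Real.dist_eq, abs_of_nonneg (by linarith)]
  linarith

omit hJ in
theorem _root_.ViscousHJ.eventually_mul_lt_of_continuousOn {K : Set (E n × ℝ)} (hKc : IsCompact K)
    {g : E n × ℝ → ℝ} (hg : ContinuousOn g K) {η : ℝ} (hη : 0 < η) :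
    ∀ᶠ ε in 𝓝[>] (0 : ℝ), ∀ p ∈ K, |ε * g p| < η := by
  obtain ⟨b, hb⟩ := hKc.bddAbove_image hg.abs
  have hlim : Tendsto (fun ε : ℝ => ε * b) (𝓝[>] 0) (𝓝 0) := by
    have := (continuous_mul_const b).tendsto 0
    rw [zero_mul] at this
    exact this.mono_left nhdsWithin_le_nhds
  filter_upwards [hlim.eventually (gt_mem_nhds hη), self_mem_nhdsWithin] with ε h1 hε p hp
  replace hε : 0 < ε := hε
  rw [abs_mul, abs_of_pos hε]
  exact (mul_le_mul_of_nonneg_left (hb (mem_image_of_mem _ hp)) hε.le).trans_lt h1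

/-- The jointly convex functions are `S_ε - n * ε / 2 * log t`. Their correction vanishes locally
uniformly, so they also converge to `S_0`, and convexity passes this on to the differentials. -/
theorem eventually_dist_spaceTimeDeriv_lt {K : Set (E n × ℝ)} (hK : K ⊆ spaceTime n)
    (hKc : IsCompact K) {η : ℝ} (hη : 0 < η) :
    ∀ᶠ ε in 𝓝[>] (0 : ℝ), ∀ p ∈ K,
      ‖spaceTimeDeriv (gradX (Seps J ε) p.1 p.2 - gradX (S0 J) p.1 p.2)
        (derivT (Seps J ε) p.1 p.2 - n * ε / 2 * p.2⁻¹ - derivT (S0 J) p.1 p.2)‖ < η := by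
  have h := tendstoUniformlyOn_fderiv_of_convexOn (l := 𝓝[>] (0 : ℝ)) (isOpen_spaceTime (n := n))
    (F := fun ε p => Seps J ε p.1 p.2 - n * ε / 2 * Real.log p.2)
    (F' := fun ε p => spaceTimeDeriv (gradX (Seps J ε) p.1 p.2)
      (derivT (Seps J ε) p.1 p.2 - n * ε / 2 * p.2⁻¹))
    (f := fun p => S0 J p.1 p.2)
    (f' := fun p => spaceTimeDeriv (gradX (S0 J) p.1 p.2) (derivT (S0 J) p.1 p.2))
    ?_ hJ.convexOn_S0 ?_ ?_ ?_ hK hKc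
  · filter_upwards [Metric.tendstoUniformlyOn_iff.1 h η hη] with ε hε p hp
    have := hε p hp
    rwa [dist_comm, dist_eq_norm, spaceTimeDeriv_sub] at this
  · filter_upwards [self_mem_nhdsWithin] with ε hε
    replace hε : 0 < ε := hε
    refine ⟨hJ.convexOn_Seps_sub_log hε, fun p hp => ?_⟩
    have hp2 := mem_spaceTime.1 hp
    have h1 := hasFDerivAt_spaceTimeDeriv (((contDiffAt_of_contDiffOn_spaceTime
      (hJ.contDiffOn_Seps hε) p.1 hp2)).differentiableAt (by simp))
    have h2 : HasFDerivAt (fun p : E n × ℝ => n * ε / 2 * Real.log p.2)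
        ((n * ε / 2) • (p.2⁻¹ • ContinuousLinearMap.snd ℝ (E n) ℝ)) p :=
      ((hasFDerivAt_snd (𝕜 := ℝ) (p := p)).log hp2.ne').const_mul _
    refine (h1.sub h2).congr_fderiv (ContinuousLinearMap.ext fun v => ?_)
    rw [sub_apply, spaceTimeDeriv_apply, spaceTimeDeriv_apply]
    simp
    ring
  · exact fun p hp => hasFDerivAt_spaceTimeDeriv
      (hJ.hasFDerivAt_S0 p.1 (mem_spaceTime.1 hp)).differentiableAt
  · have hc := hJ.continuousOn_slopeMAP
    have h2 : ContinuousOn (fun p : E n × ℝ => spaceTimeDeriv (slopeMAP J p.1 p.2)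
        (-(‖slopeMAP J p.1 p.2‖ ^ 2 / 2))) (spaceTime n) := by
      unfold spaceTimeDeriv
      fun_prop
    refine h2.congr fun p hp => ?_
    simp only
    rw [hJ.gradX_S0 p.1 (mem_spaceTime.1 hp), hJ.derivT_S0 p.1 (mem_spaceTime.1 hp)]
  · intro K hK hKc
    rw [Metric.tendstoUniformlyOn_iff]
    intro η hη
    have hlog : ContinuousOn (fun p : E n × ℝ => (n : ℝ) / 2 * Real.log p.2) K :=
      continuousOn_const.mul (continuousOn_snd.log fun p hp => (mem_spaceTime.1 (hK hp)).ne')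
    filter_upwards [hJ.eventually_dist_Seps_lt hK hKc (half_pos hη),
      eventually_mul_lt_of_continuousOn hKc hlog (half_pos hη)] with ε h1 h2 p hp
    have h3 := abs_lt.1 (h1 p hp)
    have h4 := abs_lt.1 (h2 p hp)
    rw [Real.dist_eq, abs_lt]
    constructor <;> linarith

theorem convergesLocUnif_Seps : ConvergesLocUnif (fun ε x t => Seps J ε x t) (S0 J) :=
  convergesLocUnif_of_compact fun _ hK hKc _ hη => hJ.eventually_dist_Seps_lt hK hKc hη

theorem eventually_norm_gradX_sub_lt {K : Set (E n × ℝ)} (hK : K ⊆ spaceTime n)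
    (hKc : IsCompact K) {η : ℝ} (hη : 0 < η) :
    ∀ᶠ ε in 𝓝[>] (0 : ℝ), ∀ p ∈ K, ‖gradX (Seps J ε) p.1 p.2 - gradX (S0 J) p.1 p.2‖ < η :=
  (hJ.eventually_dist_spaceTimeDeriv_lt hK hKc hη).mono fun _ h p hp =>
    (norm_le_norm_spaceTimeDeriv _ _).trans_lt (h p hp)

theorem eventually_abs_derivT_sub_lt {K : Set (E n × ℝ)} (hK : K ⊆ spaceTime n)
    (hKc : IsCompact K) {η : ℝ} (hη : 0 < η) :
    ∀ᶠ ε in 𝓝[>] (0 : ℝ), ∀ p ∈ K, |derivT (Seps J ε) p.1 p.2 - derivT (S0 J) p.1 p.2| < η := by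
  have hinv : ContinuousOn (fun p : E n × ℝ => (n : ℝ) / 2 * p.2⁻¹) K :=
    continuousOn_const.mul (continuousOn_snd.inv₀ fun p hp => (mem_spaceTime.1 (hK hp)).ne')
  filter_upwards [hJ.eventually_dist_spaceTimeDeriv_lt hK hKc (half_pos hη),
    eventually_mul_lt_of_continuousOn hKc hinv (half_pos hη)] with ε h1 h2 p hp
  have h3 := abs_lt.1 ((abs_le_norm_spaceTimeDeriv _ _).trans_lt (h1 p hp))
  have h4 := abs_lt.1 (h2 p hp)
  rw [abs_lt]
  constructor <;> linarith

theorem convergesLocUnif_gradX :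
    ConvergesLocUnif (fun ε x t => gradX (Seps J ε) x t) (gradX (S0 J)) := by
  refine convergesLocUnif_of_compact fun K hK hKc η hη => ?_
  filter_upwards [hJ.eventually_norm_gradX_sub_lt hK hKc hη] with ε h p hp
  rw [dist_comm, dist_eq_norm]
  exact h p hp

theorem convergesLocUnif_derivT :
    ConvergesLocUnif (fun ε x t => derivT (Seps J ε) x t) (derivT (S0 J)) := by
  refine convergesLocUnif_of_compact fun K hK hKc η hη => ?_
  filter_upwards [hJ.eventually_abs_derivT_sub_lt hK hKc hη] with ε h p hp
  rw [dist_comm, Real.dist_eq]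
  exact h p hp

/-- No second-derivative estimate is needed: the viscous equation expresses the term through first
derivatives, whose limits satisfy the first-order equation. -/
theorem convergesLocUnif_lapX :
    ConvergesLocUnif (fun ε x t => ε / 2 * lapX (Seps J ε) x t) (fun _ _ => (0 : ℝ)) := by
  refine convergesLocUnif_of_compact fun K hK hKc η hη => ?_
  obtain ⟨b, hb⟩ := hKc.bddAbove_image (hJ.continuousOn_slopeMAP.mono hK).norm
  set b' := max b 0 with hb'
  have hb0 : 0 ≤ b' := le_max_right _ _
  -- The bound `σ ≤ 1` controls the gradient norm by `b' + 1`; the other bound makes `σ * (2 * b' +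
  -- 1)`, which dominates the difference of squared gradients, less than `η`.
  set σ := min 1 (η / (2 * (b' + 1))) with hσ
  have hσ0 : 0 < σ := lt_min one_pos (by positivity)
  filter_upwards [hJ.eventually_abs_derivT_sub_lt hK hKc (half_pos hη),
    hJ.eventually_norm_gradX_sub_lt hK hKc hσ0, self_mem_nhdsWithin] with ε h1 h2 hε p hp
  have hp2 := mem_spaceTime.1 (hK hp)
  set G := gradX (Seps J ε) p.1 p.2
  set g := gradX (S0 J) p.1 p.2 with hg
  have hgb : ‖g‖ ≤ b' := by
    rw [hg, hJ.gradX_S0 p.1 hp2]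
    exact (hb (mem_image_of_mem _ hp)).trans (le_max_left _ _)
  have h3 : |‖G‖ - ‖g‖| < σ := (abs_norm_sub_norm_le G g).trans_lt (h2 p hp)
  have hsq : |‖G‖ ^ 2 - ‖g‖ ^ 2| ≤ σ * (2 * b' + 1) := by
    have e : ‖G‖ ^ 2 - ‖g‖ ^ 2 = (‖G‖ - ‖g‖) * (‖G‖ + ‖g‖) := by ring
    rw [e, abs_mul, abs_of_nonneg (by positivity : 0 ≤ ‖G‖ + ‖g‖)]
    have h4 : ‖G‖ + ‖g‖ ≤ 2 * b' + 1 := by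
      have := (abs_lt.1 h3).2
      have : σ ≤ 1 := min_le_left _ _
      linarith
    exact mul_le_mul h3.le h4 (by positivity) hσ0.le
  have hsq' : σ * (2 * b' + 1) < η := by
    have h5 : σ ≤ η / (2 * (b' + 1)) := min_le_right _ _
    rw [le_div_iff₀ (by positivity)] at h5
    nlinarith
  have hpde := (hJ.isViscousSolution_Seps hε).pde p.1 p.2 hp2
  have hpde0 := hJ.isFirstOrderSolution_S0.pde p.1 p.2 hp2
  have h6 := abs_lt.1 (h1 p hp)
  have h7 := abs_le.1 hsq
  rw [dist_comm, Real.dist_eq, sub_zero, ← hpde, abs_lt]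
  constructor <;> linarith

theorem convergesLocUnif_uPM : ConvergesLocUnif (fun ε x t => uPM J x t ε) (uMAP J) := by
  refine convergesLocUnif_of_compact fun K hK hKc η hη => ?_
  obtain ⟨b, hb⟩ := hKc.bddAbove_image (continuousOn_snd (s := K))
  set b' := max b 0 with hb'
  have hb0 : 0 ≤ b' := le_max_right _ _
  filter_upwards [hJ.eventually_norm_gradX_sub_lt hK hKc (div_pos hη (by positivity : 0 < b' + 1)),
    self_mem_nhdsWithin] with ε h1 hε p hp
  have hp2 := mem_spaceTime.1 (hK hp)
  have hpb : p.2 ≤ b' := (hb (mem_image_of_mem _ hp)).trans (le_max_left _ _)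
  rw [hJ.uPM_eq p.1 hp2 hε, hJ.uMAP_eq p.1 hp2, dist_eq_norm, sub_sub_sub_cancel_left, ← smul_sub,
    norm_smul, Real.norm_of_nonneg hp2.le]
  calc p.2 * ‖gradX (Seps J ε) p.1 p.2 - gradX (S0 J) p.1 p.2‖
      ≤ b' * (η / (b' + 1)) := mul_le_mul hpb (h1 p hp).le (norm_nonneg _) hb0
    _ < (b' + 1) * (η / (b' + 1)) := by
        refine mul_lt_mul_of_pos_right (by linarith) (by positivity)
    _ = η := by field_simp

end IsRegularizer

end ViscousHJ

end

/-! ### Assembly of the four statements. -/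

open ViscousHJ in
theorem theorem3p1 (n : ℕ) (hn : 1 ≤ n) (J : E n → EReal) (hJ : IsRegularizer J) :
    -- (i) well-posedness of the integral, existence and uniqueness, initial limits
    (∀ ε : ℝ, ε > 0 →
      (∀ x, ∀ t > 0, Integrable (weight J x t ε) ∧ 0 < partitionFn J x t ε) ∧
      IsViscousSolution J ε (Seps J ε) ∧
      (∀ S : E n → ℝ → ℝ, IsViscousSolution J ε S → ∀ x, ∀ t > 0, S x t = Seps J ε x t) ∧
      (∀ x, ∀ t > 0,
        partitionFn J x t ε = ∫ y in effDom J, weight J x t ε y ∧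
        partitionFn J x t ε = ∫ y in interior (effDom J), weight J x t ε y ∧
        partitionFn J x t ε = ∫ y in subdiffDom J, weight J x t ε y) ∧
      (∀ x ∈ interior (effDom J),
        Tendsto (fun t => (Seps J ε x t : EReal)) (𝓝[>] 0) (𝓝 (J x))) ∧
      (∀ x ∈ effDom J \ interior (effDom J),
        J x ≤ liminf (fun t => (Seps J ε x t : EReal)) (𝓝[>] 0) ∧
        limsup (fun t => (Seps J ε x t : EReal)) (𝓝[>] 0) ≤
          J x - ((ε * Real.log (1 / (2 * Real.pi * ε) ^ ((n : ℝ) / 2) *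
            ∫ y in effDom J, Real.exp (-(1 / (2 * ε)) * ‖x - y‖ ^ 2)) : ℝ) : EReal))) ∧
    (effDom J =ᵐ[volume] interior (effDom J) ∧ effDom J =ᵐ[volume] subdiffDom J) ∧
    -- (ii) convexity and monotonicity
    (∀ ε > 0, ConvexOn ℝ (spaceTime n)
      (fun p : E n × ℝ => Seps J ε p.1 p.2 - n * ε / 2 * Real.log p.2)) ∧
    (∀ ε > 0, ∀ x, StrictAntiOn (fun t => Seps J ε x t - n * ε / 2 * Real.log t) (Ioi 0)) ∧
    (∀ x, ∀ t > 0, StrictAntiOn (fun ε => Seps J ε x t / ε - n / 2 * Real.log ε) (Ioi 0)) ∧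
    (∀ ε > 0, ∀ t > 0, StrictConvexOn ℝ univ (fun x => 1 / 2 * ‖x‖ ^ 2 - t * Seps J ε x t)) ∧
    -- (iii) posterior mean and mean squared error
    (∀ ε > 0, ∀ t > 0,
      (∀ x,
        Integrable (fun y => weight J x t ε y • y) ∧
        Integrable (fun y => weight J x t ε y • ‖y - uPM J x t ε‖ ^ 2) ∧
        uPM J x t ε = x - t • gradX (Seps J ε) x t ∧
        mse J x t ε = t * ε * divergence (fun z => uPM J z t ε) x ∧
        mse J x t ε = n * t * ε - t ^ 2 * ε * lapX (Seps J ε) x t) ∧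
      Differentiable ℝ (fun x => uPM J x t ε) ∧
      BijOn (fun x => uPM J x t ε) univ (interior (effDom J))) ∧
    -- (iv) the limit of vanishing viscosity
    ((∀ x, ∀ t > 0, (S0 J x t : EReal) = ⨅ y, mapCost J x t y) ∧
      IsFirstOrderSolution J (S0 J) ∧
      (∀ x, ∀ t > 0, (∀ y, mapCost J x t (uMAP J x t) ≤ mapCost J x t y) ∧
        ∀ v, (∀ y, mapCost J x t v ≤ mapCost J x t y) → v = uMAP J x t) ∧
      ConvergesLocUnif (fun ε x t => Seps J ε x t) (S0 J) ∧
      ConvergesLocUnif (fun ε x t => gradX (Seps J ε) x t) (gradX (S0 J)) ∧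
      ConvergesLocUnif (fun ε x t => derivT (Seps J ε) x t) (derivT (S0 J)) ∧
      ConvergesLocUnif (fun ε x t => ε / 2 * lapX (Seps J ε) x t) (fun _ _ => (0 : ℝ)) ∧
      ConvergesLocUnif (fun ε x t => uPM J x t ε) (uMAP J)) := by
  refine ⟨fun ε hε => ⟨fun x t ht => ⟨hJ.integrable_weight x ht hε, hJ.partitionFn_pos x ht hε⟩,
      hJ.isViscousSolution_Seps hε, fun S hS x t ht => hJ.eq_Seps_of_isViscousSolution hε hS x ht,
      fun x t _ => ?_, fun x hx => hJ.tendsto_Seps_of_mem_interior hε hx,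
      fun x hx => ⟨hJ.le_liminf_Seps hε x, hJ.limsup_Seps_le hε hx.1⟩⟩,
    ⟨hJ.effDom_ae_eq_interior, hJ.effDom_ae_eq_subdiffDom⟩,
    fun ε hε => hJ.convexOn_Seps_sub_log hε, fun ε hε x => hJ.strictAntiOn_time hn hε x,
    fun x t ht => hJ.strictAntiOn_viscosity hn x ht,
    fun ε hε t ht => hJ.strictConvexOn_half_norm_sq_sub ht hε,
    fun ε hε t ht => ⟨fun x => ⟨hJ.integrable_weight_smul_id x ht hε,
      hJ.integrable_weight_smul_norm_sub_sq x _ ht hε, hJ.uPM_eq x ht hε, ?_,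
      hJ.mse_eq x ht hε⟩, hJ.differentiable_uPM ht hε, hJ.bijOn_uPM ht hε⟩,
    fun x t ht => hJ.coe_S0 x ht, hJ.isFirstOrderSolution_S0,
    fun x t ht => ⟨hJ.mapCost_uMAP_le x ht, fun v hv => hJ.eq_uMAP ht hv⟩,
    hJ.convergesLocUnif_Seps, hJ.convergesLocUnif_gradX, hJ.convergesLocUnif_derivT,
    hJ.convergesLocUnif_lapX, hJ.convergesLocUnif_uPM⟩
  · have h := partitionFn_eq_setIntegral (J := J) x t ε
    exact ⟨h, h.trans (setIntegral_congr_set hJ.effDom_ae_eq_interior),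
      h.trans (setIntegral_congr_set hJ.effDom_ae_eq_subdiffDom)⟩
  · rw [hJ.mse_eq x ht hε, hJ.divergence_uPM x ht hε]
    ring
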